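/- Let $\langle x\rangle=(1+x^2)^{1/2}$, $0<\mu<2$, $m_\infty\ge 0$, and let $V:\mathbb R\to\mathbb R$ be a symbol in $S^{-\mu}$, i.e. $V\in C^\infty(\mathbb R)$ and for every $\alpha\in\mathbb N$ there is $C_\alpha$ with $|\partial_x^\alpha V(x)|\le C_\alpha\langle x\rangle^{-\mu-\alpha}$ for all $x$. Assume that $V$ is negative near infinity: there are $c,R>0$ with $V(x)\le -c\langle x\rangle^{-\mu}$ for $|x|\ge R$. Let $h=-\frac{d^2}{dx^2}+V+m_\infty^2$ on $L^2(\mathbb R)$. All powers $z^\alpha$ are principal ($-\pi<\arg z\le\pi$). Assume that $h$ has no zero energy resonance, i.e. there is no solution $u$ of $-u''+Vu=0$ on $\mathbb R$ such that, for some constants $u_\pm\neq0$, as $x\to\pm\infty$, $$u(x)=u_\pm V(x)^{-1/4}e^{\mp\int_0^xV(s)^{1/2}ds}(1+o(1)),\qquad u'(x)=\mp u_\pm V(x)^{1/4}e^{\mp\int_0^xV(s)^{1/2}ds}(1+o(1)).$$ For $k\in\mathbb R\setminus\{0\}$ let $F(x,k)=\lim_{\varepsilon\downarrow0}(V(x)-(k+i\varepsilon)^2)^{1/2}$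 and $S(x,k)=\int_0^xF(y,k)\,dy$. Then for each $k>0$ there are solutions $\eta_\pm(\cdot,k)$ of $-u''+Vu=k^2u$ on $\mathbb R$ with the quasiclassical asymptotics $$\eta_\pm=F^{-1/2}e^{\mp S}(1+o(1)),\qquad \eta_\pm'=\mp F^{1/2}e^{\mp S}(1+o(1)),\qquad x\to\pm\infty .$$ Put $\theta_+(x,k)=|k|^{1/2}e^{\int_0^{\infty}\mathrm{Re}\,F(y,k)dy}\,\eta_+(x,k)$, $\theta_-(x,k)=|k|^{1/2}e^{\int_{-\infty}^0\mathrm{Re}\,F(y,k)dy}\,\eta_-(x,k)$ and $m(k)=(2ik)^{-1}(\theta_+'\theta_--\theta_+\theta_-')(0,k)$. Then $m(k)\ne0$ for all $k>0$, and there is a family of functions $\{\psi(\cdot,k)\}_{k\in\mathbb R}$ with $$\psi(x,k)=m(k)^{-1}\theta_+(x,k)\ (k>0),\qquad \psi(x,k)=m(-k)^{-1}\theta_-(x,-k)\ (k<0),$$ and a family $\{\psi_l\}_{l\in I}$, with $I=\mathbb N$ or $I\subset\mathbb N$ finite, which together form a basis of (generalized) eigenfunctions of $h$: $\psi_l\in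 L^2(\mathbb R)$, $\psi(\cdot,k)\in\mathcal S'(\mathbb R)$, $h\psi_l=\epsilon_l\psi_l$ with $\epsilon_l\le m_\infty^2$, $h\psi(\cdot,k)=(k^2+m_\infty^2)\psi(\cdot,k)$ for all $k\in\mathbb R$ (in the sense of distributions), and $$\sum_{l\in I}|\psi_l)(\psi_l|+\frac1{2\pi}\int_{\mathbb R}|\psi(\cdot,k))(\psi(\cdot,k)|\,dk=\mathbf 1$$ (as sesquilinear forms on $\mathcal S(\mathbb R)$). Moreover condition (BM2) holds with the weight $M(x)=\langle x\rangle^{\mu/4}$: there is a constant $C$ such that $$\|M^{-1}(\cdot)\,\psi(\cdot,k)\|_{L^\infty(\mathbb R)}\le C\qquad\text{for all }k\in\mathbb R .$$ -/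

import Mathlib

open Filter Topology MeasureTheory
open scoped SchwartzMap ContDiff NNReal ComplexConjugate

noncomputable section

/-- The Japanese bracket `⟨x⟩ = (1 + x²)^{1/2}`. -/
def bracket (x : ℝ) : ℝ := Real.sqrt (1 + x ^ 2)

/-- Real symbols of order `ρ` on the line: `V` is smooth and `|∂^α V(x)| ≤ C_α ⟨x⟩^{ρ - α}` for
all `α ∈ ℕ`. -/
def IsSymbol (ρ : ℝ) (V : ℝ → ℝ) : Prop :=
  ContDiff ℝ ∞ V ∧
    ∀ α : ℕ, ∃ C : ℝ, ∀ x : ℝ, |iteratedDeriv α V x| ≤ C * bracket x ^ (ρ - (α : ℝ))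

/-- `u` is a (complex valued, `C²`) solution of `-u'' + V u = E u` on the whole line. -/
def IsSolution (V : ℝ → ℝ) (E : ℝ) (u : ℝ → ℂ) : Prop :=
  ContDiff ℝ 2 u ∧ ∀ x : ℝ, -deriv (deriv u) x + (V x : ℂ) * u x = (E : ℂ) * u x

/-- The Wronskian `W(f, g) = f' g - f g'` at the point `x`. -/
def wronskianAt (f g : ℝ → ℂ) (x : ℝ) : ℂ := deriv f x * g x - f x * deriv g x

/-! ### Zero energy resonances -/

/-- The phase `∫_0^x V(s)^{1/2} ds`, with the principal branch of the square root
(so `V^{1/2} = i |V|^{1/2}` where `V < 0`). -/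
def zeroPhase (V : ℝ → ℝ) (x : ℝ) : ℂ := ∫ s in (0 : ℝ)..x, (V s : ℂ) ^ (1 / 2 : ℂ)

/-- `-d²/dx² + V` has a zero energy resonance: there is a solution of `-u'' + V u = 0` with
`u = u_± V^{-1/4} e^{∓ ∫_0^x V^{1/2}} (1 + o(1))` and
`u' = ∓ u_± V^{1/4} e^{∓ ∫_0^x V^{1/2}} (1 + o(1))` as `x → ± ∞`, for constants `u_± ≠ 0`. -/
def HasZeroEnergyResonance (V : ℝ → ℝ) : Prop :=
  ∃ (u : ℝ → ℂ) (up um : ℂ), up ≠ 0 ∧ um ≠ 0 ∧ IsSolution V 0 u ∧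
    Tendsto (fun x : ℝ => u x /
      (up * (V x : ℂ) ^ (-1 / 4 : ℂ) * Complex.exp (-zeroPhase V x))) atTop (𝓝 1) ∧
    Tendsto (fun x : ℝ => deriv u x /
      (-up * (V x : ℂ) ^ (1 / 4 : ℂ) * Complex.exp (-zeroPhase V x))) atTop (𝓝 1) ∧
    Tendsto (fun x : ℝ => u x /
      (um * (V x : ℂ) ^ (-1 / 4 : ℂ) * Complex.exp (zeroPhase V x))) atBot (𝓝 1) ∧
    Tendsto (fun x : ℝ => deriv u x /
      (um * (V x : ℂ) ^ (1 / 4 : ℂ) * Complex.exp (zeroPhase V x))) atBot (𝓝 1)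

/-! ### Quasiclassical solutions -/

/-- `F(x, k) = (V(x) - k²)^{1/2}` for real `k`, as the boundary value of `(V(x) - ζ²)^{1/2}`
(principal branch) when `ζ → k`, `Im ζ > 0`. For `k > 0`, `V(x) - ζ²` approaches the real axis from
below, so `F = -i (k² - V)^{1/2}` where `V < k²`; for `k < 0` it approaches it from above, so
`F = i (k² - V)^{1/2}` there. -/
def eikonal (V : ℝ → ℝ) (k x : ℝ) : ℂ :=
  if 0 < k then conj (((V x - k ^ 2 : ℝ) : ℂ) ^ (1 / 2 : ℂ))
  else ((V x - k ^ 2 : ℝ) : ℂ) ^ (1 / 2 : ℂ)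

/-- The phase `S(0, x, k) = ∫_0^x F(y, k) dy`. -/
def phase (V : ℝ → ℝ) (k x : ℝ) : ℂ := ∫ y in (0 : ℝ)..x, eikonal V k y

/-- `η` is the quasiclassical solution `η_+(·, k)`: a solution of `-η'' + V η = k² η` with
`η = F^{-1/2} e^{-S} (1 + o(1))`, `η' = -F^{1/2} e^{-S} (1 + o(1))` as `x → +∞`. -/
def IsQuasiclassicalPlus (V : ℝ → ℝ) (k : ℝ) (η : ℝ → ℂ) : Prop :=
  IsSolution V (k ^ 2) η ∧
    Tendsto (fun x : ℝ => η x /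
      (eikonal V k x ^ (-1 / 2 : ℂ) * Complex.exp (-phase V k x))) atTop (𝓝 1) ∧
    Tendsto (fun x : ℝ => deriv η x /
      (-(eikonal V k x ^ (1 / 2 : ℂ)) * Complex.exp (-phase V k x))) atTop (𝓝 1)

/-- `η` is the quasiclassical solution `η_-(·, k)`: a solution of `-η'' + V η = k² η` with
`η = F^{-1/2} e^{S} (1 + o(1))`, `η' = F^{1/2} e^{S} (1 + o(1))` as `x → -∞`. -/
def IsQuasiclassicalMinus (V : ℝ → ℝ) (k : ℝ) (η : ℝ → ℂ) : Prop :=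
  IsSolution V (k ^ 2) η ∧
    Tendsto (fun x : ℝ => η x /
      (eikonal V k x ^ (-1 / 2 : ℂ) * Complex.exp (phase V k x))) atBot (𝓝 1) ∧
    Tendsto (fun x : ℝ => deriv η x /
      (eikonal V k x ^ (1 / 2 : ℂ) * Complex.exp (phase V k x))) atBot (𝓝 1)

/-- The normalization `θ_+(x, k) = |k|^{1/2} exp(∫_0^∞ Re F(y, k) dy) η_+(x, k)`. For `k ≠ 0` and
`V` continuous and tending to `0` at infinity, `Re F(·, k)` is continuous with compact support. -/
def jostPlus (V : ℝ → ℝ) (k : ℝ) (η : ℝ → ℂ) (x : ℝ) : ℂ :=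
  η x * ((Real.sqrt |k| * Real.exp (∫ y in Set.Ioi (0 : ℝ), (eikonal V k y).re) : ℝ) : ℂ)

/-- The normalization `θ_-(x, k) = |k|^{1/2} exp(∫_{-∞}^0 Re F(y, k) dy) η_-(x, k)`. -/
def jostMinus (V : ℝ → ℝ) (k : ℝ) (η : ℝ → ℂ) (x : ℝ) : ℂ :=
  η x * ((Real.sqrt |k| * Real.exp (∫ y in Set.Iio (0 : ℝ), (eikonal V k y).re) : ℝ) : ℂ)

/-- `m(k) = (2 i k)^{-1} W(θ_+(·, k), θ_-(·, k))`; the Wronskian does not depend on the point, and is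
taken at `0`. -/
def jostM (k : ℝ) (θp θm : ℝ → ℂ) : ℂ := (2 * Complex.I * (k : ℂ))⁻¹ * wronskianAt θp θm 0

/-- `{ψ(·, k)}` is the family of distorted plane waves built from the quasiclassical solutions
`η_±`: `m(k) ≠ 0` for `k > 0`, and `ψ(x, k) = m(k)^{-1} θ_+(x, k)` for `k > 0`,
`ψ(x, k) = m(-k)^{-1} θ_-(x, -k)` for `k < 0`. Nothing is prescribed at `k = 0`. -/
def IsQuasiclassicalFamily (V : ℝ → ℝ) (ηp ηm ψ : ℝ → ℝ → ℂ) : Prop :=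
  ∀ k : ℝ, 0 < k →
    IsQuasiclassicalPlus V k (ηp k) ∧ IsQuasiclassicalMinus V k (ηm k) ∧
    jostM k (jostPlus V k (ηp k)) (jostMinus V k (ηm k)) ≠ 0 ∧
    (∀ x : ℝ, ψ k x =
      (jostM k (jostPlus V k (ηp k)) (jostMinus V k (ηm k)))⁻¹ * jostPlus V k (ηp k) x) ∧
    (∀ x : ℝ, ψ (-k) x =
      (jostM k (jostPlus V k (ηp k)) (jostMinus V k (ηm k)))⁻¹ * jostMinus V k (ηm k) x)

/-! ### Bases of generalized eigenfunctions and condition (BM2) -/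

/-- The function `φ` defines a tempered distribution by integration against test functions. -/
def IsTemperedFunction (φ : ℝ → ℂ) : Prop :=
  ∃ T : 𝓢(ℝ, ℂ) →L[ℂ] ℂ, ∀ f : 𝓢(ℝ, ℂ),
    Integrable (fun x => φ x * f x) ∧ T f = ∫ x, φ x * f x

/-- `(-d²/dx² + c) φ = E φ` in the sense of tempered distributions. -/
def IsDistribEigenfunction (c : ℝ → ℝ) (E : ℝ) (φ : ℝ → ℂ) : Prop :=
  ∀ f : 𝓢(ℝ, ℂ),
    Integrable (fun x => φ x * (-deriv (deriv f) x + (c x : ℂ) * f x)) ∧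
    ∫ x, φ x * (-deriv (deriv f) x + (c x : ℂ) * f x) = (E : ℂ) * ∫ x, φ x * f x

/-- The pairing `(u | v) = ∫ conj(u) v dx`. -/
def pairing (u v : ℝ → ℂ) : ℂ := ∫ x, conj (u x) * v x

/-- The families `{φ_l}_{l ∈ I}` and `{ψ(·, k)}_{k ∈ ℝ}` form a basis of (generalized)
eigenfunctions of `h = -d²/dx² + V + m²`. The resolution of the identity
`∑ |φ_l)(φ_l| + (2π)^{-1} ∫ |ψ(·, k))(ψ(·, k)| dk = 1` is an identity of sesquilinear forms on
the Schwartz space, which is dense in `L²`. -/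
structure IsEigenfunctionBasis (V : ℝ → ℝ) (m : ℝ) (I : Set ℕ) (ev : I → ℝ)
    (φ : I → ℝ → ℂ) (ψ : ℝ → ℝ → ℂ) : Prop where
  index : I = Set.univ ∨ I.Finite
  memLp : ∀ l, MemLp (φ l) 2 volume
  tempered : ∀ k, IsTemperedFunction (ψ k)
  discrete : ∀ l, IsDistribEigenfunction (fun x => V x + m ^ 2) (ev l) (φ l)
  ev_le : ∀ l, ev l ≤ m ^ 2
  continuous : ∀ k, IsDistribEigenfunction (fun x => V x + m ^ 2) (k ^ 2 + m ^ 2) (ψ k)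
  summable : ∀ f g : 𝓢(ℝ, ℂ), Summable fun l => pairing f (φ l) * pairing (φ l) g
  integrable : ∀ f g : 𝓢(ℝ, ℂ), Integrable fun k => pairing f (ψ k) * pairing (ψ k) g
  complete : ∀ f g : 𝓢(ℝ, ℂ),
    (∑' l, pairing f (φ l) * pairing (φ l) g) +
      (1 / (2 * Real.pi) : ℂ) * (∫ k, pairing f (ψ k) * pairing (ψ k) g) = pairing f g

/-- Condition (BM2) with weight `M`: `‖M⁻¹ ψ(·, k)‖_∞ ≤ C` for all `k ∈ ℝ`. -/
def ConditionBM2 (M : ℝ → ℝ) (ψ : ℝ → ℝ → ℂ) : Prop :=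
  ∃ C : ℝ≥0, ∀ k : ℝ, eLpNorm (fun x => ((M x)⁻¹ : ℂ) * ψ k x) ⊤ volume ≤ C

end

/-! The whole spectral resolution is read off from one scalar function, without appeal to the
spectral theorem. For a test function `f` put g(z) = (f, (-d²/dx² + V - z)⁻¹ f), Im z > 0. Green's
identities show that g is holomorphic, that Im g ≥ 0 and |g| Im z ≤ ‖f‖², and that y Im g(iy) → ‖f‖²
(`isHerglotz_resolventForm`). If the boundary values of such a function consist of isolated point
masses on (-∞, 0) and a continuous density on [0, ∞), then Poisson's formula forces their total mass
to be ‖f‖² (`HasBoundaryValues.total_mass`). With the masses and the density computed explicitly,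
this is Parseval's identity for `f`. Density of test functions and polarization give the resolution
of the identity on the Schwartz space.

The explicit computation rests on the resolvent kernel -a(max) b(min) / W, where a and b solve the
equation and decay at +∞ and -∞, and W is their Wronskian. The solutions have the form F^(-1/2)
e^(-S) y with F = (Q - z)^(1/2), S the integral of F, and y the solution of a Volterra equation from
+∞ (`volterra_exists`, `WKBData.exists_isWKBFamily`). For symbols the error density is O(⟨x⟩^(μ/2 -
2)), integrable because μ < 2, as long as |Q - z| ≥ c⟨x⟩^(-μ) (`wkbData_of_symbol`). Turning points
are avoided by taking Q = V + B with B smooth and compactly supported; the difference Q - V is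
simply part of the error. Three choices of B cover the half-planes Im z > δ and Re z < -δ and the
closed first quadrant. In the quadrant, negativity of V near infinity allows Q ≤ -c⟨x⟩^(-μ)
everywhere, which makes the construction uniform down to z = 0.

On the negative axis W is holomorphic; its zeros are isolated and simple, and the residue of g is
minus the square of the pairing of `f` with a normalized eigenfunction (`exists_atom`). Eigenvalues
may accumulate at 0, but the mass in (-δ, 0) is at most of order δ Im g(iδ), which tends to 0.

On [0, ∞) the solutions a and b carry fluxes 2i and -2i. Hence |W|² = 4 + |X|² with X the Wronskian
of conj a and b, so |W| ≥ 2 and m(k) ≠ 0 (`two_le_norm_wronskian`). The same identities show that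
the jump of Green's function is the rank-two kernel a ⊗ conj a + b ⊗ conj b (`green_jump`), so the
density of g at l = k² is a multiple of the sum of the squared pairings of `f` with ψ(·, k) and ψ(·,
-k). Condition (BM2) follows because √k |u| is bounded uniformly in x and k for the solutions u just
constructed (|F| ≥ k and e^(-S) is unimodular when Q < 0) and |W| ≥ 2. -/

/-! ### Volterra equations with parameters -/

/-- Holomorphic dependence of an integral on a parameter, under local domination. -/
theorem differentiableOn_integral_of_dominated {X : Type*} [MeasurableSpace X] {ν : Measure X}
    {U : Set ℂ} (hU : IsOpen U) {Φ : ℂ → X → ℂ}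
    (hmeas : ∀ z ∈ U, AEStronglyMeasurable (Φ z) ν)
    (hdom : ∀ z₀ ∈ U, ∃ s ∈ 𝓝 z₀, ∃ b : X → ℝ, Integrable b ν ∧
      ∀ᵐ p ∂ν, ∀ z ∈ s ∩ U, ‖Φ z p‖ ≤ b p)
    (hhol : ∀ p, DifferentiableOn ℂ (fun z => Φ z p) U) :
    DifferentiableOn ℂ (fun z => ∫ p, Φ z p ∂ν) U := by
  intro z₀ hz₀
  obtain ⟨s, hs, b, hb, hsb⟩ := hdom z₀ hz₀
  obtain ⟨r, hr, hrs⟩ := Metric.mem_nhds_iff.1 (inter_mem hs (hU.mem_nhds hz₀))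
  have hsub : ∀ z ∈ Metric.ball z₀ (r / 2), Metric.closedBall z (r / 4) ⊆ s ∩ U := by
    intro z hz w hw
    apply hrs
    rw [Metric.mem_ball] at hz ⊢
    rw [Metric.mem_closedBall] at hw
    linarith [dist_triangle w z z₀]
  have hd : ∀ p, ∀ z ∈ Metric.ball z₀ (r / 2),
      HasDerivAt (fun z => Φ z p) (deriv (fun z => Φ z p) z) z := by
    intro p z hz
    have hzU : z ∈ U := (hsub z hz (Metric.mem_closedBall_self (by positivity))).2
    exact ((hhol p).differentiableAt (hU.mem_nhds hzU)).hasDerivAt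
  have hz₀b : z₀ ∈ Metric.ball z₀ (r / 2) := Metric.mem_ball_self (by positivity)
  -- The derivative is a pointwise limit of difference quotients along a sequence of real
  -- increments, hence measurable in `p`.
  have hmeas' : AEStronglyMeasurable (fun p => deriv (fun z => Φ z p) z₀) ν := by
    obtain ⟨v, -, hv, hvlim⟩ := exists_seq_strictAnti_tendsto' (show (0 : ℝ) < r by exact hr)
    have hvU : ∀ n, z₀ + (v n : ℂ) ∈ U := by
      intro n
      refine (hrs ?_).2
      have := hv n
      rw [Metric.mem_ball, dist_eq_norm, add_sub_cancel_left, Complex.norm_real, Real.norm_eq_abs,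
        abs_of_pos this.1]
      exact this.2
    refine aestronglyMeasurable_of_tendsto_ae atTop
      (f := fun n p => (v n : ℂ)⁻¹ • (Φ (z₀ + v n) p - Φ z₀ p)) (fun n => ?_) ?_
    · exact ((hmeas _ (hvU n)).sub (hmeas _ hz₀)).const_smul (𝕜 := ℂ) _
    · refine Eventually.of_forall fun p => ?_
      have h1 := hasDerivAt_iff_tendsto_slope_zero.1 (hd p z₀ hz₀b)
      refine h1.comp (tendsto_nhdsWithin_iff.2 ⟨?_, Eventually.of_forall fun n => ?_⟩)
      · have := (Complex.continuous_ofReal.tendsto 0).comp hvlim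
        simpa [Function.comp_def] using this
      · simpa using (hv n).1.ne'
  have key := hasDerivAt_integral_of_dominated_loc_of_deriv_le (μ := ν)
    (F := Φ) (F' := fun z p => deriv (fun z => Φ z p) z) (x₀ := z₀)
    (bound := fun p => b p / (r / 4)) (Metric.ball_mem_nhds z₀ (by positivity : 0 < r / 2))
    (by
      filter_upwards [hU.mem_nhds hz₀] with z hz using hmeas z hz)
    (hb.mono' (hmeas z₀ hz₀) (hsb.mono fun p hp =>
      hp z₀ (hsub z₀ hz₀b (Metric.mem_closedBall_self (by positivity)))))
    hmeas'
    -- Cauchy's estimate on circles of radius `r / 4` converts the bound on the integrand into one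
    -- on its derivative.
    (hsb.mono fun p hp z hz => by
      refine Complex.norm_deriv_le_of_forall_mem_sphere_norm_le (by positivity) ?_ ?_
      · refine DifferentiableOn.diffContOnCl ?_
        rw [closure_ball _ (by positivity : r / 4 ≠ 0)]
        exact (hhol p).mono fun w hw => (hsub z hz hw).2
      · intro w hw
        exact hp w (hsub z hz (Metric.sphere_subset_closedBall hw)))
    (hb.div_const _)
    (Eventually.of_forall fun p z hz => hd p z hz)
  exact key.2.differentiableAt.differentiableWithinAt

theorem hasDerivAt_integral_Ioi {E : Type*} [NormedAddCommGroup E] [NormedSpace ℝ E]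
    [CompleteSpace E] {f : ℝ → E} (hf : Continuous f) {x : ℝ}
    (hi : IntegrableOn f (Set.Ioi x)) :
    HasDerivAt (fun x => ∫ t in Set.Ioi x, f t) (-f x) x := by
  have h : ∀ y, ∫ t in Set.Ioi y, f t = (∫ t in Set.Ioi x, f t) - ∫ t in x..y, f t := by
    intro y
    have hy : IntegrableOn f (Set.Ioi y) := by
      rcases le_total x y with h | h
      · exact hi.mono_set (Set.Ioi_subset_Ioi h)
      · rw [← Set.Ioc_union_Ioi_eq_Ioi h]
        exact (hf.integrableOn_Ioc).union hi
    rw [eq_sub_iff_add_eq', intervalIntegral.integral_interval_add_Ioi hi hy]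
  have h2 : HasDerivAt (fun y => ∫ t in x..y, f t) (f x) x :=
    (hf.integral_hasStrictDerivAt x x).hasDerivAt
  simpa [funext h] using h2.const_sub (∫ t in Set.Ioi x, f t)

theorem tendsto_setIntegral_Ioi_zero {ρ : ℝ → ℝ} (hρ : Integrable ρ) :
    Tendsto (fun t => ∫ s in Set.Ioi t, ρ s) atTop (𝓝 0) := by
  have h := intervalIntegral_tendsto_integral_Ioi 0 hρ.integrableOn tendsto_id
  have h2 : ∀ t, ∫ s in Set.Ioi t, ρ s = (∫ s in Set.Ioi 0, ρ s) - ∫ s in (0 : ℝ)..t, ρ s := by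
    intro t
    rw [eq_sub_iff_add_eq', intervalIntegral.integral_interval_add_Ioi hρ.integrableOn
      hρ.integrableOn]
  rw [funext h2]
  simpa using h.const_sub (∫ s in Set.Ioi 0, ρ s)

/-- Exponential weights absorb an integrable kernel. -/
theorem setIntegral_Ioi_mul_exp_tail {ρ : ℝ → ℝ} (hρc : Continuous ρ) (hρ : Integrable ρ)
    (h0 : ∀ t, 0 ≤ ρ t) (x : ℝ) :
    ∫ t in Set.Ioi x, ρ t * Real.exp (2 * ∫ s in Set.Ioi t, ρ s) =
      (Real.exp (2 * ∫ s in Set.Ioi x, ρ s) - 1) / 2 := by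
  have hd : ∀ t, HasDerivAt (fun t => -Real.exp (2 * ∫ s in Set.Ioi t, ρ s) / 2)
      (ρ t * Real.exp (2 * ∫ s in Set.Ioi t, ρ s)) t := by
    intro t
    have h1 := hasDerivAt_integral_Ioi hρc (x := t) hρ.integrableOn
    exact ((((h1.const_mul 2).exp).neg).div_const 2).congr_deriv (by ring)
  have hlim := tendsto_setIntegral_Ioi_zero hρ
  have hlim' : Tendsto (fun t => -Real.exp (2 * ∫ s in Set.Ioi t, ρ s) / 2) atTop (𝓝 (-1 / 2)) := by
    have := ((Real.continuous_exp.tendsto _).comp (hlim.const_mul 2)).neg.div_const 2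
    simpa using this
  rw [integral_Ioi_of_hasDerivAt_of_nonneg' (fun t _ => hd t)
    (fun t _ => mul_nonneg (h0 t) (Real.exp_pos _).le) hlim']
  ring

/-- In the sup norm with weight e(x) = exp(2 ∫_x^∞ ρ) the Volterra operator is a contraction with
constant 1/2, because ∫_x^∞ ρ e = (e(x) - 1)/2; no smallness of `ρ` is needed. The predicate `H` is
any property stable under the iteration and under uniform limits in the parameter. It serves to
carry holomorphy through the fixed point without making `Z` a complex manifold. -/
theorem volterra_exists {Z : Type*} [TopologicalSpace Z] [FirstCountableTopology Z]
    {κ : ℝ → ℝ → Z → ℂ} {γ : ℝ → Z → ℂ} {ρ : ℝ → ℝ}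
    (hκ : Continuous fun p : ℝ × ℝ × Z => κ p.1 p.2.1 p.2.2)
    (hκ1 : ∀ x t z, ‖κ x t z‖ ≤ 1) (hκ0 : ∀ x t z, t ≤ x → κ x t z = 0)
    (hγ : Continuous fun p : ℝ × Z => γ p.1 p.2) (hγρ : ∀ t z, ‖γ t z‖ ≤ ρ t)
    (hρ : Integrable ρ) (hρc : Continuous ρ) (H : (Z → ℂ) → Prop) (H0 : H fun _ => 0)
    (Hlim : ∀ (F : ℕ → Z → ℂ) (f : Z → ℂ), TendstoUniformly F f atTop → (∀ n, H (F n)) → H f)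
    (Hstep : ∀ y : ℝ → Z → ℂ, (Continuous fun p : ℝ × Z => y p.1 p.2) →
      (∃ C, ∀ x z, ‖y x z‖ ≤ C) → (∀ t, H (y t)) →
      ∀ x, H fun z => 1 - ∫ t, κ x t z * γ t z * y t z) :
    ∃ y : ℝ → Z → ℂ, (Continuous fun p : ℝ × Z => y p.1 p.2) ∧ (∃ C, ∀ x z, ‖y x z‖ ≤ C) ∧
      (∀ x z, y x z = 1 - ∫ t, κ x t z * γ t z * y t z) ∧ ∀ x, H (y x) := by
  have hρ0 : ∀ t, 0 ≤ ρ t ∨ IsEmpty Z := by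
    intro t
    rcases isEmpty_or_nonempty Z with h | ⟨⟨z⟩⟩
    · exact Or.inr h
    · exact Or.inl ((norm_nonneg _).trans (hγρ t z))
  -- Nonnegativity of `ρ` is only available through the bound on `γ` at some parameter.
  rcases isEmpty_or_nonempty Z with hZ | ⟨⟨z₀⟩⟩
  · refine ⟨fun _ _ => 0, continuous_const, ⟨0, by simp⟩, fun x z => (hZ.false z).elim, fun x => H0⟩
  replace hρ0 : ∀ t, 0 ≤ ρ t := fun t => (norm_nonneg _).trans (hγρ t z₀)
  set N : ℝ → ℝ := fun x => ∫ s in Set.Ioi x, ρ s with hN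
  have hNc : Continuous N := continuous_iff_continuousAt.2 fun x =>
    (hasDerivAt_integral_Ioi hρc (x := x) hρ.integrableOn).continuousAt
  have hN0 : ∀ x, 0 ≤ N x := fun x => integral_nonneg hρ0
  set M : ℝ := ∫ s, ρ s
  have hNM : ∀ x, N x ≤ M := fun x => setIntegral_le_integral hρ (Eventually.of_forall hρ0)
  set e : ℝ → ℝ := fun x => Real.exp (2 * N x) with he
  have hec : Continuous e := by fun_prop
  have he1 : ∀ x, 1 ≤ e x := fun x => Real.one_le_exp (by have := hN0 x; positivity)
  have heM : ∀ x, e x ≤ Real.exp (2 * M) := fun x => Real.exp_le_exp.2 (by linarith [hNM x])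
  have he0 : ∀ x, 0 < e x := fun x => Real.exp_pos _
  have hint : Integrable fun t => ρ t * e t := by
    refine (hρ.mul_const (Real.exp (2 * M))).mono' (hρc.mul hec).aestronglyMeasurable
      (Eventually.of_forall fun t => ?_)
    rw [Real.norm_of_nonneg (mul_nonneg (hρ0 t) (he0 t).le)]
    exact mul_le_mul_of_nonneg_left (heM t) (hρ0 t)
  -- the integral operator applied to `e * w`
  have hbd : ∀ (w : ℝ → Z → ℂ) (A : ℝ), (∀ x z, ‖w x z‖ ≤ A) → ∀ x t z,
      ‖κ x t z * γ t z * ((e t : ℂ) * w t z)‖ ≤ (Set.Ioi x).indicator (fun t => A * (ρ t * e t)) t := by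
    intro w A hA x t z
    by_cases htx : t ∈ Set.Ioi x
    · rw [Set.indicator_of_mem htx, norm_mul, norm_mul, norm_mul, Complex.norm_real,
        Real.norm_of_nonneg (he0 t).le]
      calc ‖κ x t z‖ * ‖γ t z‖ * (e t * ‖w t z‖) ≤ 1 * ρ t * (e t * A) := by
            gcongr
            · exact mul_nonneg zero_le_one (hρ0 t)
            · exact hκ1 x t z
            · exact hγρ t z
            · exact hA t z
        _ = A * (ρ t * e t) := by ring
    · rw [Set.indicator_of_notMem htx, hκ0 x t z (not_lt.1 htx)]
      simp
  have hbd' : ∀ (w : ℝ → Z → ℂ) (A : ℝ), (∀ x z, ‖w x z‖ ≤ A) → ∀ x t z,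
      ‖κ x t z * γ t z * ((e t : ℂ) * w t z)‖ ≤ A * (ρ t * e t) := by
    intro w A hA x t z
    refine (hbd w A hA x t z).trans (Set.indicator_le_self' (fun t _ => ?_) t)
    exact mul_nonneg ((norm_nonneg _).trans (hA x z)) (mul_nonneg (hρ0 t) (he0 t).le)
  have hcont : ∀ w : ℝ → Z → ℂ, (Continuous fun p : ℝ × Z => w p.1 p.2) → ∀ t,
      Continuous fun p : ℝ × Z => κ p.1 t p.2 * γ t p.2 * ((e t : ℂ) * w t p.2) := by
    intro w hw t
    have h1 : Continuous fun p : ℝ × Z => κ p.1 t p.2 :=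
      hκ.comp (continuous_fst.prodMk (continuous_const.prodMk continuous_snd))
    have h2 : Continuous fun p : ℝ × Z => γ t p.2 := hγ.comp (continuous_const.prodMk continuous_snd)
    have h3 : Continuous fun p : ℝ × Z => w t p.2 := hw.comp (continuous_const.prodMk continuous_snd)
    exact (h1.mul h2).mul (continuous_const.mul h3)
  have hmeas : ∀ w : ℝ → Z → ℂ, (Continuous fun p : ℝ × Z => w p.1 p.2) → ∀ x z,
      AEStronglyMeasurable (fun t => κ x t z * γ t z * ((e t : ℂ) * w t z)) := by
    intro w hw x z
    have h1 : Continuous fun t => κ x t z :=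
      hκ.comp (continuous_const.prodMk (continuous_id.prodMk continuous_const))
    have h2 : Continuous fun t => γ t z := hγ.comp (continuous_id.prodMk continuous_const)
    have h3 : Continuous fun t => w t z := hw.comp (continuous_id.prodMk continuous_const)
    exact ((h1.mul h2).mul ((Complex.continuous_ofReal.comp hec).mul h3)).aestronglyMeasurable
  have hintw : ∀ w : ℝ → Z → ℂ, (Continuous fun p : ℝ × Z => w p.1 p.2) → ∀ A,
      (∀ x z, ‖w x z‖ ≤ A) → ∀ x z,
      Integrable (fun t => κ x t z * γ t z * ((e t : ℂ) * w t z)) := fun w hw A hA x z =>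
    (hint.const_mul A).mono' (hmeas w hw x z) (Eventually.of_forall fun t => hbd' w A hA x t z)
  have hTb : ∀ (w : ℝ → Z → ℂ) (A : ℝ), 0 ≤ A → (∀ x z, ‖w x z‖ ≤ A) → ∀ x z,
      ‖∫ t, κ x t z * γ t z * ((e t : ℂ) * w t z)‖ ≤ A * (e x / 2) := by
    intro w A hA0 hA x z
    calc ‖∫ t, κ x t z * γ t z * ((e t : ℂ) * w t z)‖
        ≤ ∫ t, (Set.Ioi x).indicator (fun t => A * (ρ t * e t)) t :=
          norm_integral_le_of_norm_le ((hint.const_mul A).indicator measurableSet_Ioi)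
            (Eventually.of_forall fun t => hbd w A hA x t z)
      _ = A * ((e x - 1) / 2) := by
          rw [integral_indicator measurableSet_Ioi, integral_const_mul,
            setIntegral_Ioi_mul_exp_tail hρc hρ hρ0]
      _ ≤ A * (e x / 2) := by gcongr; linarith
  have hTc : ∀ w : ℝ → Z → ℂ, (Continuous fun p : ℝ × Z => w p.1 p.2) → ∀ A,
      (∀ x z, ‖w x z‖ ≤ A) →
      Continuous fun p : ℝ × Z => ∫ t, κ p.1 t p.2 * γ t p.2 * ((e t : ℂ) * w t p.2) :=
    fun w hw A hA => continuous_of_dominated (fun p => hmeas w hw p.1 p.2)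
      (fun p => Eventually.of_forall fun t => hbd' w A hA p.1 t p.2) (hint.const_mul A)
      (Eventually.of_forall fun t => hcont w hw t)
  -- The unknown is y / e, so that the ordinary sup norm becomes the weighted one.
  let T : BoundedContinuousFunction (ℝ × Z) ℂ → BoundedContinuousFunction (ℝ × Z) ℂ := fun w =>
    BoundedContinuousFunction.ofNormedAddCommGroup
      (fun p => ((e p.1)⁻¹ : ℂ) *
        (1 - ∫ t, κ p.1 t p.2 * γ t p.2 * ((e t : ℂ) * w (t, p.2))))
      (by
        have h1 : Continuous fun p : ℝ × Z => ((e p.1 : ℝ) : ℂ)⁻¹ := by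
          refine Continuous.inv₀ (by fun_prop) fun p => ?_
          exact_mod_cast (he0 p.1).ne'
        exact h1.mul (continuous_const.sub
          (hTc (fun x z => w (x, z)) w.continuous ‖w‖ fun x z => w.norm_coe_le_norm _)))
      (1 + ‖w‖)
      (by
        intro p
        rw [norm_mul, norm_inv, Complex.norm_real, Real.norm_of_nonneg (he0 _).le]
        have h2 := hTb (fun x z => w (x, z)) ‖w‖ (norm_nonneg _)
          (fun x z => w.norm_coe_le_norm _) p.1 p.2
        rw [inv_mul_le_iff₀ (he0 _)]
        refine (norm_sub_le _ _).trans ?_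
        rw [norm_one]
        nlinarith [he1 p.1, norm_nonneg w, mul_nonneg (norm_nonneg w) (he0 p.1).le])
  have hTapp : ∀ w p, T w p = ((e p.1)⁻¹ : ℂ) *
        (1 - ∫ t, κ p.1 t p.2 * γ t p.2 * ((e t : ℂ) * w (t, p.2))) := fun w p => rfl
  have hTcontr : ContractingWith (1 / 2) T := by
    refine ⟨by norm_num, LipschitzWith.of_dist_le_mul fun w₁ w₂ => ?_⟩
    rw [BoundedContinuousFunction.dist_le (by positivity)]
    intro p
    rw [hTapp, hTapp, dist_eq_norm, ← mul_sub, sub_sub_sub_cancel_left, ← integral_sub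
      (hintw (fun x z => w₂ (x, z)) w₂.continuous ‖w₂‖ (fun x z => w₂.norm_coe_le_norm _) p.1 p.2)
      (hintw (fun x z => w₁ (x, z)) w₁.continuous ‖w₁‖ (fun x z => w₁.norm_coe_le_norm _) p.1 p.2)]
    have h := hTb (fun x z => (w₂ - w₁) (x, z)) (dist w₁ w₂) dist_nonneg
      (fun x z => by
        rw [dist_comm, dist_eq_norm]
        exact (w₂ - w₁).norm_coe_le_norm _) p.1 p.2
    have heq : ∀ t, κ p.1 t p.2 * γ t p.2 * ((e t : ℂ) * w₂ (t, p.2)) -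
        κ p.1 t p.2 * γ t p.2 * ((e t : ℂ) * w₁ (t, p.2)) =
        κ p.1 t p.2 * γ t p.2 * ((e t : ℂ) * (w₂ - w₁) (t, p.2)) := by
      intro t
      rw [BoundedContinuousFunction.sub_apply]
      ring
    simp_rw [heq]
    rw [norm_mul, norm_inv, Complex.norm_real, Real.norm_of_nonneg (he0 _).le,
      inv_mul_le_iff₀ (he0 _)]
    refine h.trans (le_of_eq ?_)
    push_cast
    ring
  obtain ⟨w, hw, hwlim, -⟩ := hTcontr.exists_fixedPoint 0 (edist_ne_top _ _)
  have hwe : ∀ x z, (e x : ℂ) * w (x, z) =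
      1 - ∫ t, κ x t z * γ t z * ((e t : ℂ) * w (t, z)) := by
    intro x z
    have h := congrArg (fun v => v (x, z)) hw
    simp only [hTapp] at h
    rw [← h, mul_inv_cancel_left₀]
    exact_mod_cast (he0 x).ne'
  have hyc : ∀ v : BoundedContinuousFunction (ℝ × Z) ℂ,
      Continuous fun p : ℝ × Z => (e p.1 : ℂ) * v (p.1, p.2) := fun v => by fun_prop
  have hyb : ∀ v : BoundedContinuousFunction (ℝ × Z) ℂ, ∀ x z,
      ‖(e x : ℂ) * v (x, z)‖ ≤ Real.exp (2 * M) * ‖v‖ := by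
    intro v x z
    rw [norm_mul, Complex.norm_real, Real.norm_of_nonneg (he0 _).le]
    exact mul_le_mul (heM x) (v.norm_coe_le_norm _) (norm_nonneg _) (Real.exp_pos _).le
  refine ⟨fun x z => (e x : ℂ) * w (x, z), hyc w, ⟨_, hyb w⟩, hwe, fun x => ?_⟩
  -- The Picard iterates started at 0 satisfy `H`, and for fixed x they converge uniformly in the
  -- parameter.
  have hH : ∀ n : ℕ, ∀ x, H fun z => (e x : ℂ) * (T^[n] 0) (x, z) := by
    intro n
    induction n with
    | zero => intro x; simpa using H0
    | succ n ih =>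
      intro x
      have h := Hstep _ (hyc (T^[n] 0)) ⟨_, hyb _⟩ ih x
      convert h using 2 with z
      rw [Function.iterate_succ_apply', hTapp, mul_inv_cancel_left₀]
      exact_mod_cast (he0 x).ne'
  refine Hlim (fun n z => (e x : ℂ) * (T^[n] 0) (x, z)) _ ?_ fun n => hH n x
  rw [Metric.tendstoUniformly_iff]
  intro ε hε
  have h1 := (tendsto_iff_dist_tendsto_zero.1 hwlim)
  filter_upwards [h1.eventually (gt_mem_nhds (div_pos hε (he0 x)))] with n hn z
  rw [dist_eq_norm, ← mul_sub, norm_mul, Complex.norm_real, Real.norm_of_nonneg (he0 _).le]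
  rw [lt_div_iff₀ (he0 x), mul_comm] at hn
  refine lt_of_le_of_lt (mul_le_mul_of_nonneg_left ?_ (he0 x).le) hn
  rw [← dist_eq_norm, dist_comm]
  exact BoundedContinuousFunction.dist_coe_le_dist _

/-! ### The outgoing square root -/

/-- The branch of the square root with `arg ∈ (-3π/4, π/4]`. -/
noncomputable def outgoingSqrt (q : ℂ) : ℂ :=
  Complex.exp (-(Real.pi / 4 : ℝ) * Complex.I) * (Complex.I * q) ^ (1 / 2 : ℂ)

/-- The points where `outgoingSqrt` is holomorphic or a boundary value with nonnegative real part. -/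
def IsAdmissible (q : ℂ) : Prop := q ≠ 0 ∧ (q.im ≤ 0 ∨ 0 < q.re)

theorem outgoingSqrt_sq (q : ℂ) : outgoingSqrt q ^ 2 = q := by
  have h1 : ((Complex.I * q) ^ (1 / 2 : ℂ)) ^ 2 = Complex.I * q := by
    rw [one_div]
    exact Complex.cpow_ofNat_inv_pow _ 2
  have h2 : Complex.exp (-(Real.pi / 4 : ℝ) * Complex.I) ^ 2 = -Complex.I := by
    rw [← Complex.exp_nat_mul, show ((2 : ℕ) : ℂ) * (-(Real.pi / 4 : ℝ) * Complex.I) =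
      -(Real.pi / 2 * Complex.I) by push_cast; ring, Complex.exp_neg,
      Complex.exp_pi_div_two_mul_I, Complex.inv_I]
  rw [outgoingSqrt, mul_pow, h1, h2]
  linear_combination -q * Complex.I_mul_I

theorem IsAdmissible.mem_slitPlane {q : ℂ} (hq : IsAdmissible q) :
    Complex.I * q ∈ Complex.slitPlane := by
  rw [Complex.mem_slitPlane_iff]
  simp only [Complex.mul_re, Complex.I_re, Complex.I_im, Complex.mul_im, zero_mul, one_mul,
    zero_sub, zero_add]
  rcases hq with ⟨h0, h | h⟩
  · by_cases him : q.im = 0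
    · right
      intro hre
      exact h0 (Complex.ext hre him)
    · left
      have := lt_of_le_of_ne h him
      linarith
  · right
    linarith

theorem outgoingSqrt_ne_zero {q : ℂ} (hq : q ≠ 0) : outgoingSqrt q ≠ 0 := by
  intro h
  apply hq
  rw [← outgoingSqrt_sq q, h]
  simp

theorem outgoingSqrt_eq_polar {q : ℂ} (hq : q ≠ 0) :
    outgoingSqrt q = ((‖Complex.I * q‖ ^ (1 / 2 : ℝ) : ℝ) : ℂ) *
      Complex.exp ((Complex.arg (Complex.I * q) / 2 - Real.pi / 4 : ℝ) * Complex.I) := by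
  have hIq : Complex.I * q ≠ 0 := mul_ne_zero Complex.I_ne_zero hq
  rw [outgoingSqrt, Complex.cpow_def_of_ne_zero hIq, Complex.log, Real.rpow_def_of_pos
    (norm_pos_iff.2 hIq), Complex.ofReal_exp, ← Complex.exp_add, ← Complex.exp_add]
  congr 1
  push_cast
  ring

/-- If Im q ≤ 0 then |arg(iq)| ≤ π/2, and if Re q > 0 then arg(iq) ≥ 0. In both cases arg(iq)/2 -
π/4, the argument of the root, lies in [-π/2, π/4]. -/
theorem IsAdmissible.re_outgoingSqrt_nonneg {q : ℂ} (hq : IsAdmissible q) :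
    0 ≤ (outgoingSqrt q).re := by
  rw [outgoingSqrt_eq_polar hq.1, Complex.re_ofReal_mul, Complex.exp_ofReal_mul_I_re]
  refine mul_nonneg (by positivity) (Real.cos_nonneg_of_mem_Icc ⟨?_, ?_⟩)
  · rcases hq.2 with h | h
    · have : |Complex.arg (Complex.I * q)| ≤ Real.pi / 2 := by
        rw [Complex.abs_arg_le_pi_div_two_iff]
        simpa using h
      linarith [(abs_le.1 this).1]
    · have : 0 ≤ Complex.arg (Complex.I * q) := by
        rw [Complex.arg_nonneg_iff]
        simpa using h.le
      linarith [Real.pi_pos]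
  · linarith [Complex.arg_le_pi (Complex.I * q), Real.pi_pos]

theorem IsAdmissible.hasDerivAt_outgoingSqrt {q : ℂ} (hq : IsAdmissible q) :
    HasDerivAt outgoingSqrt (1 / (2 * outgoingSqrt q)) q := by
  have h0 := outgoingSqrt_ne_zero hq.1
  have h1 : HasDerivAt (fun q : ℂ => Complex.I * q) (Complex.I * 1) q :=
    (hasDerivAt_id q).const_mul _
  have h2 := (h1.cpow_const (c := 1 / 2) hq.mem_slitPlane).const_mul
    (Complex.exp (-(Real.pi / 4 : ℝ) * Complex.I))
  refine HasDerivAt.congr_deriv h2 ?_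
  have hIq : Complex.I * q ≠ 0 := mul_ne_zero Complex.I_ne_zero hq.1
  rw [Complex.cpow_sub _ _ hIq, Complex.cpow_one]
  have h3 := outgoingSqrt_sq q
  rw [eq_div_iff (by simpa using h0)]
  have h4 : Complex.exp (-(Real.pi / 4 : ℝ) * Complex.I) *
      (1 / 2 * ((Complex.I * q) ^ (1 / 2 : ℂ) / (Complex.I * q)) * (Complex.I * 1)) *
      (2 * outgoingSqrt q) = outgoingSqrt q ^ 2 / q := by
    rw [sq, outgoingSqrt]
    have := hq.1
    field_simp
  rw [h4, h3, div_self hq.1]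

theorem IsAdmissible.continuousAt_outgoingSqrt {q : ℂ} (hq : IsAdmissible q) :
    ContinuousAt outgoingSqrt q :=
  hq.hasDerivAt_outgoingSqrt.continuousAt

theorem mem_slitPlane_of_re_nonneg {w : ℂ} (h : 0 ≤ w.re) (h0 : w ≠ 0) :
    w ∈ Complex.slitPlane := by
  rw [Complex.mem_slitPlane_iff]
  by_contra! hc
  exact h0 (Complex.ext (le_antisymm hc.1 h) hc.2)

/-- Needed to differentiate the amplitudes F^(±1/2) with the principal power. -/
theorem IsAdmissible.outgoingSqrt_mem_slitPlane {q : ℂ} (hq : IsAdmissible q) :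
    outgoingSqrt q ∈ Complex.slitPlane :=
  mem_slitPlane_of_re_nonneg hq.re_outgoingSqrt_nonneg (outgoingSqrt_ne_zero hq.1)

theorem norm_outgoingSqrt (q : ℂ) : ‖outgoingSqrt q‖ = Real.sqrt ‖q‖ := by
  rw [eq_comm, Real.sqrt_eq_iff_mul_self_eq (norm_nonneg _) (norm_nonneg _), ← norm_mul, ← sq,
    outgoingSqrt_sq]

/-- The square is known, so only the sign is in question. The sign found here is that of the limit
from Im q < 0, that is, of `eikonal` for positive momentum. -/
theorem outgoingSqrt_neg_ofReal {a : ℝ} (ha : 0 < a) :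
    outgoingSqrt (-(a : ℂ)) = -Complex.I * Real.sqrt a := by
  have hadm : IsAdmissible (-(a : ℂ)) := ⟨by simpa using ha.ne', Or.inl (by simp)⟩
  have hsq := outgoingSqrt_sq (-(a : ℂ))
  have h2 : (outgoingSqrt (-(a : ℂ)) - -Complex.I * Real.sqrt a) *
      (outgoingSqrt (-(a : ℂ)) + -Complex.I * Real.sqrt a) = 0 := by
    have h3 : ((Real.sqrt a : ℝ) : ℂ) ^ 2 = a := by
      rw [← Complex.ofReal_pow, Real.sq_sqrt ha.le]
    linear_combination hsq + h3 - (Real.sqrt a : ℂ) ^ 2 * Complex.I_sq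
  rcases mul_eq_zero.1 h2 with h | h
  · exact sub_eq_zero.1 h
  · exfalso
    have h5 : outgoingSqrt (-(a : ℂ)) = Complex.I * Real.sqrt a := by linear_combination h
    have h6 : -Real.pi < Complex.arg (Complex.I * -(a : ℂ)) := Complex.neg_pi_lt_arg _
    have h7 : Complex.I * -(a : ℂ) = (a : ℝ) * -Complex.I := by ring
    have h8 : Complex.arg (Complex.I * -(a : ℂ)) = -(Real.pi / 2) := by
      rw [h7, Complex.arg_real_mul _ ha, Complex.arg_neg_I]
    -- The argument of the root is (-π/2)/2 - π/4 = -π/2, which rules out the other sign.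
    have h9 : (outgoingSqrt (-(a : ℂ))).im < 0 := by
      have hIq : Complex.I * -(a : ℂ) ≠ 0 := mul_ne_zero Complex.I_ne_zero hadm.1
      rw [outgoingSqrt_eq_polar hadm.1, h8, Complex.im_ofReal_mul, Complex.exp_ofReal_mul_I_im,
        show -(Real.pi / 2) / 2 - Real.pi / 4 = -(Real.pi / 2) by ring, Real.sin_neg,
        Real.sin_pi_div_two]
      have := norm_pos_iff.2 hIq
      have : 0 < ‖Complex.I * -(a : ℂ)‖ ^ (1 / 2 : ℝ) := Real.rpow_pos_of_pos this _
      linarith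
    rw [h5] at h9
    simp at h9
    linarith [Real.sqrt_nonneg a]

/-! ### Quasiclassical solutions on the whole line -/

/-- The square root `(Q - z)^{1/2}` along the line. -/
noncomputable def wkbRoot (Q : ℝ → ℝ) (x : ℝ) (z : ℂ) : ℂ := outgoingSqrt (Q x - z)

/-- The phase `∫_0^x (Q - z)^{1/2}`. -/
noncomputable def wkbPhase (Q : ℝ → ℝ) (x : ℝ) (z : ℂ) : ℂ := ∫ t in (0 : ℝ)..x, wkbRoot Q t z

/-- The error density of the quasiclassical approximation for `V` built from the phase of `Q`. -/
noncomputable def wkbError (V Q Q1 Q2 : ℝ → ℝ) (x : ℝ) (z : ℂ) : ℂ :=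
  (5 / 16 * (Q1 x / (Q x - z)) ^ 2 - Q2 x / (4 * (Q x - z)) + (Q x - V x)) / wkbRoot Q x z

/-- Hypotheses for the quasiclassical construction, uniformly for spectral parameters in `U`. -/
structure WKBData (V Q Q1 Q2 ρ τ : ℝ → ℝ) (U : Set ℂ) : Prop where
  continuous_V : Continuous V
  deriv_Q : ∀ x, HasDerivAt Q (Q1 x) x
  deriv_Q1 : ∀ x, HasDerivAt Q1 (Q2 x) x
  continuous_Q2 : Continuous Q2
  admissible : ∀ x, ∀ z ∈ U, IsAdmissible (Q x - z)
  continuous_ρ : Continuous ρ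
  integrable_ρ : Integrable ρ
  error_le : ∀ x, ∀ z ∈ U, ‖wkbError V Q Q1 Q2 x z‖ ≤ ρ x
  slow_le : ∀ x, ∀ z ∈ U, ‖(Q1 x : ℂ) / (4 * (Q x - z) * wkbRoot Q x z)‖ ≤ τ x
  tendsto_τ : Tendsto τ atTop (𝓝 0)
  bounded_τ : ∃ T, ∀ x, τ x ≤ T

/-- A family of solutions of `-u'' + V u = z u`, `z ∈ U`, quasiclassical at `+∞`. -/
structure IsWKBFamily (V Q : ℝ → ℝ) (U : Set ℂ) (u u' : ℝ → ℂ → ℂ) : Prop where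
  deriv : ∀ x, ∀ z ∈ U, HasDerivAt (fun x => u x z) (u' x z) x
  deriv' : ∀ x, ∀ z ∈ U, HasDerivAt (fun x => u' x z) ((V x - z) * u x z) x
  cont : ContinuousOn (fun p : ℝ × ℂ => u p.1 p.2) (Set.univ ×ˢ U)
  cont' : ContinuousOn (fun p : ℝ × ℂ => u' p.1 p.2) (Set.univ ×ˢ U)
  hol : IsOpen U → ∀ x, DifferentiableOn ℂ (u x) U
  hol' : IsOpen U → ∀ x, DifferentiableOn ℂ (u' x) U
  bound : ∃ C, ∀ x, ∀ z ∈ U,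
    ‖u x z‖ ≤ C * ‖wkbRoot Q x z ^ (-1 / 2 : ℂ) * Complex.exp (-wkbPhase Q x z)‖
  bound' : ∃ C, ∀ x, ∀ z ∈ U,
    ‖u' x z‖ ≤ C * ‖wkbRoot Q x z ^ (1 / 2 : ℂ) * Complex.exp (-wkbPhase Q x z)‖
  asymp : ∀ z ∈ U, Tendsto (fun x => u x z /
    (wkbRoot Q x z ^ (-1 / 2 : ℂ) * Complex.exp (-wkbPhase Q x z))) atTop (𝓝 1)
  asymp' : ∀ z ∈ U, Tendsto (fun x => u' x z /
    (-(wkbRoot Q x z ^ (1 / 2 : ℂ)) * Complex.exp (-wkbPhase Q x z))) atTop (𝓝 1)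

namespace WKBData

variable {V Q Q1 Q2 ρ τ : ℝ → ℝ} {U : Set ℂ}

theorem continuous_Q (h : WKBData V Q Q1 Q2 ρ τ U) : Continuous Q :=
  continuous_iff_continuousAt.2 fun x => (h.deriv_Q x).continuousAt

theorem continuous_Q1 (h : WKBData V Q Q1 Q2 ρ τ U) : Continuous Q1 :=
  continuous_iff_continuousAt.2 fun x => (h.deriv_Q1 x).continuousAt

theorem root_ne_zero (h : WKBData V Q Q1 Q2 ρ τ U) (x : ℝ) {z : ℂ} (hz : z ∈ U) :
    wkbRoot Q x z ≠ 0 :=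
  outgoingSqrt_ne_zero (h.admissible x z hz).1

theorem root_sq (x : ℝ) (z : ℂ) : wkbRoot Q x z ^ 2 = Q x - z := outgoingSqrt_sq _

theorem continuous_root (h : WKBData V Q Q1 Q2 ρ τ U) :
    Continuous fun p : U × ℝ => wkbRoot Q p.2 p.1 := by
  refine continuous_iff_continuousAt.2 fun p => ?_
  have hQ := h.continuous_Q
  have h1 : ContinuousAt (fun p : U × ℝ => ((Q p.2 : ℝ) : ℂ) - (p.1 : ℂ)) p := by fun_prop
  exact ContinuousAt.comp (f := fun p : U × ℝ => ((Q p.2 : ℝ) : ℂ) - (p.1 : ℂ))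
    (h.admissible p.2 p.1 p.1.2).continuousAt_outgoingSqrt h1

theorem continuous_root_right (h : WKBData V Q Q1 Q2 ρ τ U) {z : ℂ} (hz : z ∈ U) :
    Continuous fun x => wkbRoot Q x z :=
  h.continuous_root.comp (f := fun x : ℝ => ((⟨z, hz⟩ : U), x)) (by fun_prop)

theorem continuous_phase (h : WKBData V Q Q1 Q2 ρ τ U) :
    Continuous fun p : ℝ × U => wkbPhase Q p.1 p.2 := by
  have h1 := intervalIntegral.continuous_parametric_primitive_of_continuous (μ := volume) (a₀ := 0)
    (f := fun (z : U) t => wkbRoot Q t z) h.continuous_root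
  exact h1.comp (f := fun p : ℝ × U => (p.2, p.1)) (by fun_prop)

theorem hasDerivAt_phase (h : WKBData V Q Q1 Q2 ρ τ U) (x : ℝ) {z : ℂ} (hz : z ∈ U) :
    HasDerivAt (fun x => wkbPhase Q x z) (wkbRoot Q x z) x :=
  ((h.continuous_root_right hz).integral_hasStrictDerivAt 0 x).hasDerivAt

theorem hasDerivAt_root (h : WKBData V Q Q1 Q2 ρ τ U) (x : ℝ) {z : ℂ} (hz : z ∈ U) :
    HasDerivAt (fun x => wkbRoot Q x z) (Q1 x / (2 * wkbRoot Q x z)) x := by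
  have h1 : HasDerivAt (fun x => (Q x : ℂ) - z) (Q1 x) x := ((h.deriv_Q x).ofReal_comp).sub_const z
  refine ((h.admissible x z hz).hasDerivAt_outgoingSqrt.comp x h1).congr_deriv ?_
  rw [wkbRoot]
  ring

theorem differentiableOn_root (h : WKBData V Q Q1 Q2 ρ τ U) (x : ℝ) :
    DifferentiableOn ℂ (fun z => wkbRoot Q x z) U := fun z hz =>
  (((h.admissible x z hz).hasDerivAt_outgoingSqrt.comp z
    ((hasDerivAt_id z).const_sub (Q x : ℂ))).differentiableAt).differentiableWithinAt

theorem differentiableOn_phase (h : WKBData V Q Q1 Q2 ρ τ U) (hU : IsOpen U) (x : ℝ) :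
    DifferentiableOn ℂ (fun z => wkbPhase Q x z) U := by
  have key : ∀ a b : ℝ, DifferentiableOn ℂ (fun z => ∫ t in Set.Ioc a b, wkbRoot Q t z) U := by
    intro a b
    refine differentiableOn_integral_of_dominated hU
      (fun z hz => (h.continuous_root_right hz).aestronglyMeasurable) (fun z₀ _ => ?_)
      (fun t => h.differentiableOn_root t)
    refine ⟨Metric.ball z₀ 1, Metric.ball_mem_nhds _ one_pos,
      fun t => Real.sqrt (|Q t| + (‖z₀‖ + 1)), ?_, Eventually.of_forall fun t z hz => ?_⟩
    · have hQ := h.continuous_Q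
      exact Continuous.integrableOn_Ioc (by fun_prop)
    · rw [wkbRoot, norm_outgoingSqrt]
      refine Real.sqrt_le_sqrt ((norm_sub_le _ _).trans (add_le_add ?_ ?_))
      · simp
      · have h1 := Metric.mem_ball.1 hz.1
        rw [dist_eq_norm] at h1
        linarith [norm_sub_norm_le z z₀]
  exact (key 0 x).sub (key x 0)

theorem phase_sub (h : WKBData V Q Q1 Q2 ρ τ U) {z : ℂ} (hz : z ∈ U) (x t : ℝ) :
    wkbPhase Q t z - wkbPhase Q x z = ∫ s in x..t, wkbRoot Q s z :=
  intervalIntegral.integral_interval_sub_left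
    ((h.continuous_root_right hz).intervalIntegrable _ _)
    ((h.continuous_root_right hz).intervalIntegrable _ _)

/-- Since Re F ≥ 0, the factor e^(-2(S(t) - S(x))) has modulus at most 1 for t ≥ x. This makes the
Volterra kernel bounded uniformly in the spectral parameter. -/
theorem re_phase_mono (h : WKBData V Q Q1 Q2 ρ τ U) {z : ℂ} (hz : z ∈ U) {x t : ℝ} (hxt : x ≤ t) :
    (wkbPhase Q x z).re ≤ (wkbPhase Q t z).re := by
  have h1 := h.phase_sub hz x t
  have h2 : (∫ s in x..t, wkbRoot Q s z).re = ∫ s in x..t, (wkbRoot Q s z).re :=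
    (Complex.reCLM.intervalIntegral_comp_comm
      ((h.continuous_root_right hz).intervalIntegrable x t)).symm
  have h3 : 0 ≤ ∫ s in x..t, (wkbRoot Q s z).re :=
    intervalIntegral.integral_nonneg hxt fun s _ => (h.admissible s z hz).re_outgoingSqrt_nonneg
  rw [← h1, Complex.sub_re] at h2
  linarith

theorem norm_exp_phase_le (h : WKBData V Q Q1 Q2 ρ τ U) {z : ℂ} (hz : z ∈ U) {x t : ℝ}
    (hxt : x ≤ t) : ‖Complex.exp (-2 * (wkbPhase Q t z - wkbPhase Q x z))‖ ≤ 1 := by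
  rw [Complex.norm_exp, Real.exp_le_one_iff]
  have := h.re_phase_mono hz hxt
  simp
  linarith

theorem continuous_error (h : WKBData V Q Q1 Q2 ρ τ U) :
    Continuous fun p : ℝ × U => wkbError V Q Q1 Q2 p.1 p.2 := by
  have hQ := h.continuous_Q
  have hQ1 := h.continuous_Q1
  have hQ2 := h.continuous_Q2
  have hV := h.continuous_V
  have h1 : Continuous fun p : ℝ × U => wkbRoot Q p.1 p.2 :=
    h.continuous_root.comp (f := fun p : ℝ × U => (p.2, p.1)) (by fun_prop)
  have h2 : ∀ p : ℝ × U, (Q p.1 : ℂ) - p.2 ≠ 0 := fun p => (h.admissible p.1 p.2 p.2.2).1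
  have h3 : Continuous fun p : ℝ × U => (Q p.1 : ℂ) - p.2 := by fun_prop
  have h4 : Continuous fun p : ℝ × U => (Q1 p.1 : ℂ) / (Q p.1 - p.2) :=
    Continuous.div (by fun_prop) h3 h2
  have h5 : Continuous fun p : ℝ × U => (Q2 p.1 : ℂ) / (4 * (Q p.1 - p.2)) :=
    Continuous.div (by fun_prop) (by fun_prop) fun p => mul_ne_zero (by norm_num) (h2 p)
  exact Continuous.div (by fun_prop) h1 fun p => h.root_ne_zero p.1 p.2.2

theorem differentiableOn_error (h : WKBData V Q Q1 Q2 ρ τ U) (x : ℝ) :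
    DifferentiableOn ℂ (fun z => wkbError V Q Q1 Q2 x z) U := by
  have h2 : ∀ z ∈ U, (Q x : ℂ) - z ≠ 0 := fun z hz => (h.admissible x z hz).1
  have h3 : DifferentiableOn ℂ (fun z => (Q x : ℂ) - z) U := by fun_prop
  have h4 : DifferentiableOn ℂ (fun z => (Q1 x : ℂ) / (Q x - z)) U :=
    (differentiableOn_const _).div h3 h2
  have h5 : DifferentiableOn ℂ (fun z => (Q2 x : ℂ) / (4 * (Q x - z))) U :=
    (differentiableOn_const _).div (h3.const_mul 4) fun z hz =>
      mul_ne_zero (by norm_num) (h2 z hz)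
  exact ((((h4.pow 2).const_mul _).sub h5).add_const _).div (h.differentiableOn_root x)
    fun z hz => h.root_ne_zero x hz

/-- The Volterra kernel of the quasiclassical construction. -/
noncomputable def kernel (Q : ℝ → ℝ) (x t : ℝ) (z : ℂ) : ℂ :=
  (1 - Complex.exp (-2 * (wkbPhase Q (max t x) z - wkbPhase Q x z))) / 2

theorem norm_kernel_le (h : WKBData V Q Q1 Q2 ρ τ U) {z : ℂ} (hz : z ∈ U) (x t : ℝ) :
    ‖kernel Q x t z‖ ≤ 1 := by
  rw [kernel, norm_div]
  have h1 := h.norm_exp_phase_le hz (le_max_right t x)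
  have h2 := norm_sub_le (1 : ℂ) (Complex.exp (-2 * (wkbPhase Q (max t x) z - wkbPhase Q x z)))
  rw [norm_one] at h2
  rw [Complex.norm_ofNat]
  linarith

/-- The `max` in `kernel` lets the kernel vanish continuously for t ≤ x, so an integral over the
whole line is really one over (x, ∞). -/
theorem kernel_of_le {x t : ℝ} (hxt : t ≤ x) (z : ℂ) : kernel Q x t z = 0 := by
  simp [kernel, max_eq_right hxt]

theorem continuous_kernel (h : WKBData V Q Q1 Q2 ρ τ U) :
    Continuous fun p : ℝ × ℝ × U => kernel Q p.1 p.2.1 p.2.2 := by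
  have h1 := h.continuous_phase.comp (f := fun p : ℝ × ℝ × U => (max p.2.1 p.1, p.2.2)) (by fun_prop)
  have h2 := h.continuous_phase.comp (f := fun p : ℝ × ℝ × U => (p.1, p.2.2)) (by fun_prop)
  exact (continuous_const.sub ((continuous_const.mul (h1.sub h2)).cexp)).div_const 2

theorem differentiableOn_kernel (h : WKBData V Q Q1 Q2 ρ τ U) (hU : IsOpen U) (x t : ℝ) :
    DifferentiableOn ℂ (fun z => kernel Q x t z) U := by
  have h1 := h.differentiableOn_phase hU
  exact ((((h1 (max t x)).sub (h1 x)).const_mul (-2)).cexp.const_sub 1).div_const 2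

/-- This is `volterra_exists` with the subtype `U` as parameter space. The inherited property is
holomorphy on `U` when `U` is open; for the closed quadrant it is void and only continuity remains.
-/
theorem exists_amplitude (h : WKBData V Q Q1 Q2 ρ τ U) :
    ∃ y : ℝ → ℂ → ℂ, (Continuous fun p : ℝ × U => y p.1 p.2) ∧
      (∃ C, ∀ x, ∀ z ∈ U, ‖y x z‖ ≤ C) ∧
      (∀ x, ∀ z ∈ U, y x z = 1 - ∫ t, kernel Q x t z * wkbError V Q Q1 Q2 t z * y t z) ∧
      (IsOpen U → ∀ x, DifferentiableOn ℂ (y x) U) := by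
  -- Extension by zero off `U`, so that complex differentiability on `U` can be stated.
  let ex : (U → ℂ) → ℂ → ℂ := fun φ => Function.extend Subtype.val φ 0
  have hex : ∀ (φ : U → ℂ) z (hz : z ∈ U), ex φ z = φ ⟨z, hz⟩ := fun φ z hz =>
    Subtype.val_injective.extend_apply φ 0 ⟨z, hz⟩
  obtain ⟨y, hyc, ⟨C, hC⟩, hyv, hyH⟩ := volterra_exists
    (κ := fun x t (z : U) => kernel Q x t z) (γ := fun t (z : U) => wkbError V Q Q1 Q2 t z) (ρ := ρ)
    h.continuous_kernel (fun x t z => h.norm_kernel_le z.2 x t) (fun x t z hxt => kernel_of_le hxt _)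
    h.continuous_error (fun t z => h.error_le t z z.2) h.integrable_ρ h.continuous_ρ
    (fun φ => IsOpen U → DifferentiableOn ℂ (ex φ) U)
    (fun _ => (differentiableOn_const 0).congr fun z hz => hex _ z hz)
    (fun F f hF hn hU => by
      -- Weierstrass: a locally uniform limit of holomorphic functions is holomorphic.
      refine TendstoLocallyUniformlyOn.differentiableOn (F := fun n => ex (F n)) (φ := atTop) ?_
        (Eventually.of_forall fun n => hn n hU) hU
      refine TendstoUniformlyOn.tendstoLocallyUniformlyOn ?_
      rw [Metric.tendstoUniformlyOn_iff]
      intro ε hε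
      filter_upwards [Metric.tendstoUniformly_iff.1 hF ε hε] with n hn z hz
      rw [hex _ z hz, hex _ z hz]
      exact hn _)
    (fun y hyc ⟨C, hC⟩ hyH x hU => by
      have hyH' := fun t => hyH t hU
      have hd : DifferentiableOn ℂ (fun z => 1 - ∫ t, kernel Q x t z * wkbError V Q Q1 Q2 t z *
          ex (y t) z) U := by
        refine (differentiableOn_integral_of_dominated hU (fun z hz => ?_) (fun z₀ _ => ?_)
          (fun t => ?_)).const_sub 1
        · simp_rw [hex _ z hz]
          have h1 := h.continuous_kernel.comp (f := fun t : ℝ => (x, t, (⟨z, hz⟩ : U))) (by fun_prop)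
          have h2 := h.continuous_error.comp (f := fun t : ℝ => (t, (⟨z, hz⟩ : U))) (by fun_prop)
          have h3 := hyc.comp (f := fun t : ℝ => (t, (⟨z, hz⟩ : U))) (by fun_prop)
          exact ((h1.mul h2).mul h3).aestronglyMeasurable
        · refine ⟨Set.univ, univ_mem, fun t => ρ t * C, h.integrable_ρ.mul_const C,
            Eventually.of_forall fun t z hz => ?_⟩
          rw [hex _ z hz.2, norm_mul, norm_mul]
          have h1 := h.norm_kernel_le hz.2 x t
          have h2 := h.error_le t z hz.2
          have h3 := hC t ⟨z, hz.2⟩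
          have h4 : ‖kernel Q x t z‖ * ‖wkbError V Q Q1 Q2 t z‖ ≤ 1 * ρ t :=
            mul_le_mul h1 h2 (norm_nonneg _) zero_le_one
          rw [one_mul] at h4
          exact mul_le_mul h4 h3 (norm_nonneg _) ((norm_nonneg _).trans h2)
        · exact ((h.differentiableOn_kernel hU x t).mul (h.differentiableOn_error t)).mul (hyH' t)
      refine hd.congr fun z hz => ?_
      rw [hex _ z hz]
      simp_rw [hex _ z hz])
  refine ⟨fun x => ex (y x), ?_, ⟨C, fun x z hz => ?_⟩, fun x z hz => ?_, fun hU x => hyH x hU⟩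
  · convert hyc using 2 with p
    exact hex _ _ p.2.2
  · beta_reduce
    rw [hex _ z hz]
    exact hC _ _
  · simp_rw [hex _ z hz]
    exact hyv x ⟨z, hz⟩

/-- With u = A y and A = F^(-1/2) e^(-S), the equation for u becomes the first-order system y' = F
p, p' = 2F p - g, where g is the error density times y. The Volterra equation is this system
integrated from +∞ with y → 1 and p → 0. The derivative is u' = -A F (y - p + b y) with b =
Q'/(4F³), and b → 0 gives its asymptotics. -/
theorem exists_isWKBFamily (h : WKBData V Q Q1 Q2 ρ τ U) : ∃ u u', IsWKBFamily V Q U u u' := by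
  obtain ⟨y, hyc, ⟨C, hC⟩, hyv, hyhol⟩ := h.exists_amplitude
  rcases U.eq_empty_or_nonempty with rfl | ⟨z₁, hz₁⟩
  · exact ⟨0, 0, by simp, by simp, by simp, by simp, by simp, by simp, ⟨0, by simp⟩, ⟨0, by simp⟩,
      by simp, by simp⟩
  have hC0 : 0 ≤ C := (norm_nonneg _).trans (hC 0 z₁ hz₁)
  have hρ0 : ∀ t, 0 ≤ ρ t := fun t => (norm_nonneg _).trans (h.error_le t z₁ hz₁)
  -- the source term
  let g : ℝ → ℂ → ℂ := fun t z => wkbError V Q Q1 Q2 t z * y t z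
  have hgc : Continuous fun p : ℝ × U => g p.1 p.2 := h.continuous_error.mul hyc
  have hgc' : ∀ z ∈ U, Continuous fun t => g t z := fun z hz =>
    hgc.comp (f := fun t : ℝ => (t, (⟨z, hz⟩ : U))) (by fun_prop)
  have hgb : ∀ t, ∀ z ∈ U, ‖g t z‖ ≤ ρ t * C := fun t z hz => by
    rw [norm_mul]
    exact mul_le_mul (h.error_le t z hz) (hC t z hz) (norm_nonneg _) (hρ0 t)
  have hgi : ∀ z ∈ U, Integrable fun t => g t z := fun z hz =>
    (h.integrable_ρ.mul_const C).mono' (hgc' z hz).aestronglyMeasurable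
      (Eventually.of_forall fun t => hgb t z hz)
  -- This is y'/F. Defining it through y and the tail integral of g makes continuity and holomorphy
  -- immediate; `hpx` gives the form that can be differentiated.
  let p : ℝ → ℂ → ℂ := fun x z => 2 * (y x z - 1) + ∫ t in Set.Ioi x, g t z
  have hei : ∀ z ∈ U, ∀ x, IntegrableOn (fun t => Complex.exp (-2 * wkbPhase Q t z) * g t z)
      (Set.Ioi x) := by
    intro z hz x
    have hph : Continuous fun t => wkbPhase Q t z :=
      h.continuous_phase.comp (f := fun t : ℝ => (t, (⟨z, hz⟩ : U))) (by fun_prop)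
    refine Integrable.mono' (((hgi z hz).norm.const_mul
      ‖Complex.exp (-2 * wkbPhase Q x z)‖).integrableOn)
      ((continuous_const.mul hph).cexp.mul (hgc' z hz)).aestronglyMeasurable ?_
    refine (ae_restrict_iff' measurableSet_Ioi).2 (Eventually.of_forall fun t ht => ?_)
    rw [norm_mul]
    refine mul_le_mul_of_nonneg_right ?_ (norm_nonneg _)
    rw [Complex.norm_exp, Complex.norm_exp, Real.exp_le_exp]
    have := h.re_phase_mono hz (le_of_lt ht)
    simp
    linarith
  have hyx : ∀ x, ∀ z ∈ U, y x z = 1 - (∫ t in Set.Ioi x, g t z) / 2 +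
      Complex.exp (2 * wkbPhase Q x z) *
        (∫ t in Set.Ioi x, Complex.exp (-2 * wkbPhase Q t z) * g t z) / 2 := by
    intro x z hz
    have h1 : ∀ t, kernel Q x t z * wkbError V Q Q1 Q2 t z * y t z =
        (Set.Ioi x).indicator (fun t => g t z / 2 - Complex.exp (2 * wkbPhase Q x z) / 2 *
          (Complex.exp (-2 * wkbPhase Q t z) * g t z)) t := by
      intro t
      by_cases ht : t ∈ Set.Ioi x
      · rw [Set.indicator_of_mem ht, kernel, max_eq_left (le_of_lt ht),
          show -2 * (wkbPhase Q t z - wkbPhase Q x z) = -2 * wkbPhase Q t z + 2 * wkbPhase Q x z by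
            ring, Complex.exp_add]
        simp only [g]
        ring
      · rw [Set.indicator_of_notMem ht, kernel_of_le (not_lt.1 ht), zero_mul, zero_mul]
    rw [hyv x z hz]
    simp_rw [h1]
    rw [integral_indicator measurableSet_Ioi, integral_sub ((hgi z hz).integrableOn.div_const 2)
      ((hei z hz x).const_mul _), integral_const_mul, integral_div]
    ring
  have hpx : ∀ x, ∀ z ∈ U, p x z = Complex.exp (2 * wkbPhase Q x z) *
        (∫ t in Set.Ioi x, Complex.exp (-2 * wkbPhase Q t z) * g t z) := by
    intro x z hz
    simp only [p]
    linear_combination 2 * hyx x z hz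
  have hdG : ∀ x, ∀ z ∈ U, HasDerivAt (fun x => ∫ t in Set.Ioi x, g t z) (-g x z) x :=
    fun x z hz => hasDerivAt_integral_Ioi (hgc' z hz) (hgi z hz).integrableOn
  have hdp : ∀ x, ∀ z ∈ U, HasDerivAt (fun x => p x z) (2 * wkbRoot Q x z * p x z - g x z) x := by
    intro x z hz
    have hph : Continuous fun t => wkbPhase Q t z :=
      h.continuous_phase.comp (f := fun t : ℝ => (t, (⟨z, hz⟩ : U))) (by fun_prop)
    have hcont : Continuous fun t => Complex.exp (-2 * wkbPhase Q t z) * g t z :=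
      ((continuous_const.mul hph).cexp).mul (hgc' z hz)
    have h1 := hasDerivAt_integral_Ioi hcont (hei z hz x)
    have h2 := ((h.hasDerivAt_phase x hz).const_mul 2).cexp
    rw [funext fun x => hpx x z hz]
    refine (h2.mul h1).congr_deriv ?_
    have h3 : Complex.exp (2 * wkbPhase Q x z) * Complex.exp (-2 * wkbPhase Q x z) = 1 := by
      rw [← Complex.exp_add]
      simp
    rw [hpx x z hz]
    linear_combination (-g x z) * h3
  have hdy : ∀ x, ∀ z ∈ U, HasDerivAt (fun x => y x z) (wkbRoot Q x z * p x z) x := by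
    intro x z hz
    have h1 : (fun x => y x z) = fun x => 1 + (p x z - ∫ t in Set.Ioi x, g t z) / 2 := by
      funext x
      simp only [p]
      ring
    rw [h1]
    refine ((((hdp x z hz).sub (hdG x z hz)).div_const 2).const_add 1).congr_deriv ?_
    ring
  have hGb : ∀ x, ∀ z ∈ U, ‖∫ t in Set.Ioi x, g t z‖ ≤ (∫ t in Set.Ioi x, ρ t) * C := by
    intro x z hz
    rw [← integral_mul_const]
    exact norm_integral_le_of_norm_le (h.integrable_ρ.mul_const C).integrableOn
      (Eventually.of_forall fun t => hgb t z hz)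
  -- The monotone phase removes the exponentials, leaving the tail of `ρ`; hence p → 0 and y → 1 at
  -- +∞.
  have hpb : ∀ x, ∀ z ∈ U, ‖p x z‖ ≤ (∫ t in Set.Ioi x, ρ t) * C := by
    intro x z hz
    rw [hpx x z hz, ← integral_const_mul, ← integral_mul_const]
    refine norm_integral_le_of_norm_le (h.integrable_ρ.mul_const C).integrableOn
      ((ae_restrict_iff' measurableSet_Ioi).2 (Eventually.of_forall fun t ht => ?_))
    rw [← mul_assoc, ← Complex.exp_add, show 2 * wkbPhase Q x z + -2 * wkbPhase Q t z =
      -2 * (wkbPhase Q t z - wkbPhase Q x z) by ring, norm_mul]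
    exact (mul_le_of_le_one_left (norm_nonneg _) (h.norm_exp_phase_le hz (le_of_lt ht))).trans
      (hgb t z hz)
  have htail : Tendsto (fun x => (∫ t in Set.Ioi x, ρ t) * C) atTop (𝓝 0) := by
    simpa using (tendsto_setIntegral_Ioi_zero h.integrable_ρ).mul_const C
  have hp0 : ∀ z ∈ U, Tendsto (fun x => p x z) atTop (𝓝 0) := fun z hz =>
    squeeze_zero_norm (fun x => hpb x z hz) htail
  have hG0 : ∀ z ∈ U, Tendsto (fun x => ∫ t in Set.Ioi x, g t z) atTop (𝓝 0) := fun z hz =>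
    squeeze_zero_norm (fun x => hGb x z hz) htail
  have hy1 : ∀ z ∈ U, Tendsto (fun x => y x z) atTop (𝓝 1) := by
    intro z hz
    have h1 : (fun x => y x z) = fun x => 1 + (p x z - ∫ t in Set.Ioi x, g t z) / 2 := by
      funext x
      simp only [p]
      ring
    rw [h1]
    simpa using (((hp0 z hz).sub (hG0 z hz)).div_const 2).const_add 1
  have hpc : Continuous fun q : ℝ × U => p q.1 q.2 := by
    have h1 : Continuous fun q : ℝ × U => ∫ t in Set.Ioi q.1, g t q.2 := by
      have hP : Continuous fun q : ℝ × U => ∫ t in (0 : ℝ)..q.1, g t q.2 := by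
        have h1 := intervalIntegral.continuous_parametric_primitive_of_continuous (μ := volume)
          (a₀ := 0) (f := fun (z : U) t => g t z)
          (hgc.comp (f := fun p : U × ℝ => (p.2, p.1)) (by fun_prop))
        exact h1.comp (f := fun p : ℝ × U => (p.2, p.1)) (by fun_prop)
      have hI : Continuous fun q : ℝ × U => ∫ t in Set.Ioi (0 : ℝ), g t q.2 :=
        continuous_of_dominated (fun q => (hgc' q.2 q.2.2).aestronglyMeasurable)
          (fun q => Eventually.of_forall fun t => hgb t q.2 q.2.2)
          (h.integrable_ρ.mul_const C).integrableOn
          (Eventually.of_forall fun t => hgc.comp (f := fun q : ℝ × U => (t, q.2)) (by fun_prop))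
      convert hI.sub hP using 2 with q
      rw [Pi.sub_apply, eq_sub_iff_add_eq', intervalIntegral.integral_interval_add_Ioi
        (hgi q.2 q.2.2).integrableOn (hgi q.2 q.2.2).integrableOn]
    exact (continuous_const.mul (hyc.sub continuous_const)).add h1
  have hphol : IsOpen U → ∀ x, DifferentiableOn ℂ (p x) U := by
    intro hU x
    refine (((hyhol hU x).sub_const 1).const_mul 2).add ?_
    refine differentiableOn_integral_of_dominated hU
      (fun z hz => (hgc' z hz).aestronglyMeasurable) (fun z₀ _ => ⟨Set.univ, univ_mem,
        fun t => ρ t * C, (h.integrable_ρ.mul_const C).integrableOn,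
        Eventually.of_forall fun t z hz => hgb t z hz.2⟩)
      (fun t => (h.differentiableOn_error t).mul (hyhol hU t))
  -- the solution and its derivative
  let A : ℝ → ℂ → ℂ := fun x z => wkbRoot Q x z ^ (-1 / 2 : ℂ) * Complex.exp (-wkbPhase Q x z)
  have hA0 : ∀ x, ∀ z ∈ U, A x z ≠ 0 := fun x z hz => by
    refine mul_ne_zero ?_ (Complex.exp_ne_zero _)
    rw [Complex.cpow_ne_zero_iff]
    exact Or.inl (h.root_ne_zero x hz)
  have hslit : ∀ x, ∀ z ∈ U, wkbRoot Q x z ∈ Complex.slitPlane := fun x z hz =>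
    (h.admissible x z hz).outgoingSqrt_mem_slitPlane
  have hAd : ∀ x, ∀ z ∈ U, HasDerivAt (fun x => A x z)
      (A x z * (-wkbRoot Q x z - Q1 x / (4 * wkbRoot Q x z ^ 2))) x := by
    intro x z hz
    have hne := h.root_ne_zero x hz
    have h1 : HasDerivAt (fun w : ℂ => w ^ (-1 / 2 : ℂ))
        ((-1 / 2 : ℂ) * wkbRoot Q x z ^ (-1 / 2 - 1 : ℂ) * 1) (wkbRoot Q x z) :=
      (hasDerivAt_id _).cpow_const (hslit x z hz)
    have h2 := h1.comp x (h.hasDerivAt_root x hz)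
    have h3 := (h.hasDerivAt_phase x hz).neg.cexp
    refine (h2.mul h3).congr_deriv ?_
    rw [Complex.cpow_sub _ _ hne, Complex.cpow_one]
    simp only [A, Function.comp, Pi.neg_apply]
    field_simp
    ring
  have hAF : ∀ x, ∀ z ∈ U, A x z * wkbRoot Q x z =
      wkbRoot Q x z ^ (1 / 2 : ℂ) * Complex.exp (-wkbPhase Q x z) := by
    intro x z hz
    have h1 : wkbRoot Q x z ^ (1 / 2 : ℂ) = wkbRoot Q x z ^ (-1 / 2 : ℂ) * wkbRoot Q x z := by
      have h2 := Complex.cpow_add (-1 / 2) 1 (h.root_ne_zero x hz)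
      rw [Complex.cpow_one] at h2
      rw [← h2]
      norm_num
    rw [h1]
    ring
  have hswap : Continuous fun q : ℝ × U => wkbRoot Q q.1 q.2 :=
    h.continuous_root.comp (f := fun p : ℝ × U => (p.2, p.1)) (by fun_prop)
  have hAc : Continuous fun q : ℝ × U => A q.1 q.2 :=
    (hswap.cpow continuous_const fun q => hslit q.1 q.2 q.2.2).mul h.continuous_phase.neg.cexp
  have hAhol : IsOpen U → ∀ x, DifferentiableOn ℂ (A x) U := fun hU x =>
    ((h.differentiableOn_root x).cpow_const fun z hz => hslit x z hz).mul
      (h.differentiableOn_phase hU x).neg.cexp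
  let b : ℝ → ℂ → ℂ := fun x z => (Q1 x : ℂ) / (4 * wkbRoot Q x z ^ 2 * wkbRoot Q x z)
  have hb0 : ∀ x, ∀ z ∈ U, 4 * wkbRoot Q x z ^ 2 * wkbRoot Q x z ≠ 0 := fun x z hz => by
    have := h.root_ne_zero x hz
    simp [this]
  have hbc : Continuous fun q : ℝ × U => b q.1 q.2 := by
    have hQ1 := h.continuous_Q1
    exact Continuous.div (by fun_prop) (by fun_prop) fun q => hb0 q.1 q.2 q.2.2
  have hbhol : ∀ x, DifferentiableOn ℂ (b x) U := fun x =>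
    (differentiableOn_const _).div ((((h.differentiableOn_root x).pow 2).const_mul 4).mul
      (h.differentiableOn_root x)) fun z hz => hb0 x z hz
  have hbτ : ∀ x, ∀ z ∈ U, ‖b x z‖ ≤ τ x := fun x z hz => by
    simp only [b, root_sq]
    exact h.slow_le x z hz
  let u : ℝ → ℂ → ℂ := fun x z => A x z * y x z
  let u' : ℝ → ℂ → ℂ := fun x z => -(A x z * wkbRoot Q x z) * (y x z - p x z + b x z * y x z)
  have toOn : ∀ f : ℝ → ℂ → ℂ, (Continuous fun q : ℝ × U => f q.1 q.2) →
      ContinuousOn (fun q : ℝ × ℂ => f q.1 q.2) (Set.univ ×ˢ U) := by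
    intro f hf
    rw [continuousOn_iff_continuous_domRestrict]
    exact hf.comp (f := fun q : (Set.univ ×ˢ U : Set (ℝ × ℂ)) =>
      (q.1.1, (⟨q.1.2, q.2.2⟩ : U))) (by fun_prop)
  obtain ⟨T, hT⟩ := h.bounded_τ
  refine ⟨u, u', ?_, ?_, ?_, ?_, ?_, ?_, ?_, ?_, ?_, ?_⟩
  · intro x z hz
    have hne := h.root_ne_zero x hz
    refine ((hAd x z hz).mul (hdy x z hz)).congr_deriv ?_
    simp only [u', b]
    field_simp
    ring
  · intro x z hz
    have hne := h.root_ne_zero x hz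
    have hF := h.hasDerivAt_root x hz
    have hbd : HasDerivAt (fun x => b x z) (Q2 x / (4 * wkbRoot Q x z ^ 2 * wkbRoot Q x z) -
        Q1 x * (6 * wkbRoot Q x z * Q1 x) / (4 * wkbRoot Q x z ^ 2 * wkbRoot Q x z) ^ 2) x := by
      refine ((h.deriv_Q1 x).ofReal_comp.div (((hF.pow 2).const_mul 4).mul hF)
        (hb0 x z hz)).congr_deriv ?_
      simp only [Pi.mul_apply, Pi.pow_apply]
      field_simp
      ring
    refine (((hAd x z hz).mul hF).neg.mul (((hdy x z hz).sub (hdp x z hz)).add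
      (hbd.mul (hdy x z hz)))).congr_deriv ?_
    have hg : g x z = (5 / 16 * (Q1 x / wkbRoot Q x z ^ 2) ^ 2 - Q2 x / (4 * wkbRoot Q x z ^ 2) +
        (Q x - V x)) / wkbRoot Q x z * y x z := by
      simp only [g, wkbError, root_sq]
    -- Writing z through F² makes the identity rational in F, and the definition of the error
    -- density is what makes it hold.
    rw [show ((V x : ℂ) - z) = V x - Q x + wkbRoot Q x z ^ 2 by rw [root_sq]; ring]
    simp only [u, b, hg, Pi.add_apply, Pi.mul_apply, Pi.neg_apply, Pi.sub_apply]
    field_simp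
    ring
  · exact toOn u (hAc.mul hyc)
  · exact toOn u' ((hAc.mul hswap).neg.mul ((hyc.sub hpc).add (hbc.mul hyc)))
  · exact fun hU x => (hAhol hU x).mul (hyhol hU x)
  · exact fun hU x => ((hAhol hU x).mul (h.differentiableOn_root x)).neg.mul
      (((hyhol hU x).sub (hphol hU x)).add ((hbhol x).mul (hyhol hU x)))
  · refine ⟨C, fun x z hz => ?_⟩
    rw [norm_mul, mul_comm]
    exact mul_le_mul_of_nonneg_right (hC x z hz) (norm_nonneg _)
  · refine ⟨C + (∫ t, ρ t) * C + T * C, fun x z hz => ?_⟩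
    rw [← hAF x z hz, norm_mul, norm_neg, mul_comm]
    refine mul_le_mul_of_nonneg_right ?_ (norm_nonneg _)
    have h1 : ‖p x z‖ ≤ (∫ t, ρ t) * C := (hpb x z hz).trans (mul_le_mul_of_nonneg_right
      (setIntegral_le_integral h.integrable_ρ (Eventually.of_forall hρ0)) hC0)
    have h2 : ‖b x z * y x z‖ ≤ T * C := by
      rw [norm_mul]
      exact mul_le_mul ((hbτ x z hz).trans (hT x)) (hC x z hz) (norm_nonneg _)
        (((norm_nonneg _).trans (hbτ x z hz)).trans (hT x))
    exact (norm_add_le _ _).trans (add_le_add ((norm_sub_le _ _).trans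
      (add_le_add (hC x z hz) h1)) h2)
  · intro z hz
    refine (hy1 z hz).congr fun x => ?_
    exact (mul_div_cancel_left₀ _ (hA0 x z hz)).symm
  · intro z hz
    have hb1 : Tendsto (fun x => b x z) atTop (𝓝 0) :=
      squeeze_zero_norm (fun x => hbτ x z hz) h.tendsto_τ
    have h1 := ((hy1 z hz).sub (hp0 z hz)).add (hb1.mul (hy1 z hz))
    simp only [sub_zero, zero_mul, add_zero] at h1
    refine h1.congr fun x => ?_
    have h2 : A x z * wkbRoot Q x z ≠ 0 := mul_ne_zero (hA0 x z hz) (h.root_ne_zero x hz)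
    rw [neg_mul, ← hAF x z hz]
    exact (mul_div_cancel_left₀ _ (neg_ne_zero.2 h2)).symm

end WKBData

/-! ### Symbol estimates and the three regions of spectral parameters -/

theorem one_le_bracket (x : ℝ) : 1 ≤ bracket x := by
  rw [bracket, Real.one_le_sqrt]
  nlinarith [sq_nonneg x]

theorem bracket_pos (x : ℝ) : 0 < bracket x := one_pos.trans_le (one_le_bracket x)

theorem continuous_bracket : Continuous bracket := by
  unfold bracket
  fun_prop

theorem bracket_neg (x : ℝ) : bracket (-x) = bracket x := by simp [bracket]

theorem abs_le_bracket (x : ℝ) : |x| ≤ bracket x := by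
  rw [bracket, ← Real.sqrt_sq_eq_abs]
  exact Real.sqrt_le_sqrt (by linarith)

theorem continuous_bracket_rpow (s : ℝ) : Continuous fun x => bracket x ^ s :=
  continuous_bracket.rpow_const fun x => Or.inl (bracket_pos x).ne'

theorem integrable_bracket_rpow {s : ℝ} (hs : s < -1) : Integrable fun x => bracket x ^ s := by
  have h := integrable_rpow_neg_one_add_norm_sq (E := ℝ) (μ := volume) (r := -s)
    (by simp; linarith)
  refine h.congr (Eventually.of_forall fun x => ?_)
  simp only [bracket, Real.sqrt_eq_rpow]
  rw [← Real.rpow_mul (by positivity)]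
  simp only [Real.norm_eq_abs, sq_abs]
  congr 1
  ring

theorem tendsto_bracket_rpow {s : ℝ} (hs : s < 0) {l : Filter ℝ} (hl : l = atTop ∨ l = atBot) :
    Tendsto (fun x => bracket x ^ s) l (𝓝 0) := by
  have h1 : Tendsto bracket l atTop := by
    refine tendsto_atTop_mono abs_le_bracket ?_
    rcases hl with rfl | rfl
    · exact tendsto_abs_atTop_atTop
    · exact tendsto_abs_atBot_atTop
  have h2 := (tendsto_rpow_neg_atTop (neg_pos.2 hs)).comp h1
  simpa [Function.comp_def] using h2

theorem exists_le_bracket_rpow {f : ℝ → ℝ} (hf : Continuous f) (hs : HasCompactSupport f) (s : ℝ) :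
    ∃ C, ∀ x, |f x| ≤ C * bracket x ^ s := by
  obtain ⟨C, hC⟩ := (hs.mul_right (f' := fun x => bracket x ^ (-s))).exists_bound_of_continuous
    (hf.mul (continuous_bracket_rpow (-s)))
  refine ⟨C, fun x => ?_⟩
  have h := hC x
  have hp : 0 < bracket x ^ (-s) := Real.rpow_pos_of_pos (bracket_pos x) _
  rw [Pi.mul_apply, norm_mul, Real.norm_eq_abs, Real.norm_of_nonneg hp.le,
    Real.rpow_neg (bracket_pos x).le, ← div_eq_mul_inv,
    div_le_iff₀ (Real.rpow_pos_of_pos (bracket_pos x) _)] at h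
  exact h

/-- Dividing the bounds Q' = O(⟨x⟩^(-μ-1)) and Q'' = O(⟨x⟩^(-μ-2)) by |Q - z| ≥ c⟨x⟩^(-μ) gives
O(⟨x⟩^(-1)) and O(⟨x⟩^(-2)), with constants independent of z. Division by |F| ≥ √c ⟨x⟩^(-μ/2) leaves
⟨x⟩^(μ/2-2) for the error and ⟨x⟩^(μ/2-1) for the slow term. The first is integrable and the second
tends to 0 because μ < 2. -/
theorem wkbData_of_symbol {V B : ℝ → ℝ} {μ c : ℝ} {U : Set ℂ} (hμ : μ < 2) (hc : 0 < c)
    (hV : IsSymbol (-μ) V) (hB : ContDiff ℝ ∞ B) (hBs : HasCompactSupport B)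
    (hadm : ∀ x, ∀ z ∈ U, IsAdmissible ((V x + B x : ℝ) - z))
    (hlow : ∀ x, ∀ z ∈ U, c * bracket x ^ (-μ) ≤ ‖((V x + B x : ℝ) : ℂ) - z‖) :
    ∃ Q1 Q2 ρ τ, WKBData V (fun x => V x + B x) Q1 Q2 ρ τ U := by
  set Q : ℝ → ℝ := fun x => V x + B x with hQdef
  have hQ : ContDiff ℝ ∞ Q := hV.1.add hB
  have hQ1 : ContDiff ℝ ∞ (deriv Q) := hQ.deriv'
  have hQ2 : ContDiff ℝ ∞ (deriv (deriv Q)) := hQ1.deriv'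
  have hB1 : ContDiff ℝ ∞ (deriv B) := hB.deriv'
  have hB2 : ContDiff ℝ ∞ (deriv (deriv B)) := hB1.deriv'
  have hVd : Differentiable ℝ V := hV.1.differentiable (by simp)
  have hBd : Differentiable ℝ B := hB.differentiable (by simp)
  have hV1 : ContDiff ℝ ∞ (deriv V) := hV.1.deriv'
  have hV1d : Differentiable ℝ (deriv V) := hV1.differentiable (by simp)
  have hB1d : Differentiable ℝ (deriv B) := hB1.differentiable (by simp)
  have e1 : deriv Q = fun x => deriv V x + deriv B x := by
    funext x
    exact deriv_add (hVd x) (hBd x)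
  have e2 : deriv (deriv Q) = fun x => deriv (deriv V) x + deriv (deriv B) x := by
    funext x
    rw [e1]
    exact deriv_add (hV1d x) (hB1d x)
  obtain ⟨C1, hC1⟩ := hV.2 1
  obtain ⟨C2, hC2⟩ := hV.2 2
  -- A compactly supported function is bounded by any power of the bracket; the exponents here match
  -- the corresponding terms coming from `V`.
  obtain ⟨D0, hD0⟩ := exists_le_bracket_rpow hB.continuous hBs (-2)
  obtain ⟨D1, hD1⟩ := exists_le_bracket_rpow hB1.continuous hBs.deriv (-μ - 1)
  obtain ⟨D2, hD2⟩ := exists_le_bracket_rpow hB2.continuous hBs.deriv.deriv (-μ - 2)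
  have hQ1b : ∀ x, |deriv Q x| ≤ (C1 + D1) * bracket x ^ (-μ - 1) := by
    intro x
    rw [e1, add_mul]
    refine (abs_add_le _ _).trans (add_le_add ?_ (hD1 x))
    simpa [iteratedDeriv_one] using hC1 x
  have hQ2b : ∀ x, |deriv (deriv Q) x| ≤ (C2 + D2) * bracket x ^ (-μ - 2) := by
    intro x
    rw [e2, add_mul]
    refine (abs_add_le _ _).trans (add_le_add ?_ (hD2 x))
    have := hC2 x
    rw [iteratedDeriv_succ, iteratedDeriv_one] at this
    exact_mod_cast this
  set C := C1 + D1
  set D := C2 + D2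
  have bp : ∀ x s : ℝ, 0 < bracket x ^ s := fun x s => Real.rpow_pos_of_pos (bracket_pos x) s
  have hC0 : 0 ≤ C := by
    have := (abs_nonneg _).trans (hQ1b 0)
    exact nonneg_of_mul_nonneg_left this (bp _ _)
  have hF : ∀ x, ∀ z ∈ U, Real.sqrt c * bracket x ^ (-μ / 2) ≤ ‖wkbRoot Q x z‖ := by
    intro x z hz
    rw [wkbRoot, norm_outgoingSqrt]
    refine le_trans (le_of_eq ?_) (Real.sqrt_le_sqrt (hlow x z hz))
    rw [Real.sqrt_mul hc.le, Real.sqrt_eq_rpow (bracket x ^ (-μ)), ← Real.rpow_mul (bracket_pos x).le]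
    congr 2
    ring
  have hr1 : ∀ x, ∀ z ∈ U, ‖((deriv Q x : ℝ) : ℂ) / ((Q x : ℂ) - z)‖ ≤ C / c * bracket x ^ (-1 : ℝ) := by
    intro x z hz
    rw [norm_div, Complex.norm_real, Real.norm_eq_abs, div_le_iff₀ ((mul_pos hc (bp x _)).trans_le
      (hlow x z hz))]
    refine (hQ1b x).trans ?_
    calc C * bracket x ^ (-μ - 1) = C / c * bracket x ^ (-1 : ℝ) * (c * bracket x ^ (-μ)) := by
          rw [show -μ - 1 = -1 + -μ by ring, Real.rpow_add (bracket_pos x)]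
          field_simp
      _ ≤ _ := mul_le_mul_of_nonneg_left (hlow x z hz) (mul_nonneg (div_nonneg hC0 hc.le) (bp x _).le)
  have hD0' : 0 ≤ D := by
    have := (abs_nonneg _).trans (hQ2b 0)
    exact nonneg_of_mul_nonneg_left this (bp _ _)
  have hr2 : ∀ x, ∀ z ∈ U, ‖((deriv (deriv Q) x : ℝ) : ℂ) / (4 * ((Q x : ℂ) - z))‖ ≤
      D / c * bracket x ^ (-2 : ℝ) := by
    intro x z hz
    have hq := (mul_pos hc (bp x _)).trans_le (hlow x z hz)
    rw [norm_div, norm_mul, Complex.norm_real, Real.norm_eq_abs, Complex.norm_ofNat,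
      div_le_iff₀ (by positivity)]
    refine (hQ2b x).trans ?_
    calc D * bracket x ^ (-μ - 2) = D / c * bracket x ^ (-2 : ℝ) * (c * bracket x ^ (-μ)) := by
          rw [show -μ - 2 = -2 + -μ by ring, Real.rpow_add (bracket_pos x)]
          field_simp
      _ ≤ D / c * bracket x ^ (-2 : ℝ) * ‖((V x + B x : ℝ) : ℂ) - z‖ :=
          mul_le_mul_of_nonneg_left (hlow x z hz) (mul_nonneg (div_nonneg hD0' hc.le) (bp x _).le)
      _ ≤ _ := by
          refine mul_le_mul_of_nonneg_left ?_ (mul_nonneg (div_nonneg hD0' hc.le) (bp x _).le)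
          simp only [hQdef]
          linarith
  refine ⟨deriv Q, deriv (deriv Q),
    fun x => (5 / 16 * (C / c) ^ 2 + D / c + D0) / Real.sqrt c * bracket x ^ (μ / 2 - 2),
    fun x => C / (4 * c * Real.sqrt c) * bracket x ^ (μ / 2 - 1),
    ⟨hV.1.continuous, fun x => (hQ.differentiable (by simp) x).hasDerivAt,
     fun x => (hQ1.differentiable (by simp) x).hasDerivAt, hQ2.continuous, hadm,
     continuous_const.mul (continuous_bracket_rpow _),
     (integrable_bracket_rpow (by linarith)).const_mul _, ?_, ?_, ?_, ?_⟩⟩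
  · intro x z hz
    have hFx := hF x z hz
    have hsc : 0 < Real.sqrt c := Real.sqrt_pos.2 hc
    have hFp := (mul_pos hsc (bp x (-μ / 2))).trans_le hFx
    rw [wkbError, norm_div, div_le_iff₀ hFp]
    have hnum : ‖5 / 16 * (((deriv Q x : ℝ) : ℂ) / ((Q x : ℂ) - z)) ^ 2 -
        ((deriv (deriv Q) x : ℝ) : ℂ) / (4 * ((Q x : ℂ) - z)) + ((Q x : ℂ) - V x)‖ ≤
        (5 / 16 * (C / c) ^ 2 + D / c + D0) * bracket x ^ (-2 : ℝ) := by
      refine (norm_add_le _ _).trans ?_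
      rw [add_mul]
      refine add_le_add ((norm_sub_le _ _).trans ?_) ?_
      · rw [add_mul]
        refine add_le_add ?_ (hr2 x z hz)
        rw [norm_mul, norm_pow, show ‖(5 / 16 : ℂ)‖ = 5 / 16 by norm_num, mul_assoc]
        refine mul_le_mul_of_nonneg_left ?_ (by norm_num)
        refine (pow_le_pow_left₀ (norm_nonneg _) (hr1 x z hz) 2).trans (le_of_eq ?_)
        rw [mul_pow, ← Real.rpow_natCast (bracket x ^ (-1 : ℝ)), ← Real.rpow_mul (bracket_pos x).le]
        norm_num
      · have : ((Q x : ℂ) - V x) = (B x : ℝ) := by simp [hQdef]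
        rw [this, Complex.norm_real, Real.norm_eq_abs]
        exact hD0 x
    have hK0 : 0 ≤ 5 / 16 * (C / c) ^ 2 + D / c + D0 :=
      nonneg_of_mul_nonneg_left ((norm_nonneg _).trans hnum) (bp _ _)
    refine hnum.trans ?_
    calc (5 / 16 * (C / c) ^ 2 + D / c + D0) * bracket x ^ (-2 : ℝ)
        = (5 / 16 * (C / c) ^ 2 + D / c + D0) / Real.sqrt c * bracket x ^ (μ / 2 - 2) *
          (Real.sqrt c * bracket x ^ (-μ / 2)) := by
          rw [show (-2 : ℝ) = (μ / 2 - 2) + -μ / 2 by ring, Real.rpow_add (bracket_pos x)]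
          field_simp
      _ ≤ _ := mul_le_mul_of_nonneg_left hFx
          (mul_nonneg (div_nonneg hK0 hsc.le) (bp x _).le)
  · intro x z hz
    have hFx := hF x z hz
    have hsc : 0 < Real.sqrt c := Real.sqrt_pos.2 hc
    have hFp := (mul_pos hsc (bp x (-μ / 2))).trans_le hFx
    have : ((deriv Q x : ℝ) : ℂ) / (4 * ((Q x : ℂ) - z) * wkbRoot Q x z) =
        ((deriv Q x : ℝ) : ℂ) / ((Q x : ℂ) - z) / (4 * wkbRoot Q x z) := by
      rw [div_div]
      congr 1
      ring
    rw [this, norm_div, norm_mul, Complex.norm_ofNat, div_le_iff₀ (by positivity)]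
    refine (hr1 x z hz).trans ?_
    calc C / c * bracket x ^ (-1 : ℝ) = C / (4 * c * Real.sqrt c) * bracket x ^ (μ / 2 - 1) *
          (4 * (Real.sqrt c * bracket x ^ (-μ / 2))) := by
          rw [show (-1 : ℝ) = (μ / 2 - 1) + -μ / 2 by ring, Real.rpow_add (bracket_pos x)]
          field_simp
      _ ≤ _ := mul_le_mul_of_nonneg_left (by linarith) (by have := bp x (μ / 2 - 1); positivity)
  · simpa using (tendsto_bracket_rpow (by linarith : μ / 2 - 1 < 0) (Or.inl rfl)).const_mul
      (C / (4 * c * Real.sqrt c))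
  · refine ⟨C / (4 * c * Real.sqrt c), fun x => ?_⟩
    have h1 : bracket x ^ (μ / 2 - 1) ≤ 1 :=
      Real.rpow_le_one_of_one_le_of_nonpos (one_le_bracket x) (by linarith)
    exact mul_le_of_le_one_right (by positivity) h1

/-- Exponential decay of a function and its derivative at `+∞`. -/
def DecaysRight (u u' : ℝ → ℂ) : Prop :=
  ∃ a > 0, ∃ C, ∀ x, 0 ≤ x → ‖u x‖ ≤ C * Real.exp (-a * x) ∧ ‖u' x‖ ≤ C * Real.exp (-a * x)

theorem exists_exp_bound_of_eventually {f : ℝ → ℂ} (hf : Continuous f) {a K : ℝ}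
    (h : ∀ᶠ x in atTop, ‖f x‖ ≤ K * Real.exp (-a * x)) :
    ∃ C, ∀ x, 0 ≤ x → ‖f x‖ ≤ C * Real.exp (-a * x) := by
  obtain ⟨X, hX⟩ := eventually_atTop.1 h
  obtain ⟨D, hD⟩ := (isCompact_Icc (a := (0 : ℝ)) (b := X)).exists_bound_of_continuousOn
    (f := fun x => f x * Complex.exp (a * x)) (by fun_prop)
  refine ⟨max K D, fun x hx => ?_⟩
  rcases le_total X x with hxX | hxX
  · exact (hX x hxX).trans (mul_le_mul_of_nonneg_right (le_max_left _ _) (Real.exp_pos _).le)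
  · have h1 := hD x ⟨hx, hxX⟩
    rw [norm_mul, Complex.norm_exp, show ((a : ℂ) * x).re = a * x by simp] at h1
    rw [neg_mul, Real.exp_neg, ← div_eq_mul_inv, le_div_iff₀ (Real.exp_pos _)]
    exact h1.trans (le_max_right _ _)

/-- Off the positive half-axis, Re F tends to a positive limit as Q → 0. Eventually Re F ≥ a > 0, so
e^(-S) decays like e^(-ax), while the powers F^(±1/2) converge. -/
theorem WKBData.decaysRight {V Q Q1 Q2 ρ τ : ℝ → ℝ} {U : Set ℂ} (h : WKBData V Q Q1 Q2 ρ τ U)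
    (hQ : Tendsto Q atTop (𝓝 0)) {u u' : ℝ → ℂ → ℂ} (hu : IsWKBFamily V Q U u u') {z : ℂ}
    (hz : z ∈ U) (hz' : z.im ≠ 0 ∨ z.re < 0) :
    DecaysRight (fun x => u x z) (fun x => u' x z) := by
  have hz0 : z ≠ 0 := by
    rintro rfl
    simp at hz'
  have hq : Tendsto (fun x => (Q x : ℂ) - z) atTop (𝓝 (-z)) := by
    have := ((Complex.continuous_ofReal.tendsto 0).comp hQ).sub_const z
    simpa [Function.comp_def] using this
  have hlt : 0 < ‖z‖ - z.re := by
    rcases hz' with h1 | h1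
    · linarith [Complex.abs_re_lt_norm.2 h1, le_abs_self z.re]
    · linarith [norm_nonneg z]
  set a : ℝ := Real.sqrt ((‖z‖ - z.re) / 4) with ha
  have ha0 : 0 < a := Real.sqrt_pos.2 (by linarith)
  -- From F² = q follows 2 (Re F)² = |q| + Re q, which tends to |z| - Re z; the square of `a` is
  -- half of the limiting value of (Re F)².
  have hre : ∀ᶠ x in atTop, a ≤ (wkbRoot Q x z).re := by
    have h1 : Tendsto (fun x => ‖(Q x : ℂ) - z‖ + ((Q x : ℂ) - z).re) atTop (𝓝 (‖-z‖ + (-z).re)) :=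
      hq.norm.add ((Complex.continuous_re.tendsto _).comp hq)
    rw [norm_neg, Complex.neg_re, ← sub_eq_add_neg] at h1
    filter_upwards [h1.eventually (lt_mem_nhds (half_lt_self hlt))] with x hx
    have h0 : 0 ≤ (wkbRoot Q x z).re := (h.admissible x z hz).re_outgoingSqrt_nonneg
    refine Real.sqrt_le_iff.2 ⟨h0, ?_⟩
    have h2 : wkbRoot Q x z ^ 2 = Q x - z := root_sq x z
    have h3 : ‖(Q x : ℂ) - z‖ = (wkbRoot Q x z).re ^ 2 + (wkbRoot Q x z).im ^ 2 := by
      rw [← h2, norm_pow, ← Complex.normSq_eq_norm_sq, Complex.normSq_apply]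
      ring
    have h4 : ((Q x : ℂ) - z).re = (wkbRoot Q x z).re ^ 2 - (wkbRoot Q x z).im ^ 2 := by
      rw [← h2, sq, Complex.mul_re]
      ring
    rw [h3, h4] at hx
    linarith
  obtain ⟨X, hX⟩ := eventually_atTop.1 hre
  have hph : ∀ x, X ≤ x → Real.exp (-(wkbPhase Q x z).re) ≤
      Real.exp (-(wkbPhase Q X z).re + a * X) * Real.exp (-a * x) := by
    intro x hx
    rw [← Real.exp_add, Real.exp_le_exp]
    have h1 := h.phase_sub hz X x
    have h2 : (∫ s in X..x, wkbRoot Q s z).re = ∫ s in X..x, (wkbRoot Q s z).re :=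
      (Complex.reCLM.intervalIntegral_comp_comm
        ((h.continuous_root_right hz).intervalIntegrable X x)).symm
    have h3 : ∫ s in X..x, a ≤ ∫ s in X..x, (wkbRoot Q s z).re := by
      refine intervalIntegral.integral_mono_on hx (by simp)
        ((Complex.continuous_re.comp (h.continuous_root_right hz)).intervalIntegrable _ _)
        fun s hs => hX s hs.1
    rw [intervalIntegral.integral_const, smul_eq_mul] at h3
    rw [← h1, Complex.sub_re] at h2
    linarith
  have key : ∀ (r : ℝ) (f f' : ℝ → ℂ), (∀ x, HasDerivAt f (f' x) x) →
      (∃ C, ∀ x, ‖f x‖ ≤ C * ‖wkbRoot Q x z ^ (r : ℂ) * Complex.exp (-wkbPhase Q x z)‖) →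
      ∃ C, ∀ x, 0 ≤ x → ‖f x‖ ≤ C * Real.exp (-a * x) := by
    intro r f f' hf ⟨C, hC⟩
    have hr : Tendsto (fun x => ‖wkbRoot Q x z‖ ^ r) atTop (𝓝 (Real.sqrt ‖z‖ ^ r)) := by
      simp only [wkbRoot, norm_outgoingSqrt]
      have h1 := (Real.continuous_sqrt.tendsto _).comp hq.norm
      rw [norm_neg] at h1
      refine h1.rpow_const (Or.inl ?_)
      exact (Real.sqrt_pos.2 (norm_pos_iff.2 hz0)).ne'
    have hfc : Continuous f := continuous_iff_continuousAt.2 fun x => (hf x).continuousAt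
    refine exists_exp_bound_of_eventually (K := |C| * (Real.sqrt ‖z‖ ^ r + 1) *
      Real.exp (-(wkbPhase Q X z).re + a * X)) hfc ?_
    filter_upwards [hr.eventually (gt_mem_nhds (lt_add_one _)), eventually_ge_atTop X] with x h1 h2
    refine (hC x).trans ?_
    rw [norm_mul, Complex.norm_cpow_real, Complex.norm_exp, Complex.neg_re, mul_assoc, mul_assoc]
    refine (mul_le_mul_of_nonneg_right (le_abs_self C) (by positivity)).trans ?_
    refine mul_le_mul_of_nonneg_left ?_ (abs_nonneg C)
    exact mul_le_mul h1.le (hph x h2) (Real.exp_pos _).le (by positivity)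
  obtain ⟨C1, hC1⟩ := hu.bound
  obtain ⟨C2, hC2⟩ := hu.bound'
  obtain ⟨D1, hD1⟩ := key (-1 / 2) (fun x => u x z) _ (fun x => hu.deriv x z hz)
    ⟨C1, fun x => by simpa using hC1 x z hz⟩
  obtain ⟨D2, hD2⟩ := key (1 / 2) (fun x => u' x z) _ (fun x => hu.deriv' x z hz)
    ⟨C2, fun x => by simpa using hC2 x z hz⟩
  refine ⟨a, ha0, max D1 D2, fun x hx => ⟨(hD1 x hx).trans ?_, (hD2 x hx).trans ?_⟩⟩
  · exact mul_le_mul_of_nonneg_right (le_max_left _ _) (Real.exp_pos _).le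
  · exact mul_le_mul_of_nonneg_right (le_max_right _ _) (Real.exp_pos _).le

theorem IsSymbol.tendsto_zero {V : ℝ → ℝ} {μ : ℝ} (hμ : 0 < μ) (hV : IsSymbol (-μ) V)
    {l : Filter ℝ} (hl : l = atTop ∨ l = atBot) : Tendsto V l (𝓝 0) := by
  obtain ⟨C, hC⟩ := hV.2 0
  refine squeeze_zero_norm (fun x => ?_)
    (by simpa using (tendsto_bracket_rpow (neg_lt_zero.2 hμ) hl).const_mul C)
  simpa using hC x

theorem exists_smooth_cutoff {R : ℝ} (hR : 0 < R) :
    ∃ χ : ℝ → ℝ, ContDiff ℝ ∞ χ ∧ HasCompactSupport χ ∧ (∀ x, 0 ≤ χ x) ∧ (∀ x, χ x ≤ 1) ∧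
      ∀ x, |x| ≤ R → χ x = 1 := by
  let f : ContDiffBump (0 : ℝ) := ⟨R, R + 1, hR, by linarith⟩
  refine ⟨f, f.contDiff, f.hasCompactSupport, fun x => f.nonneg, fun x => f.le_one, fun x hx => ?_⟩
  exact f.one_of_mem_closedBall (by simpa using hx)

/-- The family `u` consists of solutions that decay at `+∞` off the positive half-axis. -/
def IsDecaying (U : Set ℂ) (u u' : ℝ → ℂ → ℂ) : Prop :=
  ∀ z ∈ U, (z.im ≠ 0 ∨ z.re < 0) → DecaysRight (fun x => u x z) (fun x => u' x z)

/-- `V` is negative near infinity, as a symbol of order `-μ`. -/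
def IsNegativeNearInfinity (μ : ℝ) (V : ℝ → ℝ) : Prop :=
  ∃ c R : ℝ, 0 < c ∧ 0 < R ∧ ∀ x : ℝ, R ≤ |x| → V x ≤ -c * bracket x ^ (-μ)

theorem exists_family_of_perturbation {V B : ℝ → ℝ} {μ c : ℝ} {U : Set ℂ} (hμ0 : 0 < μ)
    (hμ : μ < 2) (hc : 0 < c) (hV : IsSymbol (-μ) V) (hB : ContDiff ℝ ∞ B)
    (hBs : HasCompactSupport B)
    (hadm : ∀ x, ∀ z ∈ U, IsAdmissible ((V x + B x : ℝ) - z))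
    (hlow : ∀ x, ∀ z ∈ U, c * bracket x ^ (-μ) ≤ ‖((V x + B x : ℝ) : ℂ) - z‖) :
    ∃ u u', IsWKBFamily V (fun x => V x + B x) U u u' ∧ IsDecaying U u u' := by
  obtain ⟨Q1, Q2, ρ, τ, h⟩ := wkbData_of_symbol hμ hc hV hB hBs hadm hlow
  obtain ⟨u, u', hu⟩ := h.exists_isWKBFamily
  refine ⟨u, u', hu, fun z hz hz' => h.decaysRight ?_ hu hz hz'⟩
  have hB0 : Tendsto B atTop (𝓝 0) :=
     hBs.is_zero_at_infty.mono_left atTop_le_cocompact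
  simpa using (hV.tendsto_zero hμ0 (Or.inl rfl)).add hB0

/-- No perturbation is needed: Im(V - z) = -Im z < -δ gives both admissibility and the lower bound.
-/
theorem exists_upper_family {V : ℝ → ℝ} {μ : ℝ} (hμ0 : 0 < μ) (hμ : μ < 2) (hV : IsSymbol (-μ) V)
    {δ : ℝ} (hδ : 0 < δ) :
    ∃ Q u u', IsWKBFamily V Q {z | δ < z.im} u u' ∧ IsDecaying {z | δ < z.im} u u' := by
  refine ⟨_, exists_family_of_perturbation (B := fun _ => 0) hμ0 hμ hδ hV contDiff_const
    HasCompactSupport.zero (fun x z hz => ?_) (fun x z hz => ?_)⟩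
  · have hz' : δ < z.im := hz
    refine ⟨fun h => ?_, Or.inl ?_⟩
    · have := congrArg Complex.im h
      simp at this
      linarith
    · simp
      linarith
  · have hz' : δ < z.im := hz
    have h1 : bracket x ^ (-μ) ≤ 1 :=
      Real.rpow_le_one_of_one_le_of_nonpos (one_le_bracket x) (by linarith)
    have h2 := Complex.abs_im_le_norm (((V x + 0 : ℝ) : ℂ) - z)
    rw [Complex.sub_im, Complex.ofReal_im, zero_sub, abs_neg, abs_of_pos (hδ.trans hz')] at h2
    nlinarith

/-- `V` tends to 0, so a bump raising it on a compact set yields Q ≥ -δ/2 everywhere; then Re(Q - z)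
> δ/2 on the half-plane. -/
theorem exists_left_family {V : ℝ → ℝ} {μ : ℝ} (hμ0 : 0 < μ) (hμ : μ < 2) (hV : IsSymbol (-μ) V)
    {δ : ℝ} (hδ : 0 < δ) :
    ∃ Q u u', IsWKBFamily V Q {z | z.re < -δ} u u' ∧ IsDecaying {z | z.re < -δ} u u' := by
  have h1 := (hV.tendsto_zero hμ0 (Or.inl rfl)).eventually (lt_mem_nhds (show -(δ / 2) < 0 by linarith))
  have h2 := (hV.tendsto_zero hμ0 (Or.inr rfl)).eventually (lt_mem_nhds (show -(δ / 2) < 0 by linarith))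
  obtain ⟨X, hX⟩ := eventually_atTop.1 h1
  obtain ⟨Y, hY⟩ := eventually_atBot.1 h2
  obtain ⟨χ, hχ, hχs, hχ0, -, hχ1⟩ := exists_smooth_cutoff
    (show 0 < max 1 (max X (-Y)) from lt_max_of_lt_left one_pos)
  obtain ⟨A, hA⟩ := (isCompact_Icc (a := -max 1 (max X (-Y)))
    (b := max 1 (max X (-Y)))).exists_bound_of_continuousOn hV.1.continuous.continuousOn
  have hlow : ∀ x, -(δ / 2) ≤ V x + |A| * χ x := by
    intro x
    by_cases hx : |x| ≤ max 1 (max X (-Y))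
    · have h3 := hA x (abs_le.1 hx)
      rw [hχ1 x hx]
      have := (abs_le.1 h3).1
      linarith [le_abs_self A]
    · have h3 : 0 ≤ |A| * χ x := mul_nonneg (abs_nonneg _) (hχ0 x)
      rw [not_le] at hx
      rcases lt_abs.1 hx with h | h
      · have := hX x (((le_max_left _ _).trans (le_max_right _ _)).trans h.le)
        linarith
      · have h4 : -Y ≤ -x := ((le_max_right _ _).trans (le_max_right _ _)).trans h.le
        have := hY x (by linarith)
        linarith
  have hre : ∀ x, ∀ z ∈ {z : ℂ | z.re < -δ}, δ / 2 < (((V x + |A| * χ x : ℝ) : ℂ) - z).re := by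
    intro x z hz
    have hz' : z.re < -δ := hz
    rw [Complex.sub_re, Complex.ofReal_re]
    linarith [hlow x]
  refine ⟨_, exists_family_of_perturbation (B := fun x => |A| * χ x) (c := δ / 2) hμ0 hμ
    (by linarith) hV (contDiff_const.mul hχ) hχs.mul_left (fun x z hz => ?_) (fun x z hz => ?_)⟩
  · have := hre x z hz
    refine ⟨fun h => ?_, Or.inr (by linarith)⟩
    rw [h, Complex.zero_re] at this
    linarith
  · have h1 : bracket x ^ (-μ) ≤ 1 :=
      Real.rpow_le_one_of_one_le_of_nonpos (one_le_bracket x) (by linarith)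
    have := hre x z hz
    have := Complex.re_le_norm (((V x + |A| * χ x : ℝ) : ℂ) - z)
    nlinarith

/-- The closed first quadrant. -/
def closedQuadrant : Set ℂ := {z | 0 ≤ z.re ∧ 0 ≤ z.im}

/-- A bump lowering `V` on the compact set where its sign is unknown yields Q ≤ -c⟨x⟩^(-μ) on the
whole line. Then Re(Q - z) ≤ -c⟨x⟩^(-μ) whenever Re z ≥ 0, including z = 0, so there are no turning
points and all constants are uniform up to zero energy. -/
theorem exists_quadrant_family {V : ℝ → ℝ} {μ : ℝ} (hμ0 : 0 < μ) (hμ : μ < 2)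
    (hV : IsSymbol (-μ) V) (hneg : IsNegativeNearInfinity μ V) :
    ∃ B : ℝ → ℝ, HasCompactSupport B ∧ Continuous B ∧ (∀ x, V x + B x < 0) ∧ ∃ u u',
      IsWKBFamily V (fun x => V x + B x) closedQuadrant u u' ∧ IsDecaying closedQuadrant u u' := by
  obtain ⟨c, R, hc, hR, hVneg⟩ := hneg
  obtain ⟨χ, hχ, hχs, hχ0, -, hχ1⟩ := exists_smooth_cutoff hR
  obtain ⟨A, hA⟩ := (isCompact_Icc (a := -R) (b := R)).exists_bound_of_continuousOn
    hV.1.continuous.continuousOn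
  -- On [-R, R] the term |A| cancels the size of `V`, and the extra c suffices because ⟨x⟩^(-μ) ≤ 1.
  have hup : ∀ x, V x + -(|A| + c) * χ x ≤ -(c * bracket x ^ (-μ)) := by
    intro x
    rcases le_total |x| R with hx | hx
    · have h3 := hA x (abs_le.1 hx)
      rw [hχ1 x hx]
      have := (abs_le.1 h3).2
      have h1 : bracket x ^ (-μ) ≤ 1 :=
        Real.rpow_le_one_of_one_le_of_nonpos (one_le_bracket x) (by linarith)
      nlinarith [le_abs_self A]
    · have h3 : 0 ≤ (|A| + c) * χ x := mul_nonneg (by positivity) (hχ0 x)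
      have := hVneg x hx
      linarith
  have hbp : ∀ x, 0 < c * bracket x ^ (-μ) := fun x =>
    mul_pos hc (Real.rpow_pos_of_pos (bracket_pos x) _)
  have hre : ∀ x, ∀ z ∈ closedQuadrant, (((V x + -(|A| + c) * χ x : ℝ) : ℂ) - z).re ≤
      -(c * bracket x ^ (-μ)) := by
    intro x z hz
    rw [Complex.sub_re, Complex.ofReal_re]
    linarith [hup x, hz.1]
  refine ⟨fun x => -(|A| + c) * χ x, hχs.mul_left, continuous_const.mul hχ.continuous,
    fun x => (hup x).trans_lt (neg_lt_zero.2 (hbp x)),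
    exists_family_of_perturbation (c := c) hμ0 hμ hc hV (contDiff_const.mul hχ) hχs.mul_left
    (fun x z hz => ?_) (fun x z hz => ?_)⟩
  · have := hre x z hz
    refine ⟨fun h => ?_, Or.inl ?_⟩
    · rw [h, Complex.zero_re] at this
      linarith [hbp x]
    · simp [hz.2]
  · have := hre x z hz
    have h2 := Complex.abs_re_le_norm (((V x + -(|A| + c) * χ x : ℝ) : ℂ) - z)
    linarith [(abs_le.1 h2).1]

/-! ### Exponential decay and Green's identities -/

/-- Exponential decay at `+∞`. -/
def ExpDecay (f : ℝ → ℂ) : Prop := ∃ a > 0, ∃ C, ∀ x, 0 ≤ x → ‖f x‖ ≤ C * Real.exp (-a * x)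

theorem DecaysRight.fst {u u' : ℝ → ℂ} (h : DecaysRight u u') : ExpDecay u := by
  obtain ⟨a, ha, C, hC⟩ := h
  exact ⟨a, ha, C, fun x hx => (hC x hx).1⟩

theorem DecaysRight.snd {u u' : ℝ → ℂ} (h : DecaysRight u u') : ExpDecay u' := by
  obtain ⟨a, ha, C, hC⟩ := h
  exact ⟨a, ha, C, fun x hx => (hC x hx).2⟩

namespace ExpDecay

variable {f g : ℝ → ℂ}

theorem nonneg_const {a C : ℝ} (h : ∀ x, 0 ≤ x → ‖f x‖ ≤ C * Real.exp (-a * x)) : 0 ≤ C := by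
  have := (norm_nonneg _).trans (h 0 le_rfl)
  simpa using this

theorem add (hf : ExpDecay f) (hg : ExpDecay g) : ExpDecay fun x => f x + g x := by
  obtain ⟨a, ha, C, hC⟩ := hf
  obtain ⟨b, hb, D, hD⟩ := hg
  refine ⟨min a b, lt_min ha hb, C + D, fun x hx => ?_⟩
  have h1 : Real.exp (-a * x) ≤ Real.exp (-min a b * x) := Real.exp_le_exp.2
    (mul_le_mul_of_nonneg_right (neg_le_neg (min_le_left a b)) hx)
  have h2 : Real.exp (-b * x) ≤ Real.exp (-min a b * x) := Real.exp_le_exp.2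
    (mul_le_mul_of_nonneg_right (neg_le_neg (min_le_right a b)) hx)
  rw [add_mul]
  exact (norm_add_le _ _).trans (add_le_add
    ((hC x hx).trans (mul_le_mul_of_nonneg_left h1 (nonneg_const hC)))
    ((hD x hx).trans (mul_le_mul_of_nonneg_left h2 (nonneg_const hD))))

theorem mul (hf : ExpDecay f) (hg : ExpDecay g) : ExpDecay fun x => f x * g x := by
  obtain ⟨a, ha, C, hC⟩ := hf
  obtain ⟨b, hb, D, hD⟩ := hg
  refine ⟨a + b, add_pos ha hb, C * D, fun x hx => ?_⟩
  rw [norm_mul, show -(a + b) * x = -a * x + -b * x by ring, Real.exp_add]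
  refine (mul_le_mul (hC x hx) (hD x hx) (norm_nonneg _) ((norm_nonneg _).trans (hC x hx))).trans
    (le_of_eq (by ring))

theorem const_mul (hf : ExpDecay f) (k : ℂ) : ExpDecay fun x => k * f x := by
  obtain ⟨a, ha, C, hC⟩ := hf
  refine ⟨a, ha, ‖k‖ * C, fun x hx => ?_⟩
  rw [norm_mul, mul_assoc]
  exact mul_le_mul_of_nonneg_left (hC x hx) (norm_nonneg _)

theorem star (hf : ExpDecay f) : ExpDecay fun x => conj (f x) := by
  obtain ⟨a, ha, C, hC⟩ := hf
  exact ⟨a, ha, C, fun x hx => by simpa using hC x hx⟩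

theorem tendsto (hf : ExpDecay f) : Tendsto f atTop (𝓝 0) := by
  obtain ⟨a, ha, C, hC⟩ := hf
  refine squeeze_zero_norm' ((eventually_ge_atTop 0).mono fun x hx => hC x hx) ?_
  have h1 : Tendsto (fun x => Real.exp (-a * x)) atTop (𝓝 0) :=
    Real.tendsto_exp_atBot.comp (tendsto_id.const_mul_atTop_of_neg (neg_lt_zero.2 ha))
  simpa using h1.const_mul C

theorem of_eventuallyEq (hg : ExpDecay g) (hf : Continuous f) (h : ∀ᶠ x in atTop, f x = g x) :
    ExpDecay f := by
  obtain ⟨a, ha, C, hC⟩ := hg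
  refine ⟨a, ha, exists_exp_bound_of_eventually (K := C) hf ?_⟩
  filter_upwards [h, eventually_ge_atTop 0] with x hx hx0
  rw [hx]
  exact hC x hx0

theorem bounded (hf : ExpDecay f) : ∃ C, ∀ x, 0 ≤ x → ‖f x‖ ≤ C := by
  obtain ⟨a, ha, C, hC⟩ := hf
  refine ⟨C, fun x hx => (hC x hx).trans (mul_le_of_le_one_right (nonneg_const hC) ?_)⟩
  rw [Real.exp_le_one_iff]
  nlinarith

theorem integrableOn (hf : ExpDecay f) (hc : Continuous f) : IntegrableOn f (Set.Ioi 0) := by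
  obtain ⟨a, ha, C, hC⟩ := hf
  exact ((integrableOn_exp_mul_Ioi (neg_lt_zero.2 ha) 0).const_mul C).mono'
    hc.aestronglyMeasurable ((ae_restrict_iff' measurableSet_Ioi).2
      (Eventually.of_forall fun x hx => hC x (le_of_lt hx)))

theorem integrable (hf : ExpDecay f) (hf' : ExpDecay fun x => f (-x)) (hc : Continuous f) :
    Integrable f := by
  have h1 := hf.integrableOn hc
  have h2 := hf'.integrableOn (hc.comp continuous_neg)
  have h3 : IntegrableOn f (Set.Iio 0) := by
    have := (Measure.measurePreserving_neg (volume : Measure ℝ)).integrableOn_comp_preimage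
      (Homeomorph.neg ℝ).measurableEmbedding (f := f) (s := Set.Iio 0)
    simpa [Function.comp_def] using this.1 (by simpa [Function.comp_def] using h2)
  rw [← integrableOn_univ, ← Set.Iio_union_Ici (a := (0 : ℝ))]
  exact h3.union ((integrableOn_Ici_iff_integrableOn_Ioi (by simp)).2 h1)

theorem tendsto_atBot (hf' : ExpDecay fun x => f (-x)) : Tendsto f atBot (𝓝 0) := by
  have := hf'.tendsto.comp tendsto_neg_atBot_atTop
  simpa [Function.comp_def] using this

theorem bounded_univ (hf : ExpDecay f) (hf' : ExpDecay fun x => f (-x)) : ∃ C, ∀ x, ‖f x‖ ≤ C := by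
  obtain ⟨C, hC⟩ := hf.bounded
  obtain ⟨D, hD⟩ := hf'.bounded
  refine ⟨max C D, fun x => ?_⟩
  rcases le_total 0 x with h | h
  · exact (hC x h).trans (le_max_left _ _)
  · have := hD (-x) (by linarith)
    rw [neg_neg] at this
    exact this.trans (le_max_right _ _)

end ExpDecay

/-- `u` solves `-u'' + V u = z u`, and `u'` is its derivative. -/
structure IsSol (V : ℝ → ℝ) (z : ℂ) (u u' : ℝ → ℂ) : Prop where
  hasDerivAt : ∀ x, HasDerivAt u (u' x) x
  hasDerivAt' : ∀ x, HasDerivAt u' ((V x - z) * u x) x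

/-- `v` is a decaying solution of `-v'' + (V - z) v = f`. -/
structure IsResolvent (V : ℝ → ℝ) (z : ℂ) (f v v' : ℝ → ℂ) : Prop where
  hasDerivAt : ∀ x, HasDerivAt v (v' x) x
  hasDerivAt' : ∀ x, HasDerivAt v' ((V x - z) * v x - f x) x
  right : ExpDecay v
  right' : ExpDecay v'
  left : ExpDecay fun x => v (-x)
  left' : ExpDecay fun x => v' (-x)

/-- The test functions `C_c^∞`. -/
def IsTest (f : ℝ → ℂ) : Prop := ContDiff ℝ ∞ f ∧ HasCompactSupport f

theorem IsTest.continuous {f : ℝ → ℂ} (hf : IsTest f) : Continuous f := hf.1.continuous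

theorem IsTest.integrable_mul {f v : ℝ → ℂ} (hf : IsTest f) (hv : Continuous v) :
    Integrable fun x => f x * v x :=
  (hf.continuous.mul hv).integrable_of_hasCompactSupport hf.2.mul_right

theorem IsTest.star {f : ℝ → ℂ} (hf : IsTest f) : IsTest fun x => conj (f x) :=
  ⟨Complex.conjCLE.contDiff.comp hf.1, hf.2.comp_left (map_zero _)⟩

theorem IsTest.integrable_sq {f : ℝ → ℂ} (hf : IsTest f) : Integrable fun x => ‖f x‖ ^ 2 := by
  refine (hf.star.integrable_mul hf.continuous).norm.congr (Eventually.of_forall fun x => ?_)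
  simp [sq]

/-- Cauchy-Schwarz. -/
theorem norm_integral_conj_mul_sq_le {f v : ℝ → ℂ} (hf : Continuous f) (hv : Continuous v)
    (hf2 : Integrable fun x => ‖f x‖ ^ 2) (hv2 : Integrable fun x => ‖v x‖ ^ 2) :
    ‖∫ x, conj (f x) * v x‖ ^ 2 ≤ (∫ x, ‖f x‖ ^ 2) * ∫ x, ‖v x‖ ^ 2 := by
  have h1 : MemLp f (ENNReal.ofReal 2) := by
    rw [ENNReal.ofReal_ofNat]
    exact (memLp_two_iff_integrable_sq_norm hf.aestronglyMeasurable).2 hf2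
  have h2 : MemLp v (ENNReal.ofReal 2) := by
    rw [ENNReal.ofReal_ofNat]
    exact (memLp_two_iff_integrable_sq_norm hv.aestronglyMeasurable).2 hv2
  have h3 := integral_mul_norm_le_Lp_mul_Lq Real.HolderConjugate.two_two h1 h2
  have h4 : ‖∫ x, conj (f x) * v x‖ ≤ ∫ x, ‖f x‖ * ‖v x‖ := by
    refine (norm_integral_le_integral_norm _).trans (le_of_eq ?_)
    simp
  simp only [Real.rpow_two, ← Real.sqrt_eq_rpow] at h3
  calc ‖∫ x, conj (f x) * v x‖ ^ 2
      ≤ (Real.sqrt (∫ x, ‖f x‖ ^ 2) * Real.sqrt (∫ x, ‖v x‖ ^ 2)) ^ 2 :=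
        pow_le_pow_left₀ (norm_nonneg _) (h4.trans h3) 2
    _ = _ := by
        rw [mul_pow, Real.sq_sqrt (integral_nonneg fun _ => by positivity),
          Real.sq_sqrt (integral_nonneg fun _ => by positivity)]

namespace IsResolvent

variable {V : ℝ → ℝ} {z : ℂ} {f v v' w w' : ℝ → ℂ}

theorem continuous (h : IsResolvent V z f v v') : Continuous v :=
  continuous_iff_continuousAt.2 fun x => (h.hasDerivAt x).continuousAt

theorem integrable_sq (h : IsResolvent V z f v v') : Integrable fun x => ‖v x‖ ^ 2 := by
  have h1 := (h.right.mul h.right.star).integrable (h.left.mul h.left.star)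
    (h.continuous.mul (Complex.continuous_conj.comp h.continuous))
  refine h1.norm.congr (Eventually.of_forall fun x => ?_)
  simp [sq]

/-- Green's identity: the integrand is the derivative of Im(conj v · v'), up to sign, and the
boundary terms vanish by exponential decay. -/
theorem im_form (h : IsResolvent V z f v v') (hf : IsTest f) :
    (∫ x, conj (f x) * v x).im = z.im * ∫ x, ‖v x‖ ^ 2 := by
  have hd : ∀ x, HasDerivAt (fun x => (conj (v x) * v' x).im)
      (-(z.im * ‖v x‖ ^ 2) + (conj (f x) * v x).im) x := by
    intro x
    have h1 : HasDerivAt (fun x => conj (v x)) (conj (v' x)) x := (h.hasDerivAt x).star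
    have h2 := Complex.imCLM.hasFDerivAt.comp_hasDerivAt x (h1.mul (h.hasDerivAt' x))
    refine HasDerivAt.congr_deriv h2 ?_
    have h3 : ‖v x‖ ^ 2 = (v x).re * (v x).re + (v x).im * (v x).im := by
      rw [← Complex.normSq_eq_norm_sq, Complex.normSq_apply]
    simp [h3]
    ring
  have hi1 : Integrable fun x => -(z.im * ‖v x‖ ^ 2) := (h.integrable_sq.const_mul _).neg
  have hi2 : Integrable fun x => conj (f x) * v x := hf.star.integrable_mul h.continuous
  have hi3 : Integrable fun x => (conj (f x) * v x).im := hi2.im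
  have ht : Tendsto (fun x => (conj (v x) * v' x).im) atTop (𝓝 0) := by
    simpa [Function.comp_def] using (Complex.continuous_im.tendsto _).comp (h.right.star.mul h.right').tendsto
  have hb : Tendsto (fun x => (conj (v x) * v' x).im) atBot (𝓝 0) := by
    have h1 := (ExpDecay.tendsto_atBot (f := fun x => conj (v x) * v' x) (h.left.star.mul h.left'))
    simpa [Function.comp_def] using (Complex.continuous_im.tendsto _).comp h1
  have key := integral_of_hasDerivAt_of_tendsto hd (hi1.add hi3) hb ht
  rw [integral_add hi1 hi3, integral_neg, integral_const_mul] at key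
  have h5 : ∫ x, (conj (f x) * v x).im = (∫ x, conj (f x) * v x).im := integral_im hi2
  linarith

theorem sub (h : IsResolvent V z f v v') (h' : IsResolvent V z f w w') :
    IsResolvent V z (fun _ => 0) (fun x => v x + -1 * w x) (fun x => v' x + -1 * w' x) where
  hasDerivAt x := (h.hasDerivAt x).add ((h'.hasDerivAt x).const_mul _)
  hasDerivAt' x := ((h.hasDerivAt' x).add ((h'.hasDerivAt' x).const_mul (-1))).congr_deriv (by ring)
  right := h.right.add (h'.right.const_mul _)
  right' := h.right'.add (h'.right'.const_mul _)
  left := h.left.add (h'.left.const_mul _)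
  left' := h.left'.add (h'.left'.const_mul _)

/-- The real operator has no nonreal eigenvalue: for zero source, `im_form` reads Im z ‖v‖² = 0. -/
theorem eq_zero (h : IsResolvent V z (fun _ => 0) v v') (hz : z.im ≠ 0) (x : ℝ) : v x = 0 := by
  have h1 := h.im_form ⟨contDiff_const, HasCompactSupport.zero⟩
  simp only [map_zero, zero_mul, integral_zero, Complex.zero_im] at h1
  have h2 : ∫ x, ‖v x‖ ^ 2 = 0 := by
    rcases mul_eq_zero.1 h1.symm with h | h
    · exact absurd h hz
    · exact h
  have h3 : (fun x => ‖v x‖ ^ 2) = 0 := by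
    refine (Continuous.ae_eq_iff_eq volume (h.continuous.norm.pow 2) continuous_zero).1 ?_
    exact (integral_eq_zero_iff_of_nonneg (fun x => by positivity) h.integrable_sq).1 h2
  simpa using congrFun h3 x

theorem unique (h : IsResolvent V z f v v') (h' : IsResolvent V z f w w') (hz : z.im ≠ 0) :
    v = w := by
  funext x
  have := (h.sub h').eq_zero hz x
  linear_combination this

/-- Multiply Cauchy-Schwarz, |(f, v)|² ≤ ‖f‖² ‖v‖², by Im z; then Im z ‖v‖² = Im (f, v) ≤ |(f, v)|
allows one factor to be cancelled. -/
theorem norm_form_mul_im_le (h : IsResolvent V z f v v') (hf : IsTest f) (hz : 0 < z.im) :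
    ‖∫ x, conj (f x) * v x‖ * z.im ≤ ∫ x, ‖f x‖ ^ 2 := by
  have h1 := norm_integral_conj_mul_sq_le hf.continuous h.continuous hf.integrable_sq h.integrable_sq
  have h2 := h.im_form hf
  have h3 := (le_abs_self _).trans (Complex.abs_im_le_norm (∫ x, conj (f x) * v x))
  rw [h2] at h3
  set γ := ‖∫ x, conj (f x) * v x‖
  have h0 : 0 ≤ γ := norm_nonneg _
  have hF : 0 ≤ ∫ x, ‖f x‖ ^ 2 := integral_nonneg fun _ => by positivity
  rcases h0.eq_or_lt with h4 | h4
  · rw [← h4]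
    simpa using hF
  · refine le_of_mul_le_mul_left ?_ h4
    nlinarith [mul_le_mul_of_nonneg_right h1 hz.le, mul_le_mul_of_nonneg_left h3 hF]

/-- The resolvent form is asymptotic to `-‖f‖² / z` along the imaginary direction. -/
theorem norm_form_add_le (h : IsResolvent V z f v v') (hV : ContDiff ℝ ∞ V) (hf : IsTest f)
    (hz : 0 < z.im) :
    ‖z * (∫ x, conj (f x) * v x) + ((∫ x, ‖f x‖ ^ 2 : ℝ) : ℂ)‖ * z.im ≤
      Real.sqrt ((∫ x, ‖-deriv (deriv f) x + V x * f x‖ ^ 2) * ∫ x, ‖f x‖ ^ 2) := by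
  have hf1 : IsTest (deriv f) := ⟨hf.1.deriv', hf.2.deriv⟩
  have hf2 : IsTest (deriv (deriv f)) := ⟨hf1.1.deriv', hf1.2.deriv⟩
  have hfd : ∀ x, HasDerivAt f (deriv f x) x := fun x =>
    (hf.1.differentiable (by simp) x).hasDerivAt
  have hfd' : ∀ x, HasDerivAt (deriv f) (deriv (deriv f) x) x := fun x =>
    (hf1.1.differentiable (by simp) x).hasDerivAt
  set k : ℝ → ℂ := fun x => -deriv (deriv f) x + V x * f x with hk
  have hkt : IsTest k := by
    refine ⟨hf2.1.neg.add ((Complex.ofRealCLM.contDiff.comp hV).mul hf.1), ?_⟩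
    exact (hf2.2.neg).add (hf.2.mul_left)
  -- Green's second identity moves the operator from v to f: with k = -f'' + V f it gives z (f, v) +
  -- ‖f‖² = (k, v).
  have hd : ∀ x, HasDerivAt (fun x => conj (f x) * v' x - conj (deriv f x) * v x)
      (conj (k x) * v x - z * (conj (f x) * v x) - ((‖f x‖ ^ 2 : ℝ) : ℂ)) x := by
    intro x
    have h1 : HasDerivAt (fun x => conj (f x)) (conj (deriv f x)) x := (hfd x).star
    have h2 : HasDerivAt (fun x => conj (deriv f x)) (conj (deriv (deriv f) x)) x := (hfd' x).star
    refine ((h1.mul (h.hasDerivAt' x)).sub (h2.mul (h.hasDerivAt x))).congr_deriv ?_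
    have h3 : ((‖f x‖ ^ 2 : ℝ) : ℂ) = conj (f x) * f x := by
      rw [Complex.conj_mul']
      push_cast
      rfl
    rw [h3]
    simp only [hk, map_add, map_neg, map_mul, Complex.conj_ofReal]
    ring
  have i1 : Integrable fun x => conj (k x) * v x := hkt.star.integrable_mul h.continuous
  have i2 : Integrable fun x => conj (f x) * v x := hf.star.integrable_mul h.continuous
  have i3 : Integrable fun x => ((‖f x‖ ^ 2 : ℝ) : ℂ) := hf.integrable_sq.ofReal
  have i4 : Integrable fun x => conj (k x) * v x - z * (conj (f x) * v x) :=
    i1.sub (i2.const_mul z)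
  have hlim : ∀ l : Filter ℝ, l ≤ cocompact ℝ →
      Tendsto (fun x => conj (f x) * v' x - conj (deriv f x) * v x) l (𝓝 0) := by
    intro l hl
    have hs : HasCompactSupport fun x => conj (f x) * v' x - conj (deriv f x) * v x := by
      have h1 : HasCompactSupport fun x => conj (f x) * v' x := hf.star.2.mul_right
      have h2 : HasCompactSupport fun x => conj (deriv f x) * v x := hf1.star.2.mul_right
      exact h1.sub h2
    exact hs.is_zero_at_infty.mono_left hl
  have key := integral_of_hasDerivAt_of_tendsto hd (i4.sub i3)
    (hlim _ atBot_le_cocompact) (hlim _ atTop_le_cocompact)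
  rw [integral_sub i4 i3, integral_sub i1 (i2.const_mul z),
    integral_const_mul, integral_complex_ofReal, sub_self] at key
  have key2 : z * (∫ x, conj (f x) * v x) + ((∫ x, ‖f x‖ ^ 2 : ℝ) : ℂ) = ∫ x, conj (k x) * v x := by
    linear_combination -key
  rw [key2]
  have c1 := norm_integral_conj_mul_sq_le hkt.continuous h.continuous hkt.integrable_sq h.integrable_sq
  have c2 := h.norm_form_mul_im_le hf hz
  have c3 := (le_abs_self _).trans (Complex.abs_im_le_norm (∫ x, conj (f x) * v x))
  rw [h.im_form hf] at c3
  refine Real.le_sqrt_of_sq_le ?_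
  have hK : 0 ≤ ∫ x, ‖k x‖ ^ 2 := integral_nonneg fun _ => by positivity
  -- Combines Im z ‖v‖² ≤ |(f, v)| with |(f, v)| Im z ≤ ‖f‖².
  have c4 : (∫ x, ‖v x‖ ^ 2) * z.im ^ 2 ≤ ∫ x, ‖f x‖ ^ 2 := by nlinarith
  calc (‖∫ x, conj (k x) * v x‖ * z.im) ^ 2 = ‖∫ x, conj (k x) * v x‖ ^ 2 * z.im ^ 2 := by ring
    _ ≤ ((∫ x, ‖k x‖ ^ 2) * ∫ x, ‖v x‖ ^ 2) * z.im ^ 2 := by gcongr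
    _ = (∫ x, ‖k x‖ ^ 2) * ((∫ x, ‖v x‖ ^ 2) * z.im ^ 2) := by ring
    _ ≤ _ := mul_le_mul_of_nonneg_left c4 hK

end IsResolvent

/-! ### Wronskians and the resolvent kernel -/

namespace IsSol

variable {V : ℝ → ℝ} {z : ℂ} {a a' b b' : ℝ → ℂ}

theorem continuous (h : IsSol V z a a') : Continuous a :=
  continuous_iff_continuousAt.2 fun x => (h.hasDerivAt x).continuousAt

theorem continuous' (h : IsSol V z a a') : Continuous a' :=
  continuous_iff_continuousAt.2 fun x => (h.hasDerivAt' x).continuousAt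

theorem wronskian_eq (ha : IsSol V z a a') (hb : IsSol V z b b') (x y : ℝ) :
    a' x * b x - a x * b' x = a' y * b y - a y * b' y := by
  have hd : ∀ x, HasDerivAt (fun x => a' x * b x - a x * b' x) 0 x := fun x =>
    (((ha.hasDerivAt' x).mul (hb.hasDerivAt x)).sub
      ((ha.hasDerivAt x).mul (hb.hasDerivAt' x))).congr_deriv (by ring)
  exact is_const_of_deriv_eq_zero (fun x => (hd x).differentiableAt) (fun x => (hd x).deriv) x y

theorem add (ha : IsSol V z a a') (hb : IsSol V z b b') (k l : ℂ) :
    IsSol V z (fun x => k * a x + l * b x) (fun x => k * a' x + l * b' x) where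
  hasDerivAt x := ((ha.hasDerivAt x).const_mul k).add ((hb.hasDerivAt x).const_mul l)
  hasDerivAt' x := (((ha.hasDerivAt' x).const_mul k).add
    ((hb.hasDerivAt' x).const_mul l)).congr_deriv (by ring)

theorem const_mul (ha : IsSol V z a a') (k : ℂ) :
    IsSol V z (fun x => k * a x) (fun x => k * a' x) where
  hasDerivAt x := (ha.hasDerivAt x).const_mul k
  hasDerivAt' x := ((ha.hasDerivAt' x).const_mul k).congr_deriv (by ring)

theorem star (ha : IsSol V z a a') :
    IsSol V (conj z) (fun x => conj (a x)) (fun x => conj (a' x)) where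
  hasDerivAt x := (ha.hasDerivAt x).star
  hasDerivAt' x := by
    refine HasDerivAt.congr_deriv (ha.hasDerivAt' x).star ?_
    simp

/-- Uniqueness for the first-order system, which is globally Lipschitz because `V` is bounded. -/
theorem eq_zero (hV : ∃ M, ∀ x, |V x| ≤ M) (ha : IsSol V z a a') {x₀ : ℝ} (h0 : a x₀ = 0)
    (h0' : a' x₀ = 0) (x : ℝ) : a x = 0 ∧ a' x = 0 := by
  obtain ⟨M, hM⟩ := hV
  have hM0 : 0 ≤ M := (abs_nonneg _).trans (hM 0)
  let v : ℝ → ℂ × ℂ → ℂ × ℂ := fun t p => (p.2, (V t - z) * p.1)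
  have hv : ∀ t, LipschitzOnWith (Real.toNNReal (1 + M + ‖z‖)) (v t) Set.univ := by
    intro t
    refine LipschitzOnWith.of_dist_le_mul fun p _ q _ => ?_
    have hn : (0 : ℝ) ≤ 1 + M + ‖z‖ := by positivity
    rw [Real.coe_toNNReal _ hn, dist_eq_norm, dist_eq_norm]
    have h1 : v t p - v t q = ((p - q).2, (V t - z) * (p - q).1) := by
      ext <;> simp [v, mul_sub]
    rw [h1, Prod.norm_mk]
    have h2 : ‖(V t : ℂ) - z‖ ≤ M + ‖z‖ := (norm_sub_le _ _).trans
      (add_le_add (by simpa using hM t) le_rfl)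
    refine max_le ((norm_snd_le _).trans ?_) ?_
    · nlinarith [norm_nonneg (p - q), mul_nonneg (add_nonneg hM0 (norm_nonneg z)) (norm_nonneg (p - q))]
    · rw [norm_mul]
      refine mul_le_mul (by linarith) (norm_fst_le _) (norm_nonneg _) hn
  have key := ODE_solution_unique_univ (v := v) (s := fun _ => Set.univ) (t₀ := x₀)
    (f := fun t => (a t, a' t)) (g := fun _ => (0, 0)) hv
    (fun t => ⟨(ha.hasDerivAt t).prodMk (ha.hasDerivAt' t), trivial⟩)
    (fun t => ⟨(hasDerivAt_const t ((0, 0) : ℂ × ℂ)).congr_deriv (by simp [v, Prod.zero_eq_mk]), trivial⟩)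
    (by simp [h0, h0'])
  have := congrFun key x
  simpa using this

/-- Solutions with vanishing Wronskian are proportional. -/
theorem exists_eq_mul (hV : ∃ M, ∀ x, |V x| ≤ M) (ha : IsSol V z a a') (hb : IsSol V z b b')
    {x₀ : ℝ} (h0 : a x₀ ≠ 0) {x₁ : ℝ} (hW : a' x₁ * b x₁ - a x₁ * b' x₁ = 0) :
    ∃ κ : ℂ, ∀ x, b x = κ * a x ∧ b' x = κ * a' x := by
  have hW' := (ha.wronskian_eq hb x₀ x₁).trans hW
  refine ⟨b x₀ / a x₀, fun x => ?_⟩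
  -- This combination vanishes at `x₀` by its coefficient, and its derivative vanishes there because
  -- the Wronskian does.
  have h := (ha.add hb (-(b x₀ / a x₀)) 1).eq_zero hV (x₀ := x₀) (by field_simp; ring)
    (by field_simp; linear_combination -hW') x
  constructor
  · linear_combination h.1
  · linear_combination h.2

end IsSol

/-- A pair of families of solutions of `-u'' + V u = z u`, decaying at `+∞` and `-∞`. -/
structure IsJostPair (V : ℝ → ℝ) (U : Set ℂ) (a a' b b' : ℝ → ℂ → ℂ) : Prop where
  solA : ∀ z ∈ U, IsSol V z (fun x => a x z) (fun x => a' x z)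
  solB : ∀ z ∈ U, IsSol V z (fun x => b x z) (fun x => b' x z)
  contA : ContinuousOn (fun p : ℝ × ℂ => a p.1 p.2) (Set.univ ×ˢ U)
  contA' : ContinuousOn (fun p : ℝ × ℂ => a' p.1 p.2) (Set.univ ×ˢ U)
  contB : ContinuousOn (fun p : ℝ × ℂ => b p.1 p.2) (Set.univ ×ˢ U)
  contB' : ContinuousOn (fun p : ℝ × ℂ => b' p.1 p.2) (Set.univ ×ˢ U)
  holA : IsOpen U → ∀ x, DifferentiableOn ℂ (a x) U
  holA' : IsOpen U → ∀ x, DifferentiableOn ℂ (a' x) U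
  holB : IsOpen U → ∀ x, DifferentiableOn ℂ (b x) U
  holB' : IsOpen U → ∀ x, DifferentiableOn ℂ (b' x) U
  neA : ∀ z ∈ U, ∃ x, a x z ≠ 0
  neB : ∀ z ∈ U, ∃ x, b x z ≠ 0
  decA : ∀ z ∈ U, (z.im ≠ 0 ∨ z.re < 0) →
    ExpDecay (fun x => a x z) ∧ ExpDecay (fun x => a' x z)
  decB : ∀ z ∈ U, (z.im ≠ 0 ∨ z.re < 0) →
    ExpDecay (fun x => b (-x) z) ∧ ExpDecay (fun x => b' (-x) z)

theorem IsWKBFamily.exists_ne_zero {V Q : ℝ → ℝ} {U : Set ℂ} {u u' : ℝ → ℂ → ℂ}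
    (h : IsWKBFamily V Q U u u') {z : ℂ} (hz : z ∈ U) : ∃ x, u x z ≠ 0 := by
  by_contra! hc
  have := h.asymp z hz
  simp only [hc, zero_div] at this
  exact zero_ne_one (tendsto_nhds_unique tendsto_const_nhds this)

/-- The solution decaying at -∞ is the reflection of the one decaying at +∞ for the reflected
potential, so only the right half-line needs a construction. -/
theorem isJostPair_of_families {V Qp Qm : ℝ → ℝ} {U : Set ℂ} {u u' v v' : ℝ → ℂ → ℂ}
    (hu : IsWKBFamily V Qp U u u') (hud : IsDecaying U u u')
    (hv : IsWKBFamily (fun x => V (-x)) Qm U v v') (hvd : IsDecaying U v v') :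
    IsJostPair V U u u' (fun x z => v (-x) z) (fun x z => -v' (-x) z) where
  solA z hz := ⟨fun x => hu.deriv x z hz, fun x => hu.deriv' x z hz⟩
  solB z hz := by
    refine ⟨fun x => ?_, fun x => ?_⟩
    · exact ((hv.deriv (-x) z hz).scomp x (hasDerivAt_neg x)).congr_deriv (by simp)
    · refine ((hv.deriv' (-x) z hz).scomp x (hasDerivAt_neg x)).neg.congr_deriv (by simp)
  contA := hu.cont
  contA' := hu.cont'
  contB := hv.cont.comp (f := fun p : ℝ × ℂ => (-p.1, p.2)) (by fun_prop) fun p hp => ⟨trivial, hp.2⟩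
  contB' := (hv.cont'.comp (f := fun p : ℝ × ℂ => (-p.1, p.2)) (by fun_prop)
    fun p hp => ⟨trivial, hp.2⟩).neg
  holA := hu.hol
  holA' := hu.hol'
  holB hU x := hv.hol hU (-x)
  holB' hU x := (hv.hol' hU (-x)).neg
  neA z hz := hu.exists_ne_zero hz
  neB z hz := by
    obtain ⟨x, hx⟩ := hv.exists_ne_zero hz
    exact ⟨-x, by simpa using hx⟩
  decA z hz hz' := ⟨(hud z hz hz').fst, (hud z hz hz').snd⟩
  decB z hz hz' := by
    refine ⟨by simpa using (hvd z hz hz').fst, ?_⟩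
    have := (hvd z hz hz').snd.const_mul (-1)
    simpa using this

/-- The Wronskian of a pair of families. -/
def jostW (a a' b b' : ℝ → ℂ → ℂ) (z : ℂ) : ℂ := a' 0 z * b 0 z - a 0 z * b' 0 z

/-- The numerator of the resolvent form. -/
noncomputable def jostN (a b : ℝ → ℂ → ℂ) (f : ℝ → ℂ) (z : ℂ) : ℂ :=
  -∫ p : ℝ × ℝ, conj (f p.1) * f p.2 * (a (max p.1 p.2) z * b (min p.1 p.2) z)

theorem IsTest.exists_support {f : ℝ → ℂ} (hf : IsTest f) :
    ∃ L > 0, ∀ x, f x ≠ 0 → x ∈ Set.Ioo (-L) L := by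
  obtain ⟨L, hL⟩ := hf.2.isBounded.subset_ball 0
  refine ⟨max L 1, lt_max_of_lt_right one_pos, fun x hx => ?_⟩
  have h1 := hL (subset_tsupport f (Function.mem_support.2 hx))
  rw [Metric.mem_ball, dist_zero_right, Real.norm_eq_abs] at h1
  exact abs_lt.1 (h1.trans_le (le_max_left _ _))

/-- Variation of constants. -/
theorem IsSol.exists_isResolvent {V : ℝ → ℝ} {z : ℂ} {a a' b b' f : ℝ → ℂ} (ha : IsSol V z a a')
    (hb : IsSol V z b b') (hW : a' 0 * b 0 - a 0 * b' 0 ≠ 0) (hA : ExpDecay a) (hA' : ExpDecay a')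
    (hB : ExpDecay fun x => b (-x)) (hB' : ExpDecay fun x => b' (-x)) (hf : IsTest f) :
    ∃ v v', IsResolvent V z f v v' ∧ ∫ x, conj (f x) * v x =
      (-∫ p : ℝ × ℝ, conj (f p.1) * f p.2 * (a (max p.1 p.2) * b (min p.1 p.2))) /
        (a' 0 * b 0 - a 0 * b' 0) := by
  obtain ⟨L, hL0, hL⟩ := hf.exists_support
  set W := a' 0 * b 0 - a 0 * b' 0
  have hWx : ∀ x, a' x * b x - a x * b' x = W := fun x => ha.wronskian_eq hb x 0
  have hac := ha.continuous
  have hbc := hb.continuous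
  have hac' := ha.continuous'
  have hbc' := hb.continuous'
  have hfc := hf.continuous
  -- `P` and `R` are constant outside (-L, L). Thus v is a multiple of a to the right of the support
  -- and of b to the left, and inherits their decay.
  let P : ℝ → ℂ := fun x => ∫ t in (-L)..x, b t * f t
  let R : ℝ → ℂ := fun x => ∫ t in x..L, a t * f t
  have hP : ∀ x, HasDerivAt P (b x * f x) x := fun x =>
    ((hbc.mul hfc).integral_hasStrictDerivAt (-L) x).hasDerivAt
  have hR : ∀ x, HasDerivAt R (-(a x * f x)) x := fun x =>
    intervalIntegral.integral_hasDerivAt_left ((hac.mul hfc).intervalIntegrable _ _)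
      (hac.mul hfc).aestronglyMeasurable.stronglyMeasurableAtFilter (hac.mul hfc).continuousAt
  have hPc : Continuous P := continuous_iff_continuousAt.2 fun x => (hP x).continuousAt
  have hRc : Continuous R := continuous_iff_continuousAt.2 fun x => (hR x).continuousAt
  have hf0 : ∀ x, x ∉ Set.Ioo (-L) L → f x = 0 := fun x hx => by
    by_contra hc
    exact hx (hL x hc)
  have hPr : ∀ x, L ≤ x → P x = P L ∧ R x = 0 := by
    intro x hx
    have h1 : ∀ g : ℝ → ℂ, Continuous g → ∫ t in L..x, g t * f t = 0 := by
      intro g _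
      refine (intervalIntegral.integral_congr (g := fun _ => 0) fun t ht => ?_).trans (by simp)
      rw [Set.uIcc_of_le hx] at ht
      simp [hf0 t fun h => absurd h.2 (not_lt.2 ht.1)]
    constructor
    · rw [← sub_eq_zero, ← h1 b hbc]
      exact intervalIntegral.integral_interval_sub_left ((hbc.mul hfc).intervalIntegrable _ _)
        ((hbc.mul hfc).intervalIntegrable _ _)
    · simp only [R]
      rw [intervalIntegral.integral_symm, h1 a hac, neg_zero]
  have hPl : ∀ x, x ≤ -L → P x = 0 ∧ R x = R (-L) := by
    intro x hx
    have h1 : ∀ g : ℝ → ℂ, Continuous g → ∫ t in x..(-L), g t * f t = 0 := by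
      intro g _
      refine (intervalIntegral.integral_congr (g := fun _ => 0) fun t ht => ?_).trans (by simp)
      rw [Set.uIcc_of_le hx] at ht
      simp [hf0 t fun h => absurd h.1 (not_lt.2 ht.2)]
    constructor
    · simp only [P]
      rw [intervalIntegral.integral_symm, h1 b hbc, neg_zero]
    · simp only [R]
      have hc : Continuous fun t => a t * f t := by fun_prop
      rw [← intervalIntegral.integral_add_adjacent_intervals
        (hc.intervalIntegrable x (-L)) (hc.intervalIntegrable (-L) L), h1 a hac, zero_add]
  let v : ℝ → ℂ := fun x => -W⁻¹ * (a x * P x + b x * R x)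
  let v' : ℝ → ℂ := fun x => -W⁻¹ * (a' x * P x + b' x * R x)
  have hvc : Continuous v := by fun_prop
  have hvc' : Continuous v' := by fun_prop
  refine ⟨v, v', ⟨fun x => ?_, fun x => ?_, ?_, ?_, ?_, ?_⟩, ?_⟩
  · exact ((((ha.hasDerivAt x).mul (hP x)).add ((hb.hasDerivAt x).mul (hR x))).const_mul
      (-W⁻¹)).congr_deriv (by simp only [v']; ring)
  · refine ((((ha.hasDerivAt' x).mul (hP x)).add ((hb.hasDerivAt' x).mul (hR x))).const_mul
      (-W⁻¹)).congr_deriv ?_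
    simp only [v]
    have h1 : W⁻¹ * (a' x * b x - a x * b' x) = 1 := by rw [hWx, inv_mul_cancel₀ hW]
    linear_combination (-f x) * h1
  · refine (hA.const_mul (-W⁻¹ * P L)).of_eventuallyEq hvc ?_
    filter_upwards [eventually_ge_atTop L] with x hx
    simp only [v, hPr x hx]
    ring
  · refine (hA'.const_mul (-W⁻¹ * P L)).of_eventuallyEq hvc' ?_
    filter_upwards [eventually_ge_atTop L] with x hx
    simp only [v', hPr x hx]
    ring
  · refine (hB.const_mul (-W⁻¹ * R (-L))).of_eventuallyEq (hvc.comp continuous_neg) ?_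
    filter_upwards [eventually_ge_atTop L] with x hx
    simp only [v, hPl (-x) (neg_le_neg hx)]
    ring
  · refine (hB'.const_mul (-W⁻¹ * R (-L))).of_eventuallyEq (hvc'.comp continuous_neg) ?_
    filter_upwards [eventually_ge_atTop L] with x hx
    simp only [v', hPl (-x) (neg_le_neg hx)]
    ring
  · have hKc : Continuous fun p : ℝ × ℝ =>
        conj (f p.1) * f p.2 * (a (max p.1 p.2) * b (min p.1 p.2)) := by
      have := Complex.continuous_conj
      fun_prop
    have hKi : Integrable fun p : ℝ × ℝ =>
        conj (f p.1) * f p.2 * (a (max p.1 p.2) * b (min p.1 p.2)) := by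
      refine hKc.integrable_of_hasCompactSupport ?_
      refine HasCompactSupport.intro (hf.2.isCompact.prod hf.2.isCompact) fun p hp => ?_
      rw [Set.mem_prod, not_and_or] at hp
      rcases hp with h | h
      · simp [image_eq_zero_of_notMem_tsupport h]
      · simp [image_eq_zero_of_notMem_tsupport h]
    rw [Measure.volume_eq_prod] at hKi ⊢
    rw [integral_prod _ hKi, eq_div_iff hW, ← integral_neg, ← integral_mul_const]
    refine integral_congr_ae (Eventually.of_forall fun x => ?_)
    simp only
    by_cases hx : x ∈ Set.Ioo (-L) L
    -- Splitting the inner integral at y = x resolves the maximum and the minimum.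
    · have h1 : ∫ y, conj (f x) * f y * (a (max x y) * b (min x y)) =
          conj (f x) * (a x * P x + b x * R x) := by
        simp_rw [mul_assoc (conj (f x))]
        rw [integral_const_mul]
        congr 1
        rw [← intervalIntegral.integral_eq_integral_of_support_subset (a := -L) (b := L)
          (fun y hy => ?_)]
        · have hc : Continuous fun y => f y * (a (max x y) * b (min x y)) := by fun_prop
          rw [← intervalIntegral.integral_add_adjacent_intervals
            (hc.intervalIntegrable (-L) x) (hc.intervalIntegrable x L)]
          congr 1
          · simp only [P]
            rw [← intervalIntegral.integral_const_mul]
            refine intervalIntegral.integral_congr fun y hy => ?_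
            rw [Set.uIcc_of_le hx.1.le] at hy
            simp only [max_eq_left hy.2, min_eq_right hy.2]
            ring
          · simp only [R]
            rw [← intervalIntegral.integral_const_mul]
            refine intervalIntegral.integral_congr fun y hy => ?_
            rw [Set.uIcc_of_le hx.2.le] at hy
            simp only [max_eq_right hy.1, min_eq_left hy.1]
            ring
        · have h2 : f y ≠ 0 := fun h => hy (by simp [h])
          exact Set.Ioo_subset_Ioc_self (hL y h2)
      rw [h1]
      simp only [v]
      field_simp
    · simp [hf0 x hx]

namespace IsJostPair

variable {V : ℝ → ℝ} {U : Set ℂ} {a a' b b' : ℝ → ℂ → ℂ} {f : ℝ → ℂ}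

theorem exists_isResolvent (h : IsJostPair V U a a' b b') {z : ℂ} (hz : z ∈ U)
    (hz' : z.im ≠ 0 ∨ z.re < 0) (hW : jostW a a' b b' z ≠ 0) (hf : IsTest f) :
    ∃ v v', IsResolvent V z f v v' ∧
      ∫ x, conj (f x) * v x = jostN a b f z / jostW a a' b b' z :=
  (h.solA z hz).exists_isResolvent (h.solB z hz) hW (h.decA z hz hz').1 (h.decA z hz hz').2
    (h.decB z hz hz').1 (h.decB z hz hz').2 hf

/-- At a zero of the Wronskian there is a solution decaying on both sides. -/
theorem exists_eigenfunction (hV : ∃ M, ∀ x, |V x| ≤ M) (h : IsJostPair V U a a' b b') {z : ℂ}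
    (hz : z ∈ U) (hz' : z.im ≠ 0 ∨ z.re < 0) (hW : jostW a a' b b' z = 0) :
    (∃ κ : ℂ, κ ≠ 0 ∧ ∀ x, b x z = κ * a x z) ∧
      IsResolvent V z (fun _ => 0) (fun x => a x z) (fun x => a' x z) := by
  obtain ⟨x₀, h0⟩ := h.neA z hz
  obtain ⟨κ, hκ⟩ := (h.solA z hz).exists_eq_mul hV (h.solB z hz) h0 hW
  have hκ0 : κ ≠ 0 := by
    rintro rfl
    obtain ⟨x₁, h1⟩ := h.neB z hz
    exact h1 (by simpa using (hκ x₁).1)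
  refine ⟨⟨κ, hκ0, fun x => (hκ x).1⟩, fun x => (h.solA z hz).hasDerivAt x, fun x => ?_,
    (h.decA z hz hz').1, (h.decA z hz hz').2, ?_, ?_⟩
  · simpa using (h.solA z hz).hasDerivAt' x
  · refine ((h.decB z hz hz').1.const_mul κ⁻¹).of_eventuallyEq
      ((h.solA z hz).continuous.comp continuous_neg) (Eventually.of_forall fun x => ?_)
    rw [(hκ (-x)).1, inv_mul_cancel_left₀ hκ0]
  · refine ((h.decB z hz hz').2.const_mul κ⁻¹).of_eventuallyEq
      ((h.solA z hz).continuous'.comp continuous_neg) (Eventually.of_forall fun x => ?_)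
    rw [(hκ (-x)).2, inv_mul_cancel_left₀ hκ0]

/-- A zero would produce a nontrivial solution decaying at both ends with nonreal energy. -/
theorem jostW_ne_zero (hV : ∃ M, ∀ x, |V x| ≤ M) (h : IsJostPair V U a a' b b') {z : ℂ}
    (hz : z ∈ U) (hz' : z.im ≠ 0) : jostW a a' b b' z ≠ 0 := by
  intro hW
  obtain ⟨x, hx⟩ := h.neA z hz
  exact hx ((h.exists_eigenfunction hV hz (Or.inl hz') hW).2.eq_zero hz' x)

theorem continuousOn_section {c : ℝ → ℂ → ℂ}
    (hc : ContinuousOn (fun p : ℝ × ℂ => c p.1 p.2) (Set.univ ×ˢ U)) (x : ℝ) :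
    ContinuousOn (c x) U :=
  hc.comp (f := fun z : ℂ => (x, z)) (by fun_prop) fun z hz => ⟨trivial, hz⟩

theorem continuousOn_jostW (h : IsJostPair V U a a' b b') : ContinuousOn (jostW a a' b b') U :=
  ((continuousOn_section h.contA' 0).mul (continuousOn_section h.contB 0)).sub
    ((continuousOn_section h.contA 0).mul (continuousOn_section h.contB' 0))

theorem differentiableOn_jostW (h : IsJostPair V U a a' b b') (hU : IsOpen U) :
    DifferentiableOn ℂ (jostW a a' b b') U :=
  ((h.holA' hU 0).mul (h.holB hU 0)).sub ((h.holA hU 0).mul (h.holB' hU 0))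

theorem continuousOn_integrand (h : IsJostPair V U a a' b b') (hf : IsTest f) :
    ContinuousOn (fun q : ℂ × (ℝ × ℝ) => conj (f q.2.1) * f q.2.2 *
      (a (max q.2.1 q.2.2) q.1 * b (min q.2.1 q.2.2) q.1)) (U ×ˢ Set.univ) := by
  have hfc := hf.continuous
  have hcc := Complex.continuous_conj
  have h1 : ContinuousOn (fun q : ℂ × (ℝ × ℝ) => a (max q.2.1 q.2.2) q.1) (U ×ˢ Set.univ) :=
    h.contA.comp (f := fun q : ℂ × (ℝ × ℝ) => (max q.2.1 q.2.2, q.1)) (by fun_prop)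
      fun q hq => ⟨trivial, hq.1⟩
  have h2 : ContinuousOn (fun q : ℂ × (ℝ × ℝ) => b (min q.2.1 q.2.2) q.1) (U ×ˢ Set.univ) :=
    h.contB.comp (f := fun q : ℂ × (ℝ × ℝ) => (min q.2.1 q.2.2, q.1)) (by fun_prop)
      fun q hq => ⟨trivial, hq.1⟩
  have h3 : Continuous fun q : ℂ × (ℝ × ℝ) => conj (f q.2.1) * f q.2.2 := by fun_prop
  exact h3.continuousOn.mul (h1.mul h2)

theorem integrand_eq_zero (w : ℂ) {p : ℝ × ℝ} (hp : p ∉ tsupport f ×ˢ tsupport f) :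
    conj (f p.1) * f p.2 * w = 0 := by
  rw [Set.mem_prod, not_and_or] at hp
  rcases hp with h | h
  · simp [image_eq_zero_of_notMem_tsupport h]
  · simp [image_eq_zero_of_notMem_tsupport h]

theorem continuousOn_jostN (h : IsJostPair V U a a' b b') (hf : IsTest f) :
    ContinuousOn (jostN a b f) U :=
  (continuousOn_integral_of_compact_support (hf.2.isCompact.prod hf.2.isCompact)
    (f := fun z (p : ℝ × ℝ) => conj (f p.1) * f p.2 * (a (max p.1 p.2) z * b (min p.1 p.2) z))
    (h.continuousOn_integrand hf) fun _ _ _ hp => integrand_eq_zero _ hp).neg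

theorem differentiableOn_jostN (h : IsJostPair V U a a' b b') (hU : IsOpen U) (hf : IsTest f) :
    DifferentiableOn ℂ (jostN a b f) U := by
  have hint := h.continuousOn_integrand hf
  refine (differentiableOn_integral_of_dominated hU
    (Φ := fun z (p : ℝ × ℝ) => conj (f p.1) * f p.2 * (a (max p.1 p.2) z * b (min p.1 p.2) z))
    (fun z hz => ?_) (fun z₀ hz₀ => ?_) fun p => ?_).neg
  · have : Continuous fun p : ℝ × ℝ =>
        conj (f p.1) * f p.2 * (a (max p.1 p.2) z * b (min p.1 p.2) z) := by
      rw [← continuousOn_univ]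
      exact hint.comp (f := fun p : ℝ × ℝ => (z, p)) (by fun_prop) fun p _ => ⟨hz, trivial⟩
    exact this.aestronglyMeasurable
  · obtain ⟨r, hr, hrU⟩ := Metric.nhds_basis_closedBall.mem_iff.1 (hU.mem_nhds hz₀)
    have hKc : IsCompact (tsupport f ×ˢ tsupport f) := hf.2.isCompact.prod hf.2.isCompact
    obtain ⟨C, hC⟩ := ((isCompact_closedBall z₀ r).prod hKc).exists_bound_of_continuousOn
      (hint.mono (Set.prod_mono hrU (Set.subset_univ _)))
    refine ⟨Metric.closedBall z₀ r, Metric.closedBall_mem_nhds _ hr,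
      (tsupport f ×ˢ tsupport f).indicator fun _ => C, ?_, Eventually.of_forall fun p z hz => ?_⟩
    · exact (integrable_indicator_iff hKc.measurableSet).2
        (integrableOn_const hKc.measure_lt_top.ne)
    · by_cases hp : p ∈ tsupport f ×ˢ tsupport f
      · rw [Set.indicator_of_mem hp]
        exact hC (z, p) ⟨hz.1, hp⟩
      · rw [Set.indicator_of_notMem hp, integrand_eq_zero _ hp, norm_zero]
  · exact ((h.holA hU _).mul (h.holB hU _)).const_mul _

end IsJostPair

/-! ### Boundary values of holomorphic functions with nonnegative imaginary part -/

theorem integrable_poisson {δ : ℝ} (hδ : 0 < δ) : Integrable fun x : ℝ => δ / (x ^ 2 + δ ^ 2) := by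
  have h := (integrable_inv_one_add_sq.comp_div hδ.ne').const_mul δ⁻¹
  refine h.congr (Eventually.of_forall fun x => ?_)
  simp only
  field_simp
  ring

theorem integral_poisson {δ : ℝ} (hδ : 0 < δ) : ∫ x : ℝ, δ / (x ^ 2 + δ ^ 2) = Real.pi := by
  have h := Measure.integral_comp_div (fun x : ℝ => (1 + x ^ 2)⁻¹) δ
  rw [integral_univ_inv_one_add_sq, abs_of_pos hδ, smul_eq_mul] at h
  have h2 : ∀ x : ℝ, δ / (x ^ 2 + δ ^ 2) = δ⁻¹ * (1 + (x / δ) ^ 2)⁻¹ := by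
    intro x
    field_simp
    ring
  simp_rw [h2]
  rw [integral_const_mul, h, inv_mul_cancel_left₀ hδ.ne']

/-- Poisson's formula for the half-plane. -/
theorem poisson_formula {h : ℂ → ℂ} {ε B δ : ℝ} (hε : 0 < ε)
    (hd : DifferentiableOn ℂ h {z | -ε < z.im}) (hB : ∀ z : ℂ, 0 ≤ z.im → ‖h z‖ ≤ B) (hδ : 0 < δ) :
    Integrable (fun x : ℝ => ((δ / (x ^ 2 + δ ^ 2) : ℝ) : ℂ) * h x) ∧
      ∫ x : ℝ, ((δ / (x ^ 2 + δ ^ 2) : ℝ) : ℂ) * h x = Real.pi * h (δ * Complex.I) := by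
  have hopen : IsOpen {z : ℂ | -ε < z.im} := isOpen_lt continuous_const Complex.continuous_im
  have hB0 : 0 ≤ B := (norm_nonneg _).trans (hB 0 le_rfl)
  have hc : Continuous fun x : ℝ => h x := by
    refine continuous_iff_continuousAt.2 fun x => ?_
    have h1 : ContinuousAt h (x : ℂ) :=
      (hd.differentiableAt (hopen.mem_nhds (by simpa using hε))).continuousAt
    exact h1.comp Complex.continuous_ofReal.continuousAt
  have hPi := integrable_poisson hδ
  have hi1 : Integrable fun x : ℝ => ((δ / (x ^ 2 + δ ^ 2) : ℝ) : ℂ) * h x :=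
    (hPi.ofReal (𝕜 := ℂ)).mul_bdd (c := B) hc.aestronglyMeasurable
      (Eventually.of_forall fun x => hB x (by simp))
  refine ⟨hi1, ?_⟩
  set p : ℂ := δ * Complex.I with hp
  have hpim : p.im = δ := by simp [hp]
  have hpU : {z : ℂ | -ε < z.im} ∈ 𝓝 p := hopen.mem_nhds (by
    show -ε < p.im
    rw [hpim]
    linarith)
  -- Since p² = -δ², this is (h(z) - h(p)) / (z² + δ²) with the singularity at p removed; the other
  -- zero -p lies below the real axis.
  let D : ℂ → ℂ := fun z => dslope h p z / (z + p)
  have hDd : DifferentiableOn ℂ D {z : ℂ | 0 ≤ z.im} := by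
    refine (((Complex.differentiableOn_dslope hpU).2 hd).mono fun z hz => ?_).div
      (by fun_prop) fun z hz h0 => ?_
    · have hz' : 0 ≤ z.im := hz
      show -ε < z.im
      linarith
    · have hz' : 0 ≤ z.im := hz
      have := congrArg Complex.im h0
      rw [Complex.add_im, hpim, Complex.zero_im] at this
      linarith
  have hp2 : p ^ 2 = -(δ : ℂ) ^ 2 := by rw [hp, mul_pow, Complex.I_sq]; ring
  have hDz : ∀ z : ℂ, z ≠ p → D z = (h z - h p) / (z ^ 2 + δ ^ 2) := by
    intro z hz
    simp only [D]
    rw [dslope_of_ne _ hz, slope_def_field, div_div]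
    congr 1
    linear_combination -hp2
  have hDr : ∀ x : ℝ, D x = ((δ / (x ^ 2 + δ ^ 2) : ℝ) : ℂ) * h x * (δ : ℂ)⁻¹ -
      ((δ / (x ^ 2 + δ ^ 2) : ℝ) : ℂ) * (δ : ℂ)⁻¹ * h p := by
    intro x
    rw [hDz]
    · have h1 : ((x : ℂ) ^ 2 + (δ : ℂ) ^ 2) ≠ 0 := by
        have : (0 : ℝ) < x ^ 2 + δ ^ 2 := by positivity
        exact_mod_cast this.ne'
      have h2 : (δ : ℂ) ≠ 0 := by exact_mod_cast hδ.ne'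
      push_cast
      field_simp
    · intro hc
      have := congrArg Complex.im hc
      rw [hpim, Complex.ofReal_im] at this
      linarith
  have hDi : Integrable fun x : ℝ => D x := by
    simp_rw [hDr]
    exact (hi1.mul_const _).sub (((hPi.ofReal (𝕜 := ℂ)).mul_const _).mul_const _)
  have hbound : ∀ R : ℝ, δ < R → ∀ z : ℂ, 0 ≤ z.im → R ≤ ‖z‖ → ‖D z‖ ≤ 2 * B / (R ^ 2 - δ ^ 2) := by
    intro R hR z hz hzR
    have hne : z ≠ p := by
      rintro rfl
      have : ‖p‖ = δ := by simp [hp, abs_of_pos hδ]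
      linarith
    rw [hDz z hne, norm_div]
    have h1 : R ^ 2 - δ ^ 2 ≤ ‖z ^ 2 + (δ : ℂ) ^ 2‖ := by
      have := norm_sub_le_norm_add (z ^ 2) ((δ : ℂ) ^ 2)
      rw [norm_pow, norm_pow, Complex.norm_real, Real.norm_of_nonneg hδ.le] at this
      have h3 : R ^ 2 ≤ ‖z‖ ^ 2 := pow_le_pow_left₀ (hδ.le.trans hR.le) hzR 2
      linarith
    have h2 : ‖h z - h p‖ ≤ 2 * B := by
      have := norm_sub_le (h z) (h p)
      have := hB z hz
      have := hB p (by rw [hpim]; exact hδ.le)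
      linarith
    have h3 : 0 < R ^ 2 - δ ^ 2 := by nlinarith
    exact div_le_div₀ (by positivity) h2 h3 h1
  -- Cauchy's theorem on [-R, R] × [0, R]: the other three sides have total length 4R, and `D` is
  -- O(R⁻²) there.
  have hrect : ∀ R : ℝ, δ < R → ‖∫ x in (-R)..R, D (x : ℂ)‖ ≤ 4 * R * (2 * B / (R ^ 2 - δ ^ 2)) := by
    intro R hR
    have hR0 : 0 < R := hδ.trans hR
    have hI := Complex.integral_boundary_rect_eq_zero_of_differentiableOn D (-R : ℂ) (R + R * Complex.I)
      (hDd.mono fun z hz => by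
        have := hz.2
        simp only [Complex.neg_im, Complex.ofReal_im, neg_zero, Complex.add_im, Complex.mul_im,
          Complex.ofReal_re, Complex.I_im, mul_one, Complex.I_re, mul_zero, add_zero, zero_add,
          Set.mem_preimage, Set.uIcc_of_le hR0.le] at this
        exact this.1)
    simp only [Complex.neg_re, Complex.neg_im, Complex.ofReal_re, Complex.ofReal_im, neg_zero,
      Complex.add_re, Complex.add_im, Complex.mul_re, Complex.mul_im, Complex.I_re, Complex.I_im,
      mul_zero, mul_one, sub_zero, add_zero, zero_add, Complex.ofReal_zero, zero_mul, smul_eq_mul,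
      Complex.ofReal_neg] at hI
    have e1 : ‖∫ x in (-R)..R, D (x + R * Complex.I)‖ ≤ 2 * B / (R ^ 2 - δ ^ 2) * |R - -R| :=
      intervalIntegral.norm_integral_le_of_norm_le_const fun x _ => hbound R hR _
        (by simpa using hR0.le) (by
          refine le_trans (by simp [abs_of_pos hR0]) (Complex.abs_im_le_norm _))
    have e2 : ‖∫ y in (0 : ℝ)..R, D (R + y * Complex.I)‖ ≤ 2 * B / (R ^ 2 - δ ^ 2) * |R - 0| :=
      intervalIntegral.norm_integral_le_of_norm_le_const fun y hy => by
        rw [Set.uIoc_of_le hR0.le] at hy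
        exact hbound R hR _ (by simpa using hy.1.le)
          (le_trans (by simp [abs_of_pos hR0]) (Complex.abs_re_le_norm _))
    have e3 : ‖∫ y in (0 : ℝ)..R, D (-R + y * Complex.I)‖ ≤ 2 * B / (R ^ 2 - δ ^ 2) * |R - 0| :=
      intervalIntegral.norm_integral_le_of_norm_le_const fun y hy => by
        rw [Set.uIoc_of_le hR0.le] at hy
        exact hbound R hR _ (by simpa using hy.1.le)
          (le_trans (by simp [abs_of_pos hR0]) (Complex.abs_re_le_norm _))
    rw [show R - -R = 2 * R by ring, abs_of_pos (by linarith)] at e1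
    rw [sub_zero, abs_of_pos hR0] at e2 e3
    have e4 : ∫ x in (-R)..R, D (x : ℂ) = (∫ x in (-R)..R, D (x + R * Complex.I)) -
        Complex.I * (∫ y in (0 : ℝ)..R, D (R + y * Complex.I)) +
        Complex.I * ∫ y in (0 : ℝ)..R, D (-R + y * Complex.I) := by
      linear_combination hI
    rw [e4]
    refine (norm_add_le _ _).trans ((add_le_add (norm_sub_le _ _) le_rfl).trans ?_)
    rw [norm_mul, norm_mul, Complex.norm_I, one_mul, one_mul]
    linarith
  have hlim0 : Tendsto (fun R : ℝ => ∫ x in (-R)..R, D (x : ℂ)) atTop (𝓝 0) := by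
    refine squeeze_zero_norm' ((eventually_gt_atTop δ).mono fun R hR => hrect R hR) ?_
    have h1 : Tendsto (fun R : ℝ => 8 * B * (R⁻¹ * (1 - (δ * R⁻¹) ^ 2)⁻¹)) atTop (𝓝 0) := by
      have h2 := tendsto_inv_atTop_zero (𝕜 := ℝ)
      have h3 : Tendsto (fun R : ℝ => 1 - (δ * R⁻¹) ^ 2) atTop (𝓝 1) := by
        simpa using ((h2.const_mul δ).pow 2).const_sub 1
      simpa using (h2.mul (h3.inv₀ one_ne_zero)).const_mul (8 * B)
    refine h1.congr' ?_
    filter_upwards [eventually_gt_atTop δ] with R hR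
    have hR0 : 0 < R := hδ.trans hR
    have h4 : R ^ 2 - δ ^ 2 ≠ 0 := by nlinarith
    have h5 : 1 - (δ * R⁻¹) ^ 2 = (R ^ 2 - δ ^ 2) / R ^ 2 := by field_simp
    rw [h5, inv_div]
    field_simp
    ring
  have hlim1 := intervalIntegral_tendsto_integral hDi tendsto_neg_atTop_atBot tendsto_id
  have hD0 := tendsto_nhds_unique hlim1 hlim0
  simp_rw [hDr] at hD0
  have i1 : Integrable fun x : ℝ => ((δ / (x ^ 2 + δ ^ 2) : ℝ) : ℂ) * h x * (δ : ℂ)⁻¹ :=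
    hi1.mul_const _
  have i2 : Integrable fun x : ℝ => ((δ / (x ^ 2 + δ ^ 2) : ℝ) : ℂ) * (δ : ℂ)⁻¹ * h p :=
    ((hPi.ofReal (𝕜 := ℂ)).mul_const _).mul_const _
  rw [integral_sub i1 i2,
    integral_mul_const, integral_mul_const, integral_mul_const, integral_complex_ofReal,
    integral_poisson hδ, sub_eq_zero] at hD0
  have h2 : (δ : ℂ) ≠ 0 := by exact_mod_cast hδ.ne'
  field_simp at hD0
  linear_combination hD0

/-- A holomorphic function on the upper half-plane with nonnegative imaginary part, and total mass
`A`. -/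
structure IsHerglotz (g : ℂ → ℂ) (A : ℝ) : Prop where
  hol : DifferentiableOn ℂ g {z | 0 < z.im}
  nonneg : ∀ z : ℂ, 0 < z.im → 0 ≤ (g z).im
  bound : ∀ z : ℂ, 0 < z.im → ‖g z‖ * z.im ≤ A
  mass : Tendsto (fun y : ℝ => y * (g (y * Complex.I)).im) atTop (𝓝 A)

/-- The boundary values of a Herglotz function: atoms `c` on the negative half-line, and a
continuous density `ρ` on the positive half-line. -/
structure HasBoundaryValues (g : ℂ → ℂ) (c ρ : ℝ → ℝ) : Prop where
  nonneg : ∀ x, 0 ≤ c x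
  eq_zero : ∀ x, 0 ≤ x → c x = 0
  isolated : ∀ l < 0, ∀ᶠ x in 𝓝[≠] l, c x = 0
  left : ∀ l : ℝ, l < 0 →
    Tendsto (fun z : ℂ => (g z + c l / (z - l)).im) (𝓝[{z | 0 < z.im}] (l : ℂ)) (𝓝 0)
  continuousOn : ContinuousOn ρ (Set.Ici 0)
  right : ∀ l : ℝ, 0 ≤ l →
    Tendsto (fun z : ℂ => (g z).im) (𝓝[{z | 0 ≤ z.re ∧ 0 < z.im}] (l : ℂ)) (𝓝 (ρ l))

/-- Each boundary limit is taken through full neighbourhoods within `S`, hence controls nearby real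
points as well; compactness then makes the vertical approach uniform. -/
theorem eventually_forall_abs_sub_le {K : Set ℝ} (hK : IsCompact K) {S : Set ℂ} {H : ℂ → ℝ}
    {T : ℝ → ℝ} (hT : ContinuousOn T K) (hS : ∀ x ∈ K, ∀ ε : ℝ, 0 < ε → (x + ε * Complex.I : ℂ) ∈ S)
    (hH : ∀ x ∈ K, Tendsto H (𝓝[S] (x : ℂ)) (𝓝 (T x))) {η : ℝ} (hη : 0 < η) :
    ∀ᶠ ε : ℝ in 𝓝[>] (0 : ℝ), ∀ x ∈ K, |H (x + ε * Complex.I) - T x| ≤ η := by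
  have key : ∀ᶠ ε : ℝ in 𝓝 (0 : ℝ), ∀ x ∈ K, (0 < ε → x ∈ K → |H (x + ε * Complex.I) - T x| ≤ η) := by
    refine hK.eventually_forall_of_forall_eventually (fun y hy => ?_)
    have h1 := (hH y hy).eventually (Metric.ball_mem_nhds _ (half_pos hη))
    have h2 := (hT y hy).eventually (Metric.ball_mem_nhds _ (half_pos hη))
    rw [eventually_nhdsWithin_iff] at h1 h2
    have h3 : Tendsto (fun z : ℝ × ℝ => (z.2 + z.1 * Complex.I : ℂ)) (𝓝 ((0 : ℝ), y)) (𝓝 (y : ℂ)) := by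
      have : Continuous fun z : ℝ × ℝ => (z.2 + z.1 * Complex.I : ℂ) := by fun_prop
      simpa using this.tendsto ((0 : ℝ), y)
    have h4 : Tendsto (fun z : ℝ × ℝ => z.2) (𝓝 ((0 : ℝ), y)) (𝓝 y) := continuous_snd.tendsto _
    filter_upwards [h3.eventually h1, h4.eventually h2] with z hz1 hz2 hz hzK
    have e1 := hz1 (hS _ hzK _ hz)
    have e2 := hz2 hzK
    rw [Real.dist_eq, abs_lt] at e1 e2
    rw [abs_le]
    constructor <;> linarith [e1.1, e1.2, e2.1, e2.2]
  filter_upwards [key.filter_mono nhdsWithin_le_nhds, self_mem_nhdsWithin] with ε h1 h2 x hx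
  exact h1 x hx h2 hx

theorem integral_shifted_poisson (a b l : ℝ) {ε : ℝ} (hε : 0 < ε) :
    ∫ x in a..b, ε / ((x - l) ^ 2 + ε ^ 2) =
      Real.arctan ((b - l) / ε) - Real.arctan ((a - l) / ε) := by
  have h := intervalIntegral.integral_comp_div_sub (fun x : ℝ => (1 + x ^ 2)⁻¹) (a := a) (b := b)
    hε.ne' (l / ε)
  rw [integral_inv_one_add_sq, smul_eq_mul, ← sub_div, ← sub_div] at h
  have h2 : ∀ x : ℝ, ε / ((x - l) ^ 2 + ε ^ 2) = ε⁻¹ * (1 + (x / ε - l / ε) ^ 2)⁻¹ := by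
    intro x
    rw [← sub_div]
    field_simp
    ring
  simp_rw [h2]
  rw [intervalIntegral.integral_const_mul, h, inv_mul_cancel_left₀ hε.ne']

/-! ### Mass estimates for Herglotz functions -/

namespace IsHerglotz

variable {g : ℂ → ℂ} {A : ℝ}

theorem nonneg_shift (hg : IsHerglotz g A) {ε : ℝ} (hε : 0 < ε) (x : ℝ) :
    0 ≤ (g (x + ε * Complex.I)).im := hg.nonneg _ (by simpa using hε)

theorem continuous_shift (hg : IsHerglotz g A) {ε : ℝ} (hε : 0 < ε) :
    Continuous fun x : ℝ => (g (x + ε * Complex.I)).im := by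
  refine Complex.continuous_im.comp (continuous_iff_continuousAt.2 fun x => ?_)
  have h1 : ContinuousAt g (x + ε * Complex.I : ℂ) :=
    (hg.hol.differentiableAt ((isOpen_lt continuous_const Complex.continuous_im).mem_nhds
      (by simpa using hε))).continuousAt
  exact ContinuousAt.comp (f := fun x : ℝ => (x + ε * Complex.I : ℂ)) h1
    (Continuous.continuousAt (by fun_prop))

theorem mul_im_le (hg : IsHerglotz g A) {z : ℂ} (hz : 0 < z.im) : (g z).im * z.im ≤ A :=
  (mul_le_mul_of_nonneg_right (Complex.im_le_norm _) hz.le).trans (hg.bound z hz)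

theorem poisson (hg : IsHerglotz g A) {ε δ : ℝ} (hε : 0 < ε) (hδ : 0 < δ) :
    Integrable (fun x : ℝ => δ / (x ^ 2 + δ ^ 2) * (g (x + ε * Complex.I)).im) ∧
      ∫ x : ℝ, δ / (x ^ 2 + δ ^ 2) * (g (x + ε * Complex.I)).im =
        Real.pi * (g ((δ + ε : ℝ) * Complex.I)).im := by
  obtain ⟨h1, h2⟩ := poisson_formula (h := fun z => g (z + ε * Complex.I)) (B := A / ε) hε
    (by
      refine hg.hol.comp (by fun_prop) fun z hz => ?_
      have hz' : -ε < z.im := hz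
      show 0 < (z + ε * Complex.I).im
      simp
      linarith)
    (by
      intro z hz
      rw [le_div_iff₀ hε]
      have him : (z + ε * Complex.I).im = z.im + ε := by simp
      have := hg.bound (z + ε * Complex.I) (by rw [him]; linarith)
      rw [him] at this
      nlinarith [norm_nonneg (g (z + ε * Complex.I))]) hδ
  have h3 : ∀ x : ℝ, ((((δ / (x ^ 2 + δ ^ 2) : ℝ) : ℂ)) * g (x + ε * Complex.I)).im =
      δ / (x ^ 2 + δ ^ 2) * (g (x + ε * Complex.I)).im := fun x => Complex.im_ofReal_mul _ _
  refine ⟨h1.im.congr (Eventually.of_forall h3), ?_⟩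
  have h4 := congrArg Complex.im h2
  rw [Complex.im_ofReal_mul] at h4
  have h5 := integral_im h1
  simp only [RCLike.im_to_complex] at h5
  rw [← h5] at h4
  simp_rw [h3] at h4
  rw [h4, ← add_mul]
  push_cast
  rfl

/-- The weight is K times the Poisson kernel: it tends to 1 as K → ∞, is at least 1/2 for |x| ≤ K
and at most 1/2 outside. Comparison with these values gives all the mass estimates below. -/
theorem integral_weight (hg : IsHerglotz g A) {ε K : ℝ} (hε : 0 < ε) (hK : 0 < K) :
    Integrable (fun x : ℝ => K ^ 2 / (x ^ 2 + K ^ 2) * (g (x + ε * Complex.I)).im) ∧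
      ∫ x : ℝ, K ^ 2 / (x ^ 2 + K ^ 2) * (g (x + ε * Complex.I)).im =
        Real.pi * (K * (g ((K + ε : ℝ) * Complex.I)).im) := by
  obtain ⟨h1, h2⟩ := hg.poisson hε hK
  have h3 : ∀ x : ℝ, K ^ 2 / (x ^ 2 + K ^ 2) * (g (x + ε * Complex.I)).im =
      K * (K / (x ^ 2 + K ^ 2) * (g (x + ε * Complex.I)).im) := fun x => by ring
  simp_rw [h3]
  refine ⟨h1.const_mul K, ?_⟩
  rw [integral_const_mul, h2]
  ring

theorem mul_im_axis_le (hg : IsHerglotz g A) {ε K : ℝ} (hε : 0 < ε) (hK : 0 < K) :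
    K * (g ((K + ε : ℝ) * Complex.I)).im ≤ A := by
  have him : (((K + ε : ℝ) : ℂ) * Complex.I).im = K + ε := by simp
  have h := hg.mul_im_le (z := ((K + ε : ℝ) : ℂ) * Complex.I) (by rw [him]; positivity)
  have h0 := hg.nonneg (((K + ε : ℝ) : ℂ) * Complex.I) (by rw [him]; positivity)
  rw [him] at h
  nlinarith

/-- On [-K, K] the weight is at least 1/2, so the integral there is at most twice the weighted one,
which is bounded by πA independently of K. -/
theorem integrable_shift (hg : IsHerglotz g A) {ε : ℝ} (hε : 0 < ε) :
    Integrable fun x : ℝ => (g (x + ε * Complex.I)).im := by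
  refine integrable_of_intervalIntegral_norm_bounded (l := atTop) (a := fun K : ℝ => -K) (b := id)
    (2 * (Real.pi * A)) (fun K => ((hg.continuous_shift hε).integrableOn_Icc).mono_set
      Set.Ioc_subset_Icc_self) tendsto_neg_atTop_atBot tendsto_id ?_
  filter_upwards [eventually_gt_atTop (0 : ℝ)] with K hK
  obtain ⟨h1, h2⟩ := hg.integral_weight hε hK
  rw [intervalIntegral.integral_of_le (by simp only [id]; linarith)]
  have h3 : ∫ x in Set.Ioc (-K) (id K), ‖(g (x + ε * Complex.I)).im‖ ≤
      ∫ x in Set.Ioc (-K) (id K), 2 * (K ^ 2 / (x ^ 2 + K ^ 2) * (g (x + ε * Complex.I)).im) := by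
    refine setIntegral_mono_on ?_ (h1.const_mul 2).integrableOn measurableSet_Ioc fun x hx => ?_
    · exact ((hg.continuous_shift hε).norm.integrableOn_Icc).mono_set Set.Ioc_subset_Icc_self
    · have h0 := hg.nonneg_shift hε x
      rw [Real.norm_of_nonneg h0, ← mul_assoc]
      refine le_mul_of_one_le_left h0 ?_
      have hx2 : x ^ 2 ≤ K ^ 2 := sq_le_sq' hx.1.le hx.2
      rw [mul_div, le_div_iff₀ (by positivity)]
      linarith
  refine h3.trans ((setIntegral_le_integral (h1.const_mul 2)
    (Eventually.of_forall fun x => ?_)).trans ?_)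
  · have h0 := hg.nonneg_shift hε x
    simp only [Pi.zero_apply]
    positivity
  · rw [integral_const_mul, h2]
    exact mul_le_mul_of_nonneg_left (mul_le_mul_of_nonneg_left (hg.mul_im_axis_le hε hK)
      Real.pi_pos.le) (by norm_num)

/-- Let K → ∞ in `integral_weight`: dominated convergence on one side, the growth on the imaginary
axis on the other. -/
theorem integral_shift (hg : IsHerglotz g A) {ε : ℝ} (hε : 0 < ε) :
    ∫ x : ℝ, (g (x + ε * Complex.I)).im = Real.pi * A := by
  have h1 : Tendsto (fun K : ℝ => ∫ x : ℝ, K ^ 2 / (x ^ 2 + K ^ 2) * (g (x + ε * Complex.I)).im) atTop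
      (𝓝 (∫ x : ℝ, (g (x + ε * Complex.I)).im)) := by
    refine tendsto_integral_filter_of_dominated_convergence
      (fun x : ℝ => (g (x + ε * Complex.I)).im) ?_ ?_ (hg.integrable_shift hε) ?_
    · filter_upwards [eventually_gt_atTop (0 : ℝ)] with K hK
      exact (hg.integral_weight hε hK).1.aestronglyMeasurable
    · filter_upwards [eventually_gt_atTop (0 : ℝ)] with K hK
      refine Eventually.of_forall fun x => ?_
      have h0 := hg.nonneg_shift hε x
      rw [Real.norm_of_nonneg (by positivity)]
      refine mul_le_of_le_one_left h0 (div_le_one_of_le₀ ?_ (by positivity))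
      linarith [sq_nonneg x]
    · refine Eventually.of_forall fun x => ?_
      have h2 : Tendsto (fun K : ℝ => (1 + (x * K⁻¹) ^ 2)⁻¹) atTop (𝓝 1) := by
        have h3 := ((tendsto_inv_atTop_zero (𝕜 := ℝ)).const_mul x).pow 2
        have h4 : Tendsto (fun K : ℝ => 1 + (x * K⁻¹) ^ 2) atTop (𝓝 1) := by
          simpa using h3.const_add 1
        simpa using h4.inv₀ one_ne_zero
      have h5 := h2.mul_const (g (x + ε * Complex.I)).im
      rw [one_mul] at h5
      refine h5.congr' ?_
      filter_upwards [eventually_gt_atTop (0 : ℝ)] with K hK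
      congr 1
      field_simp
      ring
  have h2 : Tendsto (fun K : ℝ => Real.pi * (K * (g ((K + ε : ℝ) * Complex.I)).im)) atTop
      (𝓝 (Real.pi * A)) := by
    have h3 : Tendsto (fun K : ℝ => K + ε) atTop atTop := tendsto_atTop_add_const_right _ _ tendsto_id
    have h4 : Tendsto (fun K : ℝ => 1 - ε * (K + ε)⁻¹) atTop (𝓝 1) := by
      simpa using (h3.inv_tendsto_atTop.const_mul ε).const_sub 1
    have h5 := (h4.mul (hg.mass.comp h3)).const_mul Real.pi
    rw [one_mul] at h5
    refine h5.congr' ?_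
    filter_upwards [eventually_gt_atTop (0 : ℝ)] with K hK
    simp only [Function.comp]
    have : K + ε ≠ 0 := by positivity
    field_simp
    ring
  refine tendsto_nhds_unique h1 (h2.congr' ?_)
  filter_upwards [eventually_gt_atTop (0 : ℝ)] with K hK
  exact (hg.integral_weight hε hK).2.symm

theorem integral_le (hg : IsHerglotz g A) {ε a b : ℝ} (hε : 0 < ε) (hab : a ≤ b) :
    ∫ x in a..b, (g (x + ε * Complex.I)).im ≤ Real.pi * A := by
  rw [intervalIntegral.integral_of_le hab, ← hg.integral_shift hε]
  exact setIntegral_le_integral (hg.integrable_shift hε)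
    (Eventually.of_forall fun x => hg.nonneg_shift hε x)

/-- The mass near infinity is controlled by the growth on the imaginary axis. -/
theorem le_integral_add (hg : IsHerglotz g A) {ε Λ : ℝ} (hε : 0 < ε) (hΛ : 0 < Λ) :
    Real.pi * A ≤ (∫ x in (-Λ)..Λ, (g (x + ε * Complex.I)).im) +
      2 * Real.pi * (A - Λ * (g ((Λ + ε : ℝ) * Complex.I)).im) := by
  obtain ⟨h1, h2⟩ := hg.integral_weight hε hΛ
  have hi := hg.integrable_shift hε
  rw [intervalIntegral.integral_of_le (by linarith)]
  have e1 : ∫ x in (Set.Ioc (-Λ) Λ)ᶜ, (g (x + ε * Complex.I)).im ≤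
      ∫ x in (Set.Ioc (-Λ) Λ)ᶜ, 2 * ((g (x + ε * Complex.I)).im -
        Λ ^ 2 / (x ^ 2 + Λ ^ 2) * (g (x + ε * Complex.I)).im) := by
    refine setIntegral_mono_on hi.integrableOn ((hi.sub h1).const_mul 2).integrableOn
      measurableSet_Ioc.compl fun x hx => ?_
    have h0 := hg.nonneg_shift hε x
    have hx2 : Λ ^ 2 ≤ x ^ 2 := by
      by_contra! hlt
      have := abs_lt_of_sq_lt_sq hlt hΛ.le
      rw [abs_lt] at this
      exact hx ⟨this.1, this.2.le⟩
    -- Outside [-Λ, Λ] this gives 1 ≤ 2 (1 - weight), and the total integral of Im g times 1 -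
    -- weight is known exactly.
    have h3 : Λ ^ 2 / (x ^ 2 + Λ ^ 2) ≤ 1 / 2 := by
      rw [div_le_div_iff₀ (by positivity) (by norm_num)]
      linarith
    nlinarith
  have e2 : ∫ x in (Set.Ioc (-Λ) Λ)ᶜ, 2 * ((g (x + ε * Complex.I)).im -
        Λ ^ 2 / (x ^ 2 + Λ ^ 2) * (g (x + ε * Complex.I)).im) ≤
      ∫ x : ℝ, 2 * ((g (x + ε * Complex.I)).im -
        Λ ^ 2 / (x ^ 2 + Λ ^ 2) * (g (x + ε * Complex.I)).im) := by
    refine setIntegral_le_integral ((hi.sub h1).const_mul 2) (Eventually.of_forall fun x => ?_)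
    have h0 := hg.nonneg_shift hε x
    have h3 : Λ ^ 2 / (x ^ 2 + Λ ^ 2) ≤ 1 :=
      div_le_one_of_le₀ (by linarith [sq_nonneg x]) (by positivity)
    simp only [Pi.zero_apply]
    nlinarith
  have e4 : ∫ x : ℝ, 2 * ((g (x + ε * Complex.I)).im -
      Λ ^ 2 / (x ^ 2 + Λ ^ 2) * (g (x + ε * Complex.I)).im) =
      2 * (Real.pi * A - Real.pi * (Λ * (g ((Λ + ε : ℝ) * Complex.I)).im)) := by
    rw [integral_const_mul, integral_sub hi h1, h2, hg.integral_shift hε]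
  have e3 := integral_add_compl (measurableSet_Ioc (a := -Λ) (b := Λ)) hi
  rw [hg.integral_shift hε] at e3
  linarith

/-- The mass near a point of the real axis is controlled by the growth above it. -/
theorem integral_near_zero_le (hg : IsHerglotz g A) {ε δ : ℝ} (hε : 0 < ε) (hδ : 0 < δ) :
    ∫ x in (-δ)..0, (g (x + ε * Complex.I)).im ≤
      2 * Real.pi * (δ * (g ((δ + ε : ℝ) * Complex.I)).im) := by
  obtain ⟨h1, h2⟩ := hg.integral_weight hε hδ
  rw [intervalIntegral.integral_of_le (by linarith)]
  have h3 : ∫ x in Set.Ioc (-δ) 0, (g (x + ε * Complex.I)).im ≤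
      ∫ x in Set.Ioc (-δ) 0, 2 * (δ ^ 2 / (x ^ 2 + δ ^ 2) * (g (x + ε * Complex.I)).im) := by
    refine setIntegral_mono_on (hg.integrable_shift hε).integrableOn (h1.const_mul 2).integrableOn
      measurableSet_Ioc fun x hx => ?_
    have h0 := hg.nonneg_shift hε x
    rw [← mul_assoc]
    refine le_mul_of_one_le_left h0 ?_
    have hx2 : x ^ 2 ≤ δ ^ 2 := sq_le_sq' hx.1.le (hx.2.trans hδ.le)
    rw [mul_div, le_div_iff₀ (by positivity)]
    linarith
  refine h3.trans ((setIntegral_le_integral (h1.const_mul 2)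
    (Eventually.of_forall fun x => ?_)).trans ?_)
  · have h0 := hg.nonneg_shift hε x
    simp only [Pi.zero_apply]
    positivity
  · rw [integral_const_mul, h2]
    exact le_of_eq (by ring)

end IsHerglotz

theorem im_atom (c x j ε : ℝ) :
    ((c : ℂ) / (x + ε * Complex.I - j)).im = -(c * (ε / ((x - j) ^ 2 + ε ^ 2))) := by
  have h : (x + ε * Complex.I - j : ℂ) = ((x - j : ℝ) : ℂ) + (ε : ℝ) * Complex.I := by
    push_cast
    ring
  rw [h, div_eq_mul_inv, Complex.im_ofReal_mul, Complex.inv_im, Complex.normSq_add_mul_I]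
  simp
  ring

theorem finite_of_isolated {P : ℝ → Prop} {p q : ℝ}
    (h : ∀ l ∈ Set.Icc p q, ∀ᶠ x in 𝓝[≠] l, ¬ P x) : {x | x ∈ Set.Icc p q ∧ P x}.Finite := by
  have h1 : ∀ l ∈ Set.Icc p q, {x | P x → x = l} ∈ 𝓝 l := by
    intro l hl
    filter_upwards [eventually_nhdsWithin_iff.1 (h l hl)] with x hx hcx
    by_contra hne
    exact hx hne hcx
  obtain ⟨t, ht, hcov⟩ := isCompact_Icc.elim_nhds_subcover _ h1
  refine t.finite_toSet.subset fun x hx => ?_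
  obtain ⟨l, hl, hxl⟩ := Set.mem_iUnion₂.1 (hcov hx.1)
  have : x = l := hxl hx.2
  exact this ▸ hl

/-! ### Recovering the total mass from the boundary values -/

namespace HasBoundaryValues

variable {g : ℂ → ℂ} {A : ℝ} {c ρ : ℝ → ℝ}

theorem finite_atoms (hb : HasBoundaryValues g c ρ) {p q : ℝ} (hq : q < 0) :
    {x | x ∈ Set.Icc p q ∧ c x ≠ 0}.Finite :=
  finite_of_isolated fun l hl => (hb.isolated l (hl.2.trans_lt hq)).mono fun _ h => not_not.2 h

/-- A compact interval of the negative axis carries finitely many atoms. Once their poles are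
subtracted, the imaginary part tends to 0 at every point, hence uniformly along horizontal lines. -/
theorem eventually_left (hb : HasBoundaryValues g c ρ) {p q : ℝ} (hq : q < 0) {η : ℝ} (hη : 0 < η) :
    ∀ᶠ ε : ℝ in 𝓝[>] (0 : ℝ), ∀ x ∈ Set.Icc p q, |(g (x + ε * Complex.I)).im -
      ∑ j ∈ (hb.finite_atoms (p := p) hq).toFinset, c j * (ε / ((x - j) ^ 2 + ε ^ 2))| ≤ η := by
  set J := (hb.finite_atoms (p := p) hq).toFinset with hJ
  have h1 := eventually_forall_abs_sub_le (K := Set.Icc p q) isCompact_Icc (S := {z | 0 < z.im})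
    (H := fun z => (g z + ∑ j ∈ J, (c j : ℂ) / (z - j)).im) (T := fun _ => 0) continuousOn_const
    (fun x _ ε hε => by simpa using hε) (fun x hx => ?_) hη
  · filter_upwards [h1] with ε hε x hx
    have h2 := hε x hx
    rw [Complex.add_im, Complex.im_sum, sub_zero] at h2
    simp_rw [im_atom] at h2
    rwa [Finset.sum_neg_distrib, ← sub_eq_add_neg] at h2
  · have hx0 : x < 0 := hx.2.trans_lt hq
    -- Near x only the pole at x is singular; the others are continuous and real there.
    have h2 : ∀ z : ℂ, g z + ∑ j ∈ J, (c j : ℂ) / (z - j) =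
        (g z + (c x : ℂ) / (z - x)) + ∑ j ∈ J.erase x, (c j : ℂ) / (z - j) := by
      intro z
      by_cases hxJ : x ∈ J
      · rw [← Finset.add_sum_erase J _ hxJ, add_assoc]
      · have : c x = 0 := by
          by_contra hne
          exact hxJ (by simpa [hJ] using ⟨hx, hne⟩)
        rw [Finset.erase_eq_of_notMem hxJ, this]
        simp
    have h3 : Tendsto (fun z : ℂ => ∑ j ∈ J.erase x, (c j : ℂ) / (z - j)) (𝓝[{z | 0 < z.im}] (x : ℂ))
        (𝓝 (∑ j ∈ J.erase x, (c j : ℂ) / (x - j))) := by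
      refine tendsto_finsetSum _ fun j hj => tendsto_const_nhds.div
        ((continuous_id.sub continuous_const).continuousWithinAt) ?_
      rw [Finset.mem_erase] at hj
      rw [sub_ne_zero]
      exact_mod_cast fun h : x = j => hj.1 h.symm
    have h4 : (∑ j ∈ J.erase x, (c j : ℂ) / (x - j)).im = 0 := by
      rw [Complex.im_sum]
      refine Finset.sum_eq_zero fun j _ => ?_
      rw [← Complex.ofReal_sub, ← Complex.ofReal_div, Complex.ofReal_im]
    have h5 := (hb.left x hx0).add ((Complex.continuous_im.tendsto _).comp h3)
    rw [h4, add_zero] at h5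
    refine h5.congr fun z => ?_
    simp only [h2, Complex.add_im, Function.comp]

/-- Each atom contributes its mass times the integral of a Poisson kernel over an interval, which is
at most π. -/
theorem eventually_integral_left_le (hb : HasBoundaryValues g c ρ) (hg : IsHerglotz g A)
    (hc : Summable c) {p q : ℝ} (hpq : p ≤ q) (hq : q < 0) {η : ℝ} (hη : 0 < η) :
    ∀ᶠ ε : ℝ in 𝓝[>] (0 : ℝ), ∫ x in p..q, (g (x + ε * Complex.I)).im ≤
      Real.pi * (∑' x, c x) + η * (q - p) := by
  filter_upwards [hb.eventually_left (p := p) hq hη, self_mem_nhdsWithin] with ε hε hε0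
  have hε0 : 0 < ε := hε0
  set J := (hb.finite_atoms (p := p) hq).toFinset
  have hcj : ∀ j : ℝ, Continuous fun x : ℝ => c j * (ε / ((x - j) ^ 2 + ε ^ 2)) := fun j =>
    continuous_const.mul (continuous_const.div (by fun_prop) fun x => by positivity)
  have h1 : ∫ x in p..q, (g (x + ε * Complex.I)).im ≤
      ∫ x in p..q, ((∑ j ∈ J, c j * (ε / ((x - j) ^ 2 + ε ^ 2))) + η) := by
    refine intervalIntegral.integral_mono_on hpq ((hg.continuous_shift hε0).intervalIntegrable _ _) ?_
      fun x hx => ?_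
    · exact ((continuous_finsetSum _ fun j _ => hcj j).add continuous_const).intervalIntegrable _ _
    · linarith [(abs_le.1 (hε x hx)).2]
  refine h1.trans ?_
  rw [intervalIntegral.integral_add
    ((continuous_finsetSum _ fun j _ => hcj j).intervalIntegrable _ _) (by simp),
    intervalIntegral.integral_const, smul_eq_mul, mul_comm η,
    intervalIntegral.integral_finsetSum fun j _ => (hcj j).intervalIntegrable _ _]
  refine add_le_add ?_ le_rfl
  have h2 : ∑ j ∈ J, ∫ x in p..q, c j * (ε / ((x - j) ^ 2 + ε ^ 2)) ≤ ∑ j ∈ J, Real.pi * c j := by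
    refine Finset.sum_le_sum fun j _ => ?_
    rw [intervalIntegral.integral_const_mul, integral_shifted_poisson _ _ _ hε0, mul_comm]
    refine mul_le_mul_of_nonneg_right ?_ (hb.nonneg j)
    linarith [Real.arctan_lt_pi_div_two ((q - j) / ε), Real.neg_pi_div_two_lt_arctan ((p - j) / ε)]
  refine h2.trans ?_
  rw [← Finset.mul_sum]
  exact mul_le_mul_of_nonneg_left (hc.sum_le_tsum J fun j _ => hb.nonneg j) Real.pi_pos.le

/-- The atoms outside `J'` are dropped by positivity; the arctangents stay explicit so that ε → 0
can be taken afterwards. -/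
theorem eventually_le_integral_left (hb : HasBoundaryValues g c ρ) (hg : IsHerglotz g A)
    {p q : ℝ} (hpq : p ≤ q) (hq : q < 0) (J' : Finset ℝ) (hJ' : ∀ j ∈ J', p < j ∧ j < q)
    {η : ℝ} (hη : 0 < η) :
    ∀ᶠ ε : ℝ in 𝓝[>] (0 : ℝ), (∑ j ∈ J', c j * (Real.arctan ((q - j) / ε) -
      Real.arctan ((p - j) / ε))) - η * (q - p) ≤ ∫ x in p..q, (g (x + ε * Complex.I)).im := by
  filter_upwards [hb.eventually_left (p := p) hq hη, self_mem_nhdsWithin] with ε hε hε0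
  have hε0 : 0 < ε := hε0
  set J := (hb.finite_atoms (p := p) hq).toFinset with hJ
  have hcj : ∀ j : ℝ, Continuous fun x : ℝ => c j * (ε / ((x - j) ^ 2 + ε ^ 2)) := fun j =>
    continuous_const.mul (continuous_const.div (by fun_prop) fun x => by positivity)
  have h1 : ∫ x in p..q, ((∑ j ∈ J, c j * (ε / ((x - j) ^ 2 + ε ^ 2))) - η) ≤
      ∫ x in p..q, (g (x + ε * Complex.I)).im := by
    refine intervalIntegral.integral_mono_on hpq ?_ ((hg.continuous_shift hε0).intervalIntegrable _ _)
      fun x hx => ?_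
    · exact ((continuous_finsetSum _ fun j _ => hcj j).sub continuous_const).intervalIntegrable _ _
    · linarith [(abs_le.1 (hε x hx)).1]
  refine le_trans ?_ h1
  rw [intervalIntegral.integral_sub
    ((continuous_finsetSum _ fun j _ => hcj j).intervalIntegrable _ _) (by simp),
    intervalIntegral.integral_const, smul_eq_mul, mul_comm η,
    intervalIntegral.integral_finsetSum fun j _ => (hcj j).intervalIntegrable _ _]
  refine sub_le_sub_right ?_ _
  simp_rw [intervalIntegral.integral_const_mul, integral_shifted_poisson _ _ _ hε0]
  rw [← Finset.sum_filter_add_sum_filter_not J' (fun j => c j ≠ 0)]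
  have h0 : ∑ j ∈ J' with ¬ c j ≠ 0, c j * (Real.arctan ((q - j) / ε) -
      Real.arctan ((p - j) / ε)) = 0 :=
    Finset.sum_eq_zero fun j hj => by
      rw [not_not.1 (Finset.mem_filter.1 hj).2, zero_mul]
  rw [h0, add_zero]
  refine Finset.sum_le_sum_of_subset_of_nonneg (fun j hj => ?_) fun j _ _ => ?_
  · rw [Finset.mem_filter] at hj
    have := hJ' j hj.1
    simpa [hJ] using ⟨⟨this.1.le, this.2.le⟩, hj.2⟩
  · refine mul_nonneg (hb.nonneg j) (sub_nonneg.2 (Real.arctan_mono ?_))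
    gcongr

theorem eventually_abs_integral_right (hb : HasBoundaryValues g c ρ) (hg : IsHerglotz g A)
    {Λ : ℝ} (hΛ : 0 ≤ Λ) {η : ℝ} (hη : 0 < η) :
    ∀ᶠ ε : ℝ in 𝓝[>] (0 : ℝ), |(∫ x in (0 : ℝ)..Λ, (g (x + ε * Complex.I)).im) -
      ∫ x in (0 : ℝ)..Λ, ρ x| ≤ η * Λ := by
  have hρ : ContinuousOn ρ (Set.Icc 0 Λ) := hb.continuousOn.mono Set.Icc_subset_Ici_self
  have h1 := eventually_forall_abs_sub_le (K := Set.Icc 0 Λ) isCompact_Icc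
    (S := {z | 0 ≤ z.re ∧ 0 < z.im}) (H := fun z => (g z).im) (T := ρ) hρ
    (fun x hx ε hε => by simpa using ⟨hx.1, hε⟩) (fun x hx => hb.right x hx.1) hη
  filter_upwards [h1, self_mem_nhdsWithin] with ε hε hε0
  have hε0 : 0 < ε := hε0
  rw [← intervalIntegral.integral_sub ((hg.continuous_shift hε0).intervalIntegrable _ _)
    (hρ.intervalIntegrable_of_Icc hΛ), ← Real.norm_eq_abs]
  refine (intervalIntegral.norm_integral_le_of_norm_le_const fun x hx => ?_).trans
    (le_of_eq (by rw [sub_zero, abs_of_nonneg hΛ]))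
  rw [Set.uIoc_of_le hΛ] at hx
  exact hε x ⟨hx.1.le, hx.2⟩

theorem density_nonneg (hb : HasBoundaryValues g c ρ) (hg : IsHerglotz g A) {l : ℝ} (hl : 0 ≤ l) :
    0 ≤ ρ l := by
  have h1 : Tendsto (fun ε : ℝ => (l + ε * Complex.I : ℂ)) (𝓝[>] 0)
      (𝓝[{z | 0 ≤ z.re ∧ 0 < z.im}] (l : ℂ)) := by
    refine tendsto_nhdsWithin_iff.2 ⟨?_, ?_⟩
    · have : Continuous fun ε : ℝ => (l + ε * Complex.I : ℂ) := by fun_prop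
      have := this.tendsto 0
      simp only [Complex.ofReal_zero, zero_mul, add_zero] at this
      exact this.mono_left nhdsWithin_le_nhds
    · filter_upwards [self_mem_nhdsWithin] with ε hε
      simpa using ⟨hl, hε⟩
  refine ge_of_tendsto ((hb.right l hl).comp h1) ?_
  filter_upwards [self_mem_nhdsWithin] with ε hε
  exact hg.nonneg_shift hε l

theorem tendsto_density_zero (hb : HasBoundaryValues g c ρ) :
    Tendsto (fun δ : ℝ => (g (δ * Complex.I)).im) (𝓝[>] 0) (𝓝 (ρ 0)) := by
  have h1 : Tendsto (fun ε : ℝ => (ε * Complex.I : ℂ)) (𝓝[>] 0)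
      (𝓝[{z | 0 ≤ z.re ∧ 0 < z.im}] ((0 : ℝ) : ℂ)) := by
    refine tendsto_nhdsWithin_iff.2 ⟨?_, ?_⟩
    · have : Continuous fun ε : ℝ => (ε * Complex.I : ℂ) := by fun_prop
      have := this.tendsto 0
      simp only [Complex.ofReal_zero, zero_mul] at this
      exact this.mono_left nhdsWithin_le_nhds
    · filter_upwards [self_mem_nhdsWithin] with ε hε
      simpa using hε
  exact (hb.right 0 le_rfl).comp h1

/-- The integral along Im z = ε over an interval containing `J` and [0, Λ] is at most πA. As ε → 0,
each atom strictly inside the interval contributes π times its mass. -/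
theorem sum_add_integral_le (hb : HasBoundaryValues g c ρ) (hg : IsHerglotz g A) (J : Finset ℝ)
    (hJ : ∀ j ∈ J, j < 0) {Λ : ℝ} (hΛ : 0 ≤ Λ) :
    Real.pi * (∑ j ∈ J, c j) + ∫ x in (0 : ℝ)..Λ, ρ x ≤ Real.pi * A := by
  obtain ⟨q, hqJ, hq⟩ : ∃ q : ℝ, (∀ j ∈ J, j < q) ∧ q < 0 := by
    have h1 : ∀ᶠ q in 𝓝[<] (0 : ℝ), ∀ j ∈ J, j < q := (J.eventually_all).2 fun j hj =>
      (lt_mem_nhds (hJ j hj)).filter_mono nhdsWithin_le_nhds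
    exact (h1.and self_mem_nhdsWithin).exists
  obtain ⟨p, hpJ, hp⟩ : ∃ p : ℝ, (∀ j ∈ J, p < j) ∧ p ≤ q := by
    have h1 : ∀ᶠ p in (atBot : Filter ℝ), ∀ j ∈ J, p < j := (J.eventually_all).2 fun j _ =>
      eventually_lt_atBot j
    exact (h1.and (eventually_le_atBot q)).exists
  have key : ∀ η : ℝ, 0 < η → Real.pi * (∑ j ∈ J, c j) - η * (q - p) + ((∫ x in (0 : ℝ)..Λ, ρ x) - η * Λ) ≤
      Real.pi * A := by
    intro η hη
    have hlim : Tendsto (fun ε : ℝ => (∑ j ∈ J, c j * (Real.arctan ((q - j) / ε) -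
        Real.arctan ((p - j) / ε))) - η * (q - p) + ((∫ x in (0 : ℝ)..Λ, ρ x) - η * Λ)) (𝓝[>] 0)
        (𝓝 (Real.pi * (∑ j ∈ J, c j) - η * (q - p) + ((∫ x in (0 : ℝ)..Λ, ρ x) - η * Λ))) := by
      refine (Tendsto.sub_const ?_ _).add_const _
      rw [Finset.mul_sum]
      refine tendsto_finsetSum _ fun j hj => ?_
      have hinv := tendsto_inv_nhdsGT_zero (𝕜 := ℝ)
      have h1 : Tendsto (fun ε : ℝ => Real.arctan ((q - j) / ε)) (𝓝[>] 0) (𝓝 (Real.pi / 2)) :=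
        (tendsto_nhds_of_tendsto_nhdsWithin Real.tendsto_arctan_atTop).comp
          (hinv.const_mul_atTop (sub_pos.2 (hqJ j hj)))
      have h2 : Tendsto (fun ε : ℝ => Real.arctan ((p - j) / ε)) (𝓝[>] 0) (𝓝 (-(Real.pi / 2))) :=
        (tendsto_nhds_of_tendsto_nhdsWithin Real.tendsto_arctan_atBot).comp
          (hinv.const_mul_atTop_of_neg (sub_neg.2 (hpJ j hj)))
      have h3 := (h1.sub h2).const_mul (c j)
      rwa [show c j * (Real.pi / 2 - -(Real.pi / 2)) = Real.pi * c j by ring] at h3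
    refine le_of_tendsto hlim ?_
    filter_upwards [hb.eventually_le_integral_left hg hp hq J (fun j hj => ⟨hpJ j hj, hqJ j hj⟩) hη,
      hb.eventually_abs_integral_right hg hΛ hη, self_mem_nhdsWithin] with ε h1 h2 hε0
    have hε0 : 0 < ε := hε0
    have hi : ∀ a b : ℝ, IntervalIntegrable (fun x : ℝ => (g (x + ε * Complex.I)).im) volume a b :=
      fun a b => (hg.continuous_shift hε0).intervalIntegrable _ _
    have h3 := hg.integral_le hε0 (hp.trans (hq.le.trans hΛ))
    rw [← intervalIntegral.integral_add_adjacent_intervals (hi p q) (hi q Λ),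
      ← intervalIntegral.integral_add_adjacent_intervals (hi q 0) (hi 0 Λ)] at h3
    have h4 : 0 ≤ ∫ x in q..0, (g (x + ε * Complex.I)).im :=
      intervalIntegral.integral_nonneg hq.le fun x _ => hg.nonneg_shift hε0 x
    linarith [(abs_le.1 h2).1]
  have hlim : Tendsto (fun η : ℝ => Real.pi * (∑ j ∈ J, c j) - η * (q - p) +
      ((∫ x in (0 : ℝ)..Λ, ρ x) - η * Λ)) (𝓝[>] 0)
      (𝓝 (Real.pi * (∑ j ∈ J, c j) + ∫ x in (0 : ℝ)..Λ, ρ x)) := by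
    have : Continuous fun η : ℝ => Real.pi * (∑ j ∈ J, c j) - η * (q - p) +
      ((∫ x in (0 : ℝ)..Λ, ρ x) - η * Λ) := by fun_prop
    have := this.tendsto 0
    simp only [zero_mul, sub_zero] at this
    exact this.mono_left nhdsWithin_le_nhds
  exact le_of_tendsto hlim (by filter_upwards [self_mem_nhdsWithin] with η hη using key η hη)

/-- A Herglotz function is the Stieltjes transform of its boundary values: total mass. -/
theorem total_mass (hb : HasBoundaryValues g c ρ) (hg : IsHerglotz g A) :
    Summable c ∧ IntegrableOn ρ (Set.Ioi 0) ∧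
      Real.pi * (∑' x, c x) + ∫ x in Set.Ioi (0 : ℝ), ρ x = Real.pi * A := by
  have hle : ∀ (J : Finset ℝ) (Λ : ℝ), 0 ≤ Λ →
      Real.pi * (∑ j ∈ J, c j) + ∫ x in (0 : ℝ)..Λ, ρ x ≤ Real.pi * A := by
    intro J Λ hΛ
    have h1 := hb.sum_add_integral_le hg (J.filter (· < 0)) (fun j hj => (Finset.mem_filter.1 hj).2) hΛ
    rwa [Finset.sum_filter_of_ne fun j _ hne => by
      by_contra hj
      exact hne (hb.eq_zero j (not_lt.1 hj))] at h1
  have hsum : Summable c := by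
    refine summable_of_sum_le hb.nonneg (c := A) fun u => ?_
    have := hle u 0 le_rfl
    rw [intervalIntegral.integral_same, add_zero] at this
    exact le_of_mul_le_mul_left this Real.pi_pos
  have hint : IntegrableOn ρ (Set.Ioi 0) := by
    refine integrableOn_Ioi_of_intervalIntegral_norm_bounded (Real.pi * A) 0
      (fun Λ : ℝ => ((hb.continuousOn.mono Set.Icc_subset_Ici_self).integrableOn_Icc).mono_set
        Set.Ioc_subset_Icc_self) tendsto_id ?_
    filter_upwards [eventually_ge_atTop (0 : ℝ)] with Λ hΛ
    have h1 := hle ∅ Λ hΛ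
    rw [Finset.sum_empty, mul_zero, zero_add] at h1
    refine le_trans (le_of_eq (intervalIntegral.integral_congr fun x hx => ?_)) h1
    rw [id, Set.uIcc_of_le hΛ] at hx
    exact Real.norm_of_nonneg (hb.density_nonneg hg hx.1)
  refine ⟨hsum, hint, le_antisymm ?_ ?_⟩
  · have hR : ∀ J : Finset ℝ, Real.pi * (∑ j ∈ J, c j) + ∫ x in Set.Ioi (0 : ℝ), ρ x ≤ Real.pi * A :=
      fun J => le_of_tendsto ((intervalIntegral_tendsto_integral_Ioi 0 hint tendsto_id).const_add _)
        ((eventually_ge_atTop (0 : ℝ)).mono fun Λ hΛ => hle J Λ hΛ)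
    have h1 := hsum.tsum_le_of_sum_le
      (fun J => (le_div_iff₀' Real.pi_pos).2 (le_sub_iff_add_le.2 (hR J)))
    rw [le_div_iff₀' Real.pi_pos] at h1
    linarith
  -- No mass is lost. The line is cut at -Λ, -δ, 0 and Λ, and the limits ε → 0, η → 0, δ → 0, Λ → ∞
  -- are taken in this order.
  · set S := ∑' x, c x
    set R := ∫ x in Set.Ioi (0 : ℝ), ρ x with hRdef
    have hcontI : ∀ y : ℝ, 0 < y → Tendsto (fun ε : ℝ => (g ((y + ε : ℝ) * Complex.I)).im) (𝓝[>] 0)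
        (𝓝 (g (y * Complex.I)).im) := by
      intro y hy
      have h1 : ContinuousAt g (y * Complex.I : ℂ) :=
        (hg.hol.differentiableAt ((isOpen_lt continuous_const Complex.continuous_im).mem_nhds
          (by simpa using hy))).continuousAt
      have h2 : Tendsto (fun ε : ℝ => ((y + ε : ℝ) * Complex.I : ℂ)) (𝓝[>] 0) (𝓝 (y * Complex.I)) := by
        have : Continuous fun ε : ℝ => ((y + ε : ℝ) * Complex.I : ℂ) := by fun_prop
        have := this.tendsto 0
        simp only [add_zero] at this
        exact this.mono_left nhdsWithin_le_nhds
      exact (Complex.continuous_im.tendsto _).comp (h1.tendsto.comp h2)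
    have hRle : ∀ Λ : ℝ, 0 ≤ Λ → ∫ x in (0 : ℝ)..Λ, ρ x ≤ R := by
      intro Λ hΛ
      rw [intervalIntegral.integral_of_le hΛ]
      refine setIntegral_mono_set hint ?_ Set.Ioc_subset_Ioi_self.eventuallyLE
      filter_upwards [ae_restrict_mem measurableSet_Ioi] with x hx
      exact hb.density_nonneg hg (le_of_lt hx)
    -- In order, the terms account for the atoms in [-Λ, -δ], the gap (-δ, 0) where eigenvalues may
    -- accumulate, the density on [0, Λ], and the mass outside [-Λ, Λ].
    have k1 : ∀ δ Λ η : ℝ, 0 < δ → δ ≤ Λ → 0 < η →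
        Real.pi * A ≤ Real.pi * S + η * (-δ - -Λ) + 2 * Real.pi * (δ * (g (δ * Complex.I)).im) +
          (R + η * Λ) + 2 * Real.pi * (A - Λ * (g (Λ * Complex.I)).im) := by
      intro δ Λ η hδ hδΛ hη
      have hΛ : 0 < Λ := hδ.trans_le hδΛ
      have hlim := ((((hcontI δ hδ).const_mul δ).const_mul (2 * Real.pi)).const_add
        (Real.pi * S + η * (-δ - -Λ))).add_const (R + η * Λ) |>.add
        ((((hcontI Λ hΛ).const_mul Λ).const_sub A).const_mul (2 * Real.pi))
      refine ge_of_tendsto hlim ?_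
      filter_upwards [hb.eventually_integral_left_le hg hsum (p := -Λ) (q := -δ) (by linarith)
        (by linarith) hη, hb.eventually_abs_integral_right hg hΛ.le hη, self_mem_nhdsWithin]
        with ε h1 h2 hε0
      have hε0 : 0 < ε := hε0
      have hi : ∀ a b : ℝ, IntervalIntegrable (fun x : ℝ => (g (x + ε * Complex.I)).im) volume a b :=
        fun a b => (hg.continuous_shift hε0).intervalIntegrable _ _
      have h3 := hg.le_integral_add hε0 hΛ
      rw [← intervalIntegral.integral_add_adjacent_intervals (hi (-Λ) (-δ)) (hi (-δ) Λ),
        ← intervalIntegral.integral_add_adjacent_intervals (hi (-δ) 0) (hi 0 Λ)] at h3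
      have h4 := hg.integral_near_zero_le hε0 hδ
      linarith [(abs_le.1 h2).2, hRle Λ hΛ.le]
    have k2 : ∀ δ Λ : ℝ, 0 < δ → δ ≤ Λ →
        Real.pi * A ≤ Real.pi * S + 2 * Real.pi * (δ * (g (δ * Complex.I)).im) +
          R + 2 * Real.pi * (A - Λ * (g (Λ * Complex.I)).im) := by
      intro δ Λ hδ hδΛ
      have hc : Continuous fun η : ℝ => Real.pi * S + η * (-δ - -Λ) +
          2 * Real.pi * (δ * (g (δ * Complex.I)).im) +
          (R + η * Λ) + 2 * Real.pi * (A - Λ * (g (Λ * Complex.I)).im) := by fun_prop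
      have hlim := hc.tendsto 0
      simp only [zero_mul, add_zero] at hlim
      exact ge_of_tendsto (hlim.mono_left (nhdsWithin_le_nhds (s := Set.Ioi 0)))
        (by filter_upwards [self_mem_nhdsWithin] with η hη using k1 δ Λ η hδ hδΛ hη)
    have k3 : ∀ Λ : ℝ, 0 < Λ →
        Real.pi * A ≤ Real.pi * S + R + 2 * Real.pi * (A - Λ * (g (Λ * Complex.I)).im) := by
      intro Λ hΛ
      have h1 : Tendsto (fun δ : ℝ => δ) (𝓝[>] (0 : ℝ)) (𝓝 0) :=
        tendsto_id.mono_left nhdsWithin_le_nhds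
      have hlim := (((h1.mul hb.tendsto_density_zero).const_mul (2 * Real.pi)).const_add
        (Real.pi * S)).add_const R |>.add_const (2 * Real.pi * (A - Λ * (g (Λ * Complex.I)).im))
      simp only [zero_mul, mul_zero, add_zero] at hlim
      refine ge_of_tendsto hlim ?_
      filter_upwards [self_mem_nhdsWithin, (gt_mem_nhds hΛ).filter_mono nhdsWithin_le_nhds]
        with δ hδ hδΛ
      exact k2 δ Λ hδ hδΛ.le
    have hlim := ((hg.mass.const_sub A).const_mul (2 * Real.pi)).const_add (Real.pi * S + R)
    simp only [sub_self, mul_zero, add_zero] at hlim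
    exact ge_of_tendsto hlim ((eventually_gt_atTop (0 : ℝ)).mono fun Λ hΛ => k3 Λ hΛ)

end HasBoundaryValues

/-! ### The resolvent form on the upper half-plane -/

theorem IsSymbol.comp_neg {s : ℝ} {V : ℝ → ℝ} (hV : IsSymbol s V) : IsSymbol s fun x => V (-x) := by
  refine ⟨hV.1.comp contDiff_neg, fun α => ?_⟩
  obtain ⟨C, hC⟩ := hV.2 α
  refine ⟨C, fun x => ?_⟩
  have h := hC (-x)
  rw [bracket_neg] at h
  rw [iteratedDeriv_comp_neg, smul_eq_mul, abs_mul, abs_pow, abs_neg, abs_one, one_pow, one_mul]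
  exact h

theorem IsNegativeNearInfinity.comp_neg {μ : ℝ} {V : ℝ → ℝ} (hV : IsNegativeNearInfinity μ V) :
    IsNegativeNearInfinity μ fun x => V (-x) := by
  obtain ⟨c, R, hc, hR, h⟩ := hV
  refine ⟨c, R, hc, hR, fun x hx => ?_⟩
  have := h (-x) (by rwa [abs_neg])
  rwa [bracket_neg] at this

theorem IsSymbol.bounded {μ : ℝ} {V : ℝ → ℝ} (hμ : 0 < μ) (hV : IsSymbol (-μ) V) :
    ∃ M, ∀ x, |V x| ≤ M := by
  obtain ⟨C, hC⟩ := hV.2 0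
  refine ⟨|C|, fun x => ?_⟩
  have h := hC x
  rw [iteratedDeriv_zero, Nat.cast_zero, sub_zero] at h
  have h1 : bracket x ^ (-μ) ≤ 1 := Real.rpow_le_one_of_one_le_of_nonpos (one_le_bracket x) (by linarith)
  have h0 : 0 ≤ bracket x ^ (-μ) := Real.rpow_nonneg (bracket_pos x).le _
  refine h.trans ((mul_le_mul_of_nonneg_right (le_abs_self C) h0).trans ?_)
  exact mul_le_of_le_one_right (abs_nonneg C) h1

theorem exists_upper_pair {V : ℝ → ℝ} {μ : ℝ} (hμ0 : 0 < μ) (hμ : μ < 2) (hV : IsSymbol (-μ) V)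
    {δ : ℝ} (hδ : 0 < δ) : ∃ a a' b b', IsJostPair V {z | δ < z.im} a a' b b' := by
  obtain ⟨Q, u, u', hu, hud⟩ := exists_upper_family hμ0 hμ hV hδ
  obtain ⟨Qm, v, v', hv, hvd⟩ := exists_upper_family hμ0 hμ hV.comp_neg hδ
  exact ⟨_, _, _, _, isJostPair_of_families hu hud hv hvd⟩

theorem exists_left_pair {V : ℝ → ℝ} {μ : ℝ} (hμ0 : 0 < μ) (hμ : μ < 2) (hV : IsSymbol (-μ) V)
    {δ : ℝ} (hδ : 0 < δ) : ∃ a a' b b', IsJostPair V {z | z.re < -δ} a a' b b' := by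
  obtain ⟨Q, u, u', hu, hud⟩ := exists_left_family hμ0 hμ hV hδ
  obtain ⟨Qm, v, v', hv, hvd⟩ := exists_left_family hμ0 hμ hV.comp_neg hδ
  exact ⟨_, _, _, _, isJostPair_of_families hu hud hv hvd⟩

open Classical in
/-- The quadratic form `(f, (-d²/dx² + V - z)⁻¹ f)`. -/
noncomputable def resolventForm (V : ℝ → ℝ) (f : ℝ → ℂ) (z : ℂ) : ℂ :=
  if h : ∃ v v', IsResolvent V z f v v' then ∫ x, conj (f x) * h.choose x else 0

/-- The choice in `resolventForm` is harmless off the real axis because decaying solutions are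
unique. Hence Jost pairs built on different regions represent one and the same function. -/
theorem IsResolvent.resolventForm_eq {V : ℝ → ℝ} {f v v' : ℝ → ℂ} {z : ℂ}
    (h : IsResolvent V z f v v') (hz : z.im ≠ 0) :
    resolventForm V f z = ∫ x, conj (f x) * v x := by
  have hex : ∃ v v', IsResolvent V z f v v' := ⟨v, v', h⟩
  rw [resolventForm, dif_pos hex]
  obtain ⟨w', hw⟩ := hex.choose_spec
  rw [hw.unique h hz]

namespace IsJostPair

variable {V : ℝ → ℝ} {U : Set ℂ} {a a' b b' : ℝ → ℂ → ℂ} {f : ℝ → ℂ}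

theorem resolventForm_eq (h : IsJostPair V U a a' b b') (hV : ∃ M, ∀ x, |V x| ≤ M) (hf : IsTest f)
    {z : ℂ} (hz : z ∈ U) (hz' : z.im ≠ 0) :
    resolventForm V f z = jostN a b f z / jostW a a' b b' z := by
  obtain ⟨v, v', hv, he⟩ := h.exists_isResolvent hz (Or.inl hz') (h.jostW_ne_zero hV hz hz') hf
  rw [hv.resolventForm_eq hz', he]

/-- Green's identity still applies at negative energies, where the solutions decay, and now Im z =
0. -/
theorem im_form_eq_zero (h : IsJostPair V U a a' b b') (hf : IsTest f) {x : ℝ} (hx : (x : ℂ) ∈ U)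
    (hx0 : x < 0) (hW : jostW a a' b b' x ≠ 0) : (jostN a b f x / jostW a a' b b' x).im = 0 := by
  obtain ⟨v, v', hv, he⟩ := h.exists_isResolvent hx (Or.inr (by simpa using hx0)) hW hf
  rw [← he, hv.im_form hf, Complex.ofReal_im, zero_mul]

end IsJostPair

/-- Holomorphy comes from the quotient N / W on a half-plane Im w > Im z / 2 containing the point;
the other properties are the three Green estimates for the resolvent form. -/
theorem isHerglotz_resolventForm {V : ℝ → ℝ} {μ : ℝ} (hμ0 : 0 < μ) (hμ : μ < 2)
    (hV : IsSymbol (-μ) V) {f : ℝ → ℂ} (hf : IsTest f) :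
    IsHerglotz (resolventForm V f) (∫ x, ‖f x‖ ^ 2) := by
  have hVb := hV.bounded hμ0
  have hex : ∀ z : ℂ, 0 < z.im → ∃ v v', IsResolvent V z f v v' := by
    intro z hz
    obtain ⟨a, a', b, b', h⟩ := exists_upper_pair hμ0 hμ hV (half_pos hz)
    have hzU : z ∈ {w : ℂ | z.im / 2 < w.im} := half_lt_self hz
    obtain ⟨v, v', hv, -⟩ := h.exists_isResolvent hzU (Or.inl hz.ne') (h.jostW_ne_zero hVb hzU hz.ne') hf
    exact ⟨v, v', hv⟩
  refine ⟨fun z hz => ?_, fun z hz => ?_, fun z hz => ?_, ?_⟩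
  · have hz : 0 < z.im := hz
    obtain ⟨a, a', b, b', h⟩ := exists_upper_pair hμ0 hμ hV (half_pos hz)
    have hU : IsOpen {w : ℂ | z.im / 2 < w.im} := isOpen_lt continuous_const Complex.continuous_im
    have hzU : {w : ℂ | z.im / 2 < w.im} ∈ 𝓝 z := hU.mem_nhds (half_lt_self hz)
    have h1 : DifferentiableAt ℂ (fun w => jostN a b f w / jostW a a' b b' w) z :=
      ((h.differentiableOn_jostN hU hf).differentiableAt hzU).div
        ((h.differentiableOn_jostW hU).differentiableAt hzU)
        (h.jostW_ne_zero hVb (half_lt_self hz) hz.ne')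
    refine (h1.congr_of_eventuallyEq ?_).differentiableWithinAt
    filter_upwards [hzU] with w hw
    have hw' : z.im / 2 < w.im := hw
    exact h.resolventForm_eq hVb hf hw (by linarith : (0 : ℝ) < w.im).ne'
  · obtain ⟨v, v', hv⟩ := hex z hz
    rw [hv.resolventForm_eq hz.ne', hv.im_form hf]
    exact mul_nonneg hz.le (integral_nonneg fun x => by positivity)
  · obtain ⟨v, v', hv⟩ := hex z hz
    rw [hv.resolventForm_eq hz.ne']
    exact hv.norm_form_mul_im_le hf hz
  · set K := Real.sqrt ((∫ x, ‖-deriv (deriv f) x + V x * f x‖ ^ 2) * ∫ x, ‖f x‖ ^ 2)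
    rw [tendsto_iff_norm_sub_tendsto_zero]
    have h0 : Tendsto (fun y : ℝ => K * y⁻¹) atTop (𝓝 0) := by
      simpa using (tendsto_inv_atTop_zero (𝕜 := ℝ)).const_mul K
    refine squeeze_zero' (Eventually.of_forall fun y => norm_nonneg _) ?_ h0
    filter_upwards [eventually_gt_atTop (0 : ℝ)] with y hy
    have hz : 0 < ((y : ℂ) * Complex.I).im := by simpa using hy
    obtain ⟨v, v', hv⟩ := hex _ hz
    -- At z = iy the real part of z g(z) + ‖f‖² is ‖f‖² - y Im g(iy), so this estimate yields the
    -- rate K / y.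
    have h1 := hv.norm_form_add_le hV.1 hf hz
    rw [← hv.resolventForm_eq hz.ne'] at h1
    have h2 := Complex.abs_re_le_norm ((y : ℂ) * Complex.I * resolventForm V f (y * Complex.I) +
      ((∫ x, ‖f x‖ ^ 2 : ℝ) : ℂ))
    have h3 : ((y : ℂ) * Complex.I * resolventForm V f (y * Complex.I) +
      ((∫ x, ‖f x‖ ^ 2 : ℝ) : ℂ)).re = -(y * (resolventForm V f (y * Complex.I)).im -
        ∫ x, ‖f x‖ ^ 2) := by
      rw [Complex.add_re, Complex.ofReal_re, mul_assoc, Complex.re_ofReal_mul, Complex.I_mul_re]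
      ring
    rw [h3, abs_neg] at h2
    rw [Real.norm_eq_abs, ← div_eq_mul_inv, le_div_iff₀ hy]
    refine (mul_le_mul_of_nonneg_right h2 hy.le).trans ?_
    simpa using h1

/-! ### Poles on the negative half-axis -/

theorem tendsto_ofReal_punctured (l : ℝ) :
    Tendsto (fun x : ℝ => (x : ℂ)) (𝓝[≠] l) (𝓝[≠] (l : ℂ)) := by
  refine tendsto_nhdsWithin_iff.2 ⟨?_, ?_⟩
  · exact (Complex.continuous_ofReal.tendsto l).mono_left nhdsWithin_le_nhds
  · filter_upwards [self_mem_nhdsWithin] with x hx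
    have hx' : x ≠ l := hx
    show (x : ℂ) ≠ l
    exact_mod_cast hx'

/-- A simple pole of a quotient that is real on the real axis. -/
theorem tendsto_im_sub_pole {N W : ℂ → ℂ} {U : Set ℂ} (hU : IsOpen U) {l : ℝ} (hl : (l : ℂ) ∈ U)
    (hN : DifferentiableOn ℂ N U) (hW : DifferentiableOn ℂ W U) (hW0 : W l = 0)
    (hD : deriv W l ≠ 0) (hreal : ∀ᶠ x : ℝ in 𝓝[≠] l, (N x / W x).im = 0) :
    (N l / deriv W l).im = 0 ∧
      Tendsto (fun z : ℂ => (N z / W z - (N l / deriv W l) / (z - l)).im) (𝓝[≠] (l : ℂ)) (𝓝 0) := by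
  have hUl := hU.mem_nhds hl
  set D := deriv W l with hDdef
  -- W(z) = (z - l) W1(z) with W1(l) = W'(l) ≠ 0. So (z - l) N / W extends continuously to l, and
  -- reality on the axis makes the residue real.
  set W1 := dslope W l with hW1
  have hW1d : DifferentiableOn ℂ W1 U := (Complex.differentiableOn_dslope hUl).2 hW
  have hW1l : W1 l = D := dslope_same _ _
  have hWW : ∀ z : ℂ, W z = (z - l) * W1 z := fun z => by
    have := sub_smul_dslope W (l : ℂ) z
    rw [hW0, sub_zero, smul_eq_mul] at this
    exact this.symm
  have hW1c : ContinuousAt W1 l := (hW1d.differentiableAt hUl).continuousAt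
  have hNc : ContinuousAt N l := (hN.differentiableAt hUl).continuousAt
  have hofr := tendsto_ofReal_punctured l
  have him : (N l / D).im = 0 := by
    have h1 : Tendsto (fun z : ℂ => (N z / W1 z).im) (𝓝[≠] (l : ℂ)) (𝓝 (N l / D).im) := by
      have : ContinuousAt (fun z : ℂ => (N z / W1 z).im) (l : ℂ) :=
        Complex.continuous_im.continuousAt.comp (hNc.div hW1c (by rwa [hW1l]))
      have := this.tendsto.mono_left (nhdsWithin_le_nhds (s := {(l : ℂ)}ᶜ))
      rwa [hW1l] at this
    refine tendsto_nhds_unique (h1.comp hofr) (tendsto_const_nhds.congr' ?_)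
    filter_upwards [hreal, self_mem_nhdsWithin] with x hx hxl
    have hne : (x : ℂ) - l ≠ 0 := sub_ne_zero.2 (by exact_mod_cast (show x ≠ l from hxl))
    simp only [Function.comp]
    rw [hWW] at hx
    have h2 : N x / W1 x = ((x - l : ℝ) : ℂ) * (N x / ((x - l) * W1 x)) := by
      push_cast
      by_cases hw : W1 x = 0
      · simp [hw]
      · field_simp
    rw [h2, Complex.im_ofReal_mul, hx, mul_zero]
  refine ⟨him, ?_⟩
  -- H vanishes at l, and the difference between the quotient and its polar part is the divided
  -- difference of H over W1. Its limit L is real, again by reality on the axis.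
  set H : ℂ → ℂ := fun z => N z - N l / D * W1 z with hH
  have hHd : DifferentiableOn ℂ H U := hN.sub (hW1d.const_mul _)
  have hHl : H l = 0 := by
    simp only [hH, hW1l]
    field_simp
    ring
  have hH1c : ContinuousAt (dslope H l) (l : ℂ) :=
    (((Complex.differentiableOn_dslope hUl).2 hHd).differentiableAt hUl).continuousAt
  set L := dslope H l l / D
  have h3 : Tendsto (fun z : ℂ => (N z / W z - (N l / D) / (z - l)).im) (𝓝[≠] (l : ℂ)) (𝓝 L.im) := by
    have h4 : ContinuousAt (fun z : ℂ => (dslope H l z / W1 z).im) (l : ℂ) :=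
      Complex.continuous_im.continuousAt.comp (hH1c.div hW1c (by rwa [hW1l]))
    have h5 := h4.tendsto.mono_left (nhdsWithin_le_nhds (s := {(l : ℂ)}ᶜ))
    rw [hW1l] at h5
    refine h5.congr' ?_
    have hW1ne := (hW1c.eventually_ne (by rwa [hW1l])).filter_mono
      (nhdsWithin_le_nhds (s := {(l : ℂ)}ᶜ))
    filter_upwards [hW1ne, self_mem_nhdsWithin] with z hz hzl
    have hne : z - l ≠ 0 := sub_ne_zero.2 hzl
    have h6 : H z = (z - l) * dslope H l z := by
      have := sub_smul_dslope H (l : ℂ) z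
      rw [hHl, sub_zero, smul_eq_mul] at this
      exact this.symm
    congr 1
    rw [hWW z, div_eq_iff hz]
    field_simp
    have h9 : D * H z = N z * D - W1 z * N l := by
      simp only [hH]
      field_simp
    linear_combination h9 - D * h6
  have hL : L.im = 0 := by
    refine tendsto_nhds_unique (h3.comp hofr) (tendsto_const_nhds.congr' ?_)
    filter_upwards [hreal] with x hx
    simp only [Function.comp]
    have h7 : N l / D = ((N l / D).re : ℂ) := Complex.ext rfl (by simpa using him)
    rw [Complex.sub_im, hx, h7, ← Complex.ofReal_sub, ← Complex.ofReal_div, Complex.ofReal_im,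
      sub_zero]
  rwa [hL] at h3

theorem exists_test_integral_ne_zero {a : ℝ → ℂ} (ha : Continuous a) {x₀ : ℝ} (h0 : a x₀ ≠ 0) :
    ∃ f, IsTest f ∧ ∫ x, f x * a x ≠ 0 := by
  by_contra! hc
  have h1 : ∀ᵐ x ∂volume, a x = 0 := by
    refine ae_eq_zero_of_integral_contDiff_smul_eq_zero ha.locallyIntegrable fun g hg hgs => ?_
    refine (integral_congr_ae (Eventually.of_forall fun x => ?_)).trans
      (hc (fun x => (g x : ℂ)) ⟨Complex.ofRealCLM.contDiff.comp hg, hgs.comp_left Complex.ofReal_zero⟩)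
    exact Complex.real_smul
  exact h0 (congrFun ((Continuous.ae_eq_iff_eq volume ha continuous_zero).1 h1) x₀)

theorem tendsto_add_mul_I (l : ℝ) :
    Tendsto (fun ε : ℝ => (l + ε * Complex.I : ℂ)) (𝓝[>] 0) (𝓝[{z | 0 < z.im}] (l : ℂ)) := by
  refine tendsto_nhdsWithin_iff.2 ⟨?_, ?_⟩
  · have : Continuous fun ε : ℝ => (l + ε * Complex.I : ℂ) := by fun_prop
    have := this.tendsto 0
    simp only [Complex.ofReal_zero, zero_mul, add_zero] at this
    exact this.mono_left nhdsWithin_le_nhds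
  · filter_upwards [self_mem_nhdsWithin] with ε hε
    simpa using hε

theorem nhdsWithin_upper_le (l : ℝ) : 𝓝[{z : ℂ | 0 < z.im}] (l : ℂ) ≤ 𝓝[≠] (l : ℂ) := by
  refine nhdsWithin_mono _ fun z hz hzl => ?_
  have hz : 0 < z.im := hz
  have hzl : z = l := hzl
  rw [hzl, Complex.ofReal_im] at hz
  exact lt_irrefl _ hz

/-- Two decaying solutions are proportional. -/
theorem IsResolvent.exists_eq_mul {V : ℝ → ℝ} (hV : ∃ M, ∀ x, |V x| ≤ M) {z : ℂ}
    {v v' w w' : ℝ → ℂ} (hv : IsSol V z v v') (hvd : ExpDecay v) (hvd' : ExpDecay v')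
    (hw : IsSol V z w w') (hwd : ExpDecay w) (hwd' : ExpDecay w') {x₀ : ℝ} (h0 : v x₀ ≠ 0) :
    ∃ κ : ℂ, ∀ x, w x = κ * v x := by
  have h1 : Tendsto (fun x => v' x * w x - v x * w' x) atTop (𝓝 0) := by
    simpa using (hvd'.mul hwd).tendsto.sub (hvd.mul hwd').tendsto
  have h2 : v' 0 * w 0 - v 0 * w' 0 = 0 :=
    tendsto_nhds_unique (tendsto_const_nhds.congr fun x => hv.wronskian_eq hw 0 x) h1
  obtain ⟨κ, hκ⟩ := hv.exists_eq_mul hV hw h0 h2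
  exact ⟨κ, fun x => (hκ x).1⟩

theorem IsResolvent.isSol {V : ℝ → ℝ} {z : ℂ} {v v' : ℝ → ℂ}
    (h : IsResolvent V z (fun _ => 0) v v') : IsSol V z v v' :=
  ⟨h.hasDerivAt, fun x => (h.hasDerivAt' x).congr_deriv (sub_zero _)⟩

namespace IsJostPair

variable {V : ℝ → ℝ} {U : Set ℂ} {a a' b b' : ℝ → ℂ → ℂ} {f : ℝ → ℂ}

/-- A nonzero solution decaying on both sides has vanishing Wronskian with a and with b, so both are
multiples of it and W = 0. -/
theorem eq_zero_of_isResolvent (hV : ∃ M, ∀ x, |V x| ≤ M) (h : IsJostPair V U a a' b b') {z : ℂ}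
    (hz : z ∈ U) (hz' : z.im ≠ 0 ∨ z.re < 0) (hW : jostW a a' b b' z ≠ 0) {v v' : ℝ → ℂ}
    (hv : IsResolvent V z (fun _ => 0) v v') (x : ℝ) : v x = 0 := by
  by_contra hx
  obtain ⟨hA, hA'⟩ := h.decA z hz hz'
  obtain ⟨hB, hB'⟩ := h.decB z hz hz'
  have h1 : Tendsto (fun x => v' x * a x z - v x * a' x z) atTop (𝓝 0) := by
    simpa using (hv.right'.mul hA).tendsto.sub (hv.right.mul hA').tendsto
  have h2 : v' 0 * a 0 z - v 0 * a' 0 z = 0 :=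
    tendsto_nhds_unique
      (tendsto_const_nhds.congr fun x => hv.isSol.wronskian_eq (h.solA z hz) 0 x) h1
  have h3 : Tendsto (fun x => v' x * b x z - v x * b' x z) atBot (𝓝 0) := by
    have e1 : ExpDecay fun x => v' (-x) * b (-x) z := hv.left'.mul hB
    have e2 : ExpDecay fun x => v (-x) * b' (-x) z := hv.left.mul hB'
    simpa using (ExpDecay.tendsto_atBot (f := fun x => v' x * b x z) e1).sub
      (ExpDecay.tendsto_atBot (f := fun x => v x * b' x z) e2)
  have h4 : v' 0 * b 0 z - v 0 * b' 0 z = 0 :=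
    tendsto_nhds_unique
      (tendsto_const_nhds.congr fun x => hv.isSol.wronskian_eq (h.solB z hz) 0 x) h3
  obtain ⟨κ, hκ⟩ := hv.isSol.exists_eq_mul hV (h.solA z hz) hx h2
  obtain ⟨τ, hτ⟩ := hv.isSol.exists_eq_mul hV (h.solB z hz) hx h4
  apply hW
  rw [jostW, (hκ 0).1, (hκ 0).2, (hτ 0).1, (hτ 0).2]
  ring

/-- When b is a multiple of a, the maximum and minimum disappear from the kernel and the double
integral factorizes; proportionality of a to its conjugate turns the product into a squared modulus.
-/
theorem jostN_of_proportional {κ τ l : ℂ} (hκ : ∀ x, b x l = κ * a x l)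
    (hτ : ∀ x, conj (a x l) = τ * a x l) :
    jostN a b f l = -(κ * conj τ) * ((‖∫ x, f x * a x l‖ ^ 2 : ℝ) : ℂ) := by
  have h1 : ∀ p : ℝ × ℝ, conj (f p.1) * f p.2 * (a (max p.1 p.2) l * b (min p.1 p.2) l) =
      κ * ((conj (f p.1) * a p.1 l) * (f p.2 * a p.2 l)) := by
    intro p
    rw [hκ]
    rcases le_total p.1 p.2 with h | h
    · rw [max_eq_right h, min_eq_left h]
      ring
    · rw [max_eq_left h, min_eq_right h]
      ring
  have h2 : ∫ x, conj (f x) * a x l = conj τ * conj (∫ x, f x * a x l) := by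
    rw [← integral_conj, ← integral_const_mul]
    refine integral_congr_ae (Eventually.of_forall fun x => ?_)
    have := congrArg conj (hτ x)
    simp only [map_mul, Complex.conj_conj] at this ⊢
    linear_combination conj (f x) * this
  rw [jostN]
  simp_rw [h1]
  rw [integral_const_mul, Measure.volume_eq_prod,
    integral_prod_mul (fun x => conj (f x) * a x l) (fun y => f y * a y l), h2, mul_assoc,
    ← Complex.normSq_eq_conj_mul_self, Complex.normSq_eq_norm_sq]
  ring

/-- A holomorphic function vanishing near l would vanish at nonreal points, where the Wronskian has
no zeros. -/
theorem eventually_jostW_ne_zero (hV : ∃ M, ∀ x, |V x| ≤ M) (h : IsJostPair V U a a' b b')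
    (hU : IsOpen U) {l : ℝ} (hl : (l : ℂ) ∈ U) :
    ∀ᶠ z in 𝓝[≠] (l : ℂ), jostW a a' b b' z ≠ 0 := by
  have hA : AnalyticAt ℂ (jostW a a' b b') l :=
    (h.differentiableOn_jostW hU).analyticAt (hU.mem_nhds hl)
  refine hA.eventually_eq_zero_or_eventually_ne_zero.resolve_left fun h0 => ?_
  have h1 := (tendsto_add_mul_I l).eventually
    ((h0.and (hU.mem_nhds hl)).filter_mono nhdsWithin_le_nhds)
  obtain ⟨ε, ⟨h2, h3⟩, hε⟩ := (h1.and self_mem_nhdsWithin).exists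
  have hε : 0 < ε := hε
  exact h.jostW_ne_zero hV h3 (by simpa using hε.ne') h2

end IsJostPair

/-- Negative eigenvalues are isolated. -/
theorem eventually_not_eigenvalue {V : ℝ → ℝ} {μ : ℝ} (hμ0 : 0 < μ) (hμ : μ < 2)
    (hV : IsSymbol (-μ) V) {l : ℝ} (hl : l < 0) :
    ∀ᶠ x : ℝ in 𝓝[≠] l, ∀ v v', IsResolvent V x (fun _ => 0) v v' → ∀ y, v y = 0 := by
  -- With this `δ` the half-plane is Re z < l/2, which contains l.
  obtain ⟨a, a', b, b', h⟩ := exists_left_pair hμ0 hμ hV (δ := -l / 2) (by linarith)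
  have hU : IsOpen {z : ℂ | z.re < -(-l / 2)} := isOpen_lt Complex.continuous_re continuous_const
  have hlU : (l : ℂ) ∈ {z : ℂ | z.re < -(-l / 2)} := by
    show (l : ℂ).re < -(-l / 2)
    rw [Complex.ofReal_re]
    linarith
  have h1 := (tendsto_ofReal_punctured l).eventually
    ((h.eventually_jostW_ne_zero (hV.bounded hμ0) hU hlU).and
      ((hU.eventually_mem hlU).filter_mono nhdsWithin_le_nhds))
  filter_upwards [h1, (gt_mem_nhds hl).filter_mono nhdsWithin_le_nhds] with x hx hx0 v v' hv y
  exact h.eq_zero_of_isResolvent (hV.bounded hμ0) hx.2 (Or.inr (by simpa using hx0)) hx.1 hv y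

theorem isOpen_left_half_plane (δ : ℝ) : IsOpen {z : ℂ | z.re < δ} :=
  isOpen_lt Complex.continuous_re continuous_const

/-- At a negative energy the resolvent form has at most a simple pole, whose residue is given by an
eigenfunction. -/
theorem exists_atom {V : ℝ → ℝ} {μ : ℝ} (hμ0 : 0 < μ) (hμ : μ < 2) (hV : IsSymbol (-μ) V) {l : ℝ}
    (hl : l < 0) : ∃ φ φ', IsResolvent V l (fun _ => 0) φ φ' ∧ ∀ f, IsTest f →
      Tendsto (fun z : ℂ => (resolventForm V f z +
        ((‖∫ x, conj (φ x) * f x‖ ^ 2 : ℝ) : ℂ) / (z - l)).im) (𝓝[{z | 0 < z.im}] (l : ℂ)) (𝓝 0) := by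
  have hVb := hV.bounded hμ0
  obtain ⟨a, a', b, b', h⟩ := exists_left_pair hμ0 hμ hV (δ := -l / 2) (by linarith)
  set U : Set ℂ := {z : ℂ | z.re < -(-l / 2)} with hUdef
  have hU : IsOpen U := isOpen_left_half_plane _
  have hlU : (l : ℂ) ∈ U := by
    show (l : ℂ).re < -(-l / 2)
    rw [Complex.ofReal_re]
    linarith
  have hl' : (l : ℂ).im ≠ 0 ∨ (l : ℂ).re < 0 := Or.inr (by simpa using hl)
  have hUm : ∀ᶠ z in 𝓝[{z : ℂ | 0 < z.im}] (l : ℂ), z ∈ U ∧ 0 < z.im :=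
    ((hU.eventually_mem hlU).filter_mono nhdsWithin_le_nhds).and self_mem_nhdsWithin
  have hform : ∀ f, IsTest f → ∀ᶠ z in 𝓝[{z : ℂ | 0 < z.im}] (l : ℂ),
      resolventForm V f z = jostN a b f z / jostW a a' b b' z := fun f hf => by
    filter_upwards [hUm] with z hz
    exact h.resolventForm_eq hVb hf hz.1 hz.2.ne'
  by_cases hW0 : jostW a a' b b' l = 0
  swap
  -- If l is not a zero of the Wronskian, the form extends continuously to l with a real value
  -- there, and the atom is zero.
  · refine ⟨fun _ => 0, fun _ => 0, ?_, fun f hf => ?_⟩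
    · have hz : ExpDecay fun _ : ℝ => (0 : ℂ) := by
        simpa using ((h.decA l hlU hl').1.const_mul 0)
      exact ⟨fun x => hasDerivAt_const _ _, fun x => (hasDerivAt_const _ _).congr_deriv (by simp),
        hz, hz, hz, hz⟩
    · have h1 : ContinuousAt (fun z => (jostN a b f z / jostW a a' b b' z).im) (l : ℂ) :=
        Complex.continuous_im.continuousAt.comp
          (((h.differentiableOn_jostN hU hf).differentiableAt (hU.mem_nhds hlU)).continuousAt.div
            ((h.differentiableOn_jostW hU).differentiableAt (hU.mem_nhds hlU)).continuousAt hW0)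
      have h2 := h1.tendsto.mono_left (nhdsWithin_le_nhds (s := {z : ℂ | 0 < z.im}))
      rw [h.im_form_eq_zero hf hlU hl hW0] at h2
      refine h2.congr' ?_
      filter_upwards [hform f hf] with z hz
      simp [hz]
  obtain ⟨⟨κ, hκ0, hκ⟩, hres⟩ := h.exists_eigenfunction hVb hlU hl' hW0
  obtain ⟨x₀, hx₀⟩ := h.neA l hlU
  have hsol := h.solA l hlU
  have hstar : IsSol V l (fun x => conj (a x l)) fun x => conj (a' x l) := by
    have := hsol.star
    rwa [Complex.conj_ofReal] at this
  obtain ⟨τ, hτ⟩ := IsResolvent.exists_eq_mul hVb hsol hres.right hres.right' hstar hres.right.star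
    hres.right'.star hx₀
  -- One test function seeing the eigenfunction is enough to decide the order of the zero and the
  -- sign of the residue.
  obtain ⟨f₀, hf₀, hf₀0⟩ := exists_test_integral_ne_zero hsol.continuous hx₀
  have hτ0 : τ ≠ 0 := by
    rintro rfl
    have := hτ x₀
    rw [zero_mul, map_eq_zero] at this
    exact hx₀ this
  have hN : ∀ f, jostN a b f l = -(κ * conj τ) * ((‖∫ x, f x * a x l‖ ^ 2 : ℝ) : ℂ) := fun f =>
    IsJostPair.jostN_of_proportional hκ hτ
  have hWd := h.differentiableOn_jostW hU
  have hWl : HasDerivAt (jostW a a' b b') (deriv (jostW a a' b b') l) (l : ℂ) :=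
    (hWd.differentiableAt (hU.mem_nhds hlU)).hasDerivAt
  have hNf₀ : jostN a b f₀ l ≠ 0 := by
    rw [hN]
    refine mul_ne_zero (neg_ne_zero.2 (mul_ne_zero hκ0 ((map_ne_zero _).2 hτ0))) ?_
    exact_mod_cast pow_ne_zero 2 (norm_ne_zero_iff.2 hf₀0)
  set D := deriv (jostW a a' b b') l with hDdef
  -- At l + iε the Herglotz bound gives |N| ≤ ‖f₀‖² |W| / ε, whose right side tends to ‖f₀‖²
  -- |W'(l)|. A multiple zero would force N(l) = 0.
  have hD : D ≠ 0 := by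
    intro hD0
    have hslope := (hasDerivAt_iff_tendsto_slope.1 hWl).comp
      ((tendsto_add_mul_I l).mono_right (nhdsWithin_upper_le l))
    have hNlim : Tendsto (fun ε : ℝ => ‖jostN a b f₀ (l + ε * Complex.I)‖) (𝓝[>] 0)
        (𝓝 ‖jostN a b f₀ l‖) := by
      have hc : ContinuousAt (jostN a b f₀) (l : ℂ) :=
        ((h.differentiableOn_jostN hU hf₀).differentiableAt (hU.mem_nhds hlU)).continuousAt
      exact (hc.tendsto.comp ((tendsto_add_mul_I l).mono_right nhdsWithin_le_nhds)).norm
    have hlim2 := (hslope.norm).const_mul (∫ x, ‖f₀ x‖ ^ 2)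
    rw [hD0, norm_zero, mul_zero] at hlim2
    refine hNf₀ (norm_le_zero_iff.1 (le_of_tendsto_of_tendsto hNlim hlim2 ?_))
    filter_upwards [(tendsto_add_mul_I l).eventually ((hform f₀ hf₀).and hUm), self_mem_nhdsWithin]
      with ε hε hε0
    have hε0 : 0 < ε := hε0
    have hbd := (isHerglotz_resolventForm hμ0 hμ hV hf₀).bound _ hε.2.2
    have hWne := h.jostW_ne_zero hVb hε.2.1 hε.2.2.ne'
    have him : (l + ε * Complex.I : ℂ).im = ε := by simp
    rw [hε.1, him, norm_div, div_mul_eq_mul_div, div_le_iff₀ (norm_pos_iff.2 hWne)] at hbd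
    simp only [Function.comp, slope_def_field]
    rw [hW0, sub_zero, add_sub_cancel_left, norm_div, norm_mul, Complex.norm_I, mul_one,
      Complex.norm_real, Real.norm_of_nonneg hε0.le, ← mul_div_assoc, le_div_iff₀ hε0]
    exact hbd
  have hreal : ∀ f, IsTest f →
      ∀ᶠ x : ℝ in 𝓝[≠] l, (jostN a b f x / jostW a a' b b' x).im = 0 := by
    intro f hf
    have h1 := (tendsto_ofReal_punctured l).eventually
      ((h.eventually_jostW_ne_zero hVb hU hlU).and
        ((hU.eventually_mem hlU).filter_mono nhdsWithin_le_nhds))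
    filter_upwards [h1, (gt_mem_nhds hl).filter_mono nhdsWithin_le_nhds] with x hx hx0
    exact h.im_form_eq_zero hf hx.2 hx0 hx.1
  have hpole := fun f (hf : IsTest f) => tendsto_im_sub_pole hU hlU (h.differentiableOn_jostN hU hf)
    hWd hW0 hD (hreal f hf)
  -- The residue of the form is -K times a squared modulus. K is real by the pole lemma, and
  -- nonnegative because Im g ≥ 0 above l.
  set K : ℂ := κ * conj τ / D with hK
  have hND : ∀ f, jostN a b f l / D = -(K * ((‖∫ x, f x * a x l‖ ^ 2 : ℝ) : ℂ)) := fun f => by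
    rw [hN, hK]
    ring
  have hr₀ : 0 < ‖∫ x, f₀ x * a x l‖ ^ 2 := pow_pos (norm_pos_iff.2 hf₀0) 2
  have hKim : K.im = 0 := by
    have h1 := (hpole f₀ hf₀).1
    rw [hND, Complex.neg_im, Complex.im_mul_ofReal, neg_eq_zero] at h1
    exact (mul_eq_zero.1 h1).resolve_right hr₀.ne'
  have hKre : K = (K.re : ℂ) := Complex.ext rfl (by simpa using hKim)
  have hKnonneg : 0 ≤ K.re := by
    have h1 := ((hpole f₀ hf₀).2.comp ((tendsto_add_mul_I l).mono_right (nhdsWithin_upper_le l)))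
    have hε : Tendsto (fun ε : ℝ => ε) (𝓝[>] (0 : ℝ)) (𝓝 0) := tendsto_id.mono_left nhdsWithin_le_nhds
    have h2 := (hε.mul h1).add_const (K.re * ‖∫ x, f₀ x * a x l‖ ^ 2)
    rw [zero_mul, zero_add] at h2
    have h3 : 0 ≤ K.re * ‖∫ x, f₀ x * a x l‖ ^ 2 := by
      refine ge_of_tendsto h2 ?_
      filter_upwards [(tendsto_add_mul_I l).eventually ((hform f₀ hf₀).and hUm),
        self_mem_nhdsWithin] with ε hε1 hε0
      have hε0 : 0 < ε := hε0
      simp only [Function.comp]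
      rw [← hε1.1, hND, hKre, Complex.sub_im, ← Complex.ofReal_mul, ← Complex.ofReal_neg, im_atom]
      have h4 := (isHerglotz_resolventForm hμ0 hμ hV hf₀).nonneg _ hε1.2.2
      have h5 : ε * -(-(K.re * ‖∫ x, f₀ x * a x l‖ ^ 2) * (ε / ((l - l) ^ 2 + ε ^ 2))) =
          K.re * ‖∫ x, f₀ x * a x l‖ ^ 2 := by
        rw [sub_self]
        field_simp
        ring
      rw [mul_sub, h5]
      have := mul_nonneg hε0.le h4
      simp only [Complex.ofReal_re]
      linarith
    exact nonneg_of_mul_nonneg_left h3 hr₀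
  -- The factor √K is absorbed into the eigenfunction, so the residue becomes exactly minus the
  -- squared pairing.
  set s := Real.sqrt K.re
  refine ⟨fun x => s * conj (a x l), fun x => s * conj (a' x l), ?_, fun f hf => ?_⟩
  · have h1 := hstar.const_mul (s : ℂ)
    exact ⟨h1.hasDerivAt, fun x => (h1.hasDerivAt' x).congr_deriv (sub_zero _).symm,
      hres.right.star.const_mul _, hres.right'.star.const_mul _, hres.left.star.const_mul _,
      hres.left'.star.const_mul _⟩
  · have h1 : ∀ x, conj ((s : ℂ) * conj (a x l)) * f x = s * (f x * a x l) := fun x => by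
      simp only [map_mul, Complex.conj_conj, Complex.conj_ofReal]
      ring
    simp_rw [h1]
    rw [integral_const_mul, norm_mul, mul_pow, Complex.norm_real, Real.norm_of_nonneg
      (Real.sqrt_nonneg _), Real.sq_sqrt hKnonneg]
    refine ((hpole f hf).2.mono_left (nhdsWithin_upper_le l)).congr' ?_
    filter_upwards [hform f hf] with z hz
    rw [hz, hND, hKre]
    push_cast
    simp only [Complex.ofReal_re]
    congr 1
    ring

/-! ### The positive half-axis -/

section RealEnergy

variable {Q : ℝ → ℝ} {l : ℝ}

theorem wkbRoot_ofReal {x : ℝ} (h : Q x < l) : wkbRoot Q x l = -Complex.I * Real.sqrt (l - Q x) := by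
  rw [wkbRoot, ← outgoingSqrt_neg_ofReal (sub_pos.2 h)]
  push_cast
  ring_nf

theorem wkbPhase_ofReal (h : ∀ x, Q x < l) (x : ℝ) :
    wkbPhase Q x l = -Complex.I * ((∫ t in (0 : ℝ)..x, Real.sqrt (l - Q t) : ℝ) : ℂ) := by
  rw [wkbPhase, ← intervalIntegral.integral_ofReal, ← intervalIntegral.integral_const_mul]
  exact intervalIntegral.integral_congr fun t _ => wkbRoot_ofReal (h t)

theorem norm_exp_neg_wkbPhase (h : ∀ x, Q x < l) (x : ℝ) : ‖Complex.exp (-wkbPhase Q x l)‖ = 1 := by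
  rw [wkbPhase_ofReal h, Complex.norm_exp]
  simp

theorem norm_wkbRoot_ofReal {x : ℝ} (h : Q x < l) : ‖wkbRoot Q x l‖ = Real.sqrt (l - Q x) := by
  rw [wkbRoot_ofReal h, norm_mul, norm_neg, Complex.norm_I, one_mul, Complex.norm_real,
    Real.norm_of_nonneg (Real.sqrt_nonneg _)]

/-- With s = F^(1/2) the product is s / conj s = s² / |s|² = F / |F|. -/
theorem cpow_half_mul_conj {r : ℝ} (hr : 0 < r) :
    (-Complex.I * r : ℂ) ^ (1 / 2 : ℂ) * conj ((-Complex.I * r : ℂ) ^ (-1 / 2 : ℂ)) = -Complex.I := by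
  set F : ℂ := -Complex.I * r
  have hF : F ≠ 0 := mul_ne_zero (neg_ne_zero.2 Complex.I_ne_zero) (by exact_mod_cast hr.ne')
  set s := F ^ (1 / 2 : ℂ) with hs
  have hss : s * s = F := by
    rw [hs, ← Complex.cpow_add _ _ hF]
    norm_num
  have hs0 : s ≠ 0 := by
    intro h0
    rw [h0, zero_mul] at hss
    exact hF hss.symm
  have hn : s * conj s = r := by
    rw [Complex.mul_conj, Complex.normSq_eq_norm_sq, sq, ← norm_mul, hss, norm_mul, norm_neg,
      Complex.norm_I, one_mul, Complex.norm_real, Real.norm_of_nonneg hr.le]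
  have hinv : F ^ (-1 / 2 : ℂ) = s⁻¹ := by
    rw [show (-1 / 2 : ℂ) = -(1 / 2) by ring, Complex.cpow_neg]
  have hc0 : conj s ≠ 0 := (map_ne_zero _).2 hs0
  have hr0 : (r : ℂ) ≠ 0 := by exact_mod_cast hr.ne'
  rw [hinv, map_inv₀, ← div_eq_mul_inv, div_eq_iff hc0]
  refine mul_left_cancel₀ hs0 ?_
  rw [hss, mul_left_comm, hn]

variable {V : ℝ → ℝ} {U : Set ℂ} {u u' : ℝ → ℂ → ℂ}

theorem IsWKBFamily.isSol (h : IsWKBFamily V Q U u u') {z : ℂ} (hz : z ∈ U) :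
    IsSol V z (fun x => u x z) (fun x => u' x z) :=
  ⟨fun x => h.deriv x z hz, fun x => h.deriv' x z hz⟩

/-- The flux of an outgoing solution at real energy. -/
theorem IsWKBFamily.flux (h : IsWKBFamily V Q U u u') (hl : (l : ℂ) ∈ U) (hQ : ∀ x, Q x < l) (x : ℝ) :
    u' x l * conj (u x l) - u x l * conj (u' x l) = 2 * Complex.I := by
  have hsol := h.isSol hl
  have hstar := hsol.star
  rw [Complex.conj_ofReal] at hstar
  have h1 := (h.asymp' l hl).mul ((Complex.continuous_conj.tendsto _).comp (h.asymp l hl))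
  simp only [map_one, mul_one] at h1
  -- The leading terms multiply to -F^(1/2) conj(F^(-1/2)) |e^(-S)|² = i. The flux is constant in x,
  -- so its limit is its value.
  have h2 : Tendsto (fun x => u' x l * conj (u x l)) atTop (𝓝 Complex.I) := by
    have h3 := h1.mul_const Complex.I
    rw [one_mul] at h3
    refine h3.congr fun x => ?_
    have hr : 0 < Real.sqrt (l - Q x) := Real.sqrt_pos.2 (sub_pos.2 (hQ x))
    have hF := wkbRoot_ofReal (hQ x)
    have hc := cpow_half_mul_conj hr
    rw [← hF] at hc
    set s := wkbRoot Q x l ^ (1 / 2 : ℂ)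
    set t := wkbRoot Q x l ^ (-1 / 2 : ℂ)
    set e := Complex.exp (-wkbPhase Q x l)
    have he : e * conj e = 1 := by
      rw [Complex.mul_conj, Complex.normSq_eq_norm_sq, norm_exp_neg_wkbPhase hQ]
      norm_num
    have hs0 : s ≠ 0 := by
      rintro h0
      rw [h0, zero_mul] at hc
      exact Complex.I_ne_zero (neg_eq_zero.1 hc.symm)
    have ht0 : conj t ≠ 0 := by
      rintro h0
      rw [h0, mul_zero] at hc
      exact Complex.I_ne_zero (neg_eq_zero.1 hc.symm)
    have he0 : e ≠ 0 := Complex.exp_ne_zero _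
    have hce0 : conj e ≠ 0 := (map_ne_zero _).2 he0
    simp only [Function.comp, map_div₀, map_mul]
    rw [div_mul_div_comm, show -s * e * (conj t * conj e) = -(s * conj t) * (e * conj e) by ring, hc, he]
    field_simp
  have h4 : Tendsto (fun x => u x l * conj (u' x l)) atTop (𝓝 (-Complex.I)) := by
    have h5 := (Complex.continuous_conj.tendsto _).comp h2
    rw [Complex.conj_I] at h5
    refine h5.congr fun x => ?_
    simp [mul_comm]
  have h6 := h2.sub h4
  rw [sub_neg_eq_add, ← two_mul] at h6
  exact tendsto_nhds_unique
    (tendsto_const_nhds.congr fun y => hsol.wronskian_eq hstar x y) h6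

/-- Since Q < 0, the phase factor is unimodular and |F| = (k² - Q)^(1/2) ≥ k, so |F|^(-1/2) costs at
most k^(-1/2). The constant is uniform in k and x; this is the source of the bound in (BM2). -/
theorem IsWKBFamily.norm_le (h : IsWKBFamily V Q U u u') (hQ : ∀ x, Q x < 0) :
    ∃ C, ∀ k : ℝ, 0 < k → ((k ^ 2 : ℝ) : ℂ) ∈ U → ∀ x, Real.sqrt k * ‖u x (k ^ 2 : ℝ)‖ ≤ C := by
  obtain ⟨C, hC⟩ := h.bound
  refine ⟨|C|, fun k hk hkU x => ?_⟩
  have hQk : ∀ x, Q x < k ^ 2 := fun x => (hQ x).trans (by positivity)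
  have h1 := hC x _ hkU
  rw [norm_mul, norm_exp_neg_wkbPhase hQk, mul_one,
    show (-1 / 2 : ℂ) = ((-1 / 2 : ℝ) : ℂ) by push_cast; ring, Complex.norm_cpow_real,
    norm_wkbRoot_ofReal (hQk x)] at h1
  have h2 : k ≤ Real.sqrt (k ^ 2 - Q x) := Real.le_sqrt_of_sq_le (by linarith [hQ x])
  have h3 : Real.sqrt (k ^ 2 - Q x) ^ (-1 / 2 : ℝ) ≤ k ^ (-1 / 2 : ℝ) :=
    Real.rpow_le_rpow_of_nonpos hk h2 (by norm_num)
  have h4 : ‖u x (k ^ 2 : ℝ)‖ ≤ |C| * k ^ (-1 / 2 : ℝ) :=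
    h1.trans (mul_le_mul (le_abs_self C) h3 (by positivity) (abs_nonneg C))
  have h5 : Real.sqrt k * k ^ (-1 / 2 : ℝ) = 1 := by
    rw [Real.sqrt_eq_rpow, ← Real.rpow_add hk]
    norm_num
  calc Real.sqrt k * ‖u x (k ^ 2 : ℝ)‖ ≤ Real.sqrt k * (|C| * k ^ (-1 / 2 : ℝ)) := by gcongr
    _ = |C| := by rw [mul_left_comm, h5, mul_one]

theorem IsWKBFamily.norm_deriv_le (h : IsWKBFamily V Q U u u') (hQ : ∀ x, Q x < l) {M : ℝ}
    (hM : ∀ x, |Q x| ≤ M) (hl : (l : ℂ) ∈ U) : ∃ C, ∀ x, ‖u' x l‖ ≤ C := by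
  obtain ⟨C, hC⟩ := h.bound'
  refine ⟨|C| * Real.sqrt (l + M) ^ (1 / 2 : ℝ), fun x => ?_⟩
  have h1 := hC x _ hl
  rw [norm_mul, norm_exp_neg_wkbPhase hQ, mul_one,
    show (1 / 2 : ℂ) = ((1 / 2 : ℝ) : ℂ) by push_cast; ring, Complex.norm_cpow_real,
    norm_wkbRoot_ofReal (hQ x)] at h1
  refine h1.trans (mul_le_mul (le_abs_self C) ?_ (by positivity) (abs_nonneg C))
  exact Real.rpow_le_rpow (Real.sqrt_nonneg _)
    (Real.sqrt_le_sqrt (by linarith [(abs_le.1 (hM x)).1])) (by norm_num)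

end RealEnergy

/-- The two fluxes give |a'b - ab'|² = 4 + |a' conj b - a conj b'|². In scattering terms,
transmission never exceeds incidence. -/
theorem two_le_norm_wronskian {a a' b b' : ℂ} (ha : a' * conj a - a * conj a' = 2 * Complex.I)
    (hb : b' * conj b - b * conj b' = -(2 * Complex.I)) : 2 ≤ ‖a' * b - a * b'‖ := by
  have h1 : (a' * b - a * b') * conj (a' * b - a * b') =
      4 + (a' * conj b - a * conj b') * conj (a' * conj b - a * conj b') := by
    simp only [map_sub, map_mul, Complex.conj_conj]
    linear_combination (b' * conj b - b * conj b') * ha + 2 * Complex.I * hb -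
      4 * Complex.I_mul_I
  rw [Complex.mul_conj, Complex.mul_conj, Complex.normSq_eq_norm_sq, Complex.normSq_eq_norm_sq] at h1
  have h2 : ‖a' * b - a * b'‖ ^ 2 = 4 + ‖a' * conj b - a * conj b'‖ ^ 2 := by exact_mod_cast h1
  nlinarith [norm_nonneg (a' * b - a * b'), sq_nonneg ‖a' * conj b - a * conj b'‖]

/-- The jump of Green's function across the continuous spectrum. -/
theorem green_jump {V : ℝ → ℝ} {l : ℝ} {a a' b b' : ℝ → ℂ} (ha : IsSol V l a a') (hb : IsSol V l b b')
    (hfa : ∀ x, a' x * conj (a x) - a x * conj (a' x) = 2 * Complex.I)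
    (hfb : ∀ x, b' x * conj (b x) - b x * conj (b' x) = -(2 * Complex.I)) :
    (∀ x y, (a' 0 * b 0 - a 0 * b' 0) * (conj (a x) * conj (b y)) -
      conj (a' 0 * b 0 - a 0 * b' 0) * (a x * b y) =
        2 * Complex.I * (a x * conj (a y) + b x * conj (b y))) ∧
    ∀ x y, a x * conj (a y) + b x * conj (b y) = a y * conj (a x) + b y * conj (b x) := by
  set W := a' 0 * b 0 - a 0 * b' 0 with hW
  have hstar := ha.star
  rw [Complex.conj_ofReal] at hstar
  -- W and X are, up to sign, the coefficients of 2i b in the basis conj a, a (see `hexp`).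
  set X := conj (a' 0) * b 0 - conj (a 0) * b' 0 with hX
  have hexp : ∀ x, 2 * Complex.I * b x = -X * a x + W * conj (a x) := by
    intro x
    have h1 := ha.wronskian_eq hb x 0
    have h2 := hstar.wronskian_eq hb x 0
    rw [← hW] at h1
    rw [← hX] at h2
    linear_combination (-b x) * hfa x - a x * h2 + conj (a x) * h1
  have hexpc : ∀ x, -(2 * Complex.I) * conj (b x) = -conj X * conj (a x) + conj W * a x := by
    intro x
    have := congrArg conj (hexp x)
    simp only [map_mul, map_add, map_neg, Complex.conj_conj, Complex.conj_I, map_ofNat] at this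
    linear_combination this
  -- Unitarity of scattering, a consequence of the two fluxes.
  have hnorm : W * conj W = 4 + X * conj X := by
    simp only [hW, hX, map_sub, map_mul, Complex.conj_conj]
    linear_combination (b' 0 * conj (b 0) - b 0 * conj (b' 0)) * hfa 0 + 2 * Complex.I * hfb 0 -
      4 * Complex.I_mul_I
  have hI := Complex.I_mul_I
  have h2I : 2 * Complex.I ≠ 0 := mul_ne_zero two_ne_zero Complex.I_ne_zero
  constructor
  · intro x y
    refine mul_left_cancel₀ h2I ?_
    linear_combination (-(a x * conj (a y))) * hnorm - W * conj (a x) * hexpc y -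
      conj W * a x * hexp y - 4 * (a x * conj (a y)) * hI + 2 * Complex.I * b x * hexpc y +
      (-conj X * conj (a y) + conj W * a y) * hexp x
  · intro x y
    refine mul_left_cancel₀ (mul_ne_zero h2I h2I) ?_
    linear_combination 4 * (a x * conj (a y)) * hI - 2 * Complex.I * b x * hexpc y -
      (-conj X * conj (a y) + conj W * a y) * hexp x + (a x * conj (a y)) * hnorm -
      4 * (a y * conj (a x)) * hI + 2 * Complex.I * b y * hexpc x +
      (-conj X * conj (a x) + conj W * a x) * hexp y - (a y * conj (a x)) * hnorm

theorem IsTest.integrable_kernel {f : ℝ → ℂ} (hf : IsTest f) {K : ℝ × ℝ → ℂ} (hK : Continuous K) :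
    Integrable fun p : ℝ × ℝ => conj (f p.1) * f p.2 * K p := by
  have hfc := hf.continuous
  have hcc := Complex.continuous_conj
  have hc : Continuous fun p : ℝ × ℝ => conj (f p.1) * f p.2 * K p := by fun_prop
  refine hc.integrable_of_hasCompactSupport (HasCompactSupport.intro (hf.2.isCompact.prod hf.2.isCompact)
    fun p hp => IsJostPair.integrand_eq_zero _ hp)

/-- With N = -J, the imaginary part of N / W is (W conj J - conj W J) / (2i |W|²). The kernel of
this combination is the jump in `green_jump`, a sum of two rank-one kernels. -/
theorem im_jostN_div {V : ℝ → ℝ} {l : ℝ} {a a' b b' : ℝ → ℂ → ℂ} {f : ℝ → ℂ} (hf : IsTest f)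
    (ha : IsSol V l (fun x => a x l) fun x => a' x l) (hb : IsSol V l (fun x => b x l) fun x => b' x l)
    (hfa : ∀ x, a' x l * conj (a x l) - a x l * conj (a' x l) = 2 * Complex.I)
    (hfb : ∀ x, b' x l * conj (b x l) - b x l * conj (b' x l) = -(2 * Complex.I)) :
    (jostN a b f l / jostW a a' b b' l).im = (‖jostW a a' b b' l‖ ^ 2)⁻¹ *
      (‖∫ x, conj (a x l) * f x‖ ^ 2 + ‖∫ x, conj (b x l) * f x‖ ^ 2) := by
  obtain ⟨hG, hS⟩ := green_jump ha hb hfa hfb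
  have hac := ha.continuous
  have hbc := hb.continuous
  have hcc := Complex.continuous_conj
  set W := jostW a a' b b' l with hWdef
  have hW0 : W ≠ 0 := by
    have := two_le_norm_wronskian (hfa 0) (hfb 0)
    intro h0
    rw [hWdef, jostW] at h0
    rw [h0, norm_zero] at this
    linarith
  set K : ℝ × ℝ → ℂ := fun p => a (max p.1 p.2) l * b (min p.1 p.2) l with hK
  have hKc : Continuous K :=
    (hac.comp (continuous_fst.max continuous_snd)).mul (hbc.comp (continuous_fst.min continuous_snd))
  have hiK := hf.integrable_kernel hKc
  have hiK' := hf.integrable_kernel (hcc.comp hKc)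
  -- The kernel is symmetric in its two variables, so conjugating J amounts to conjugating the
  -- kernel alone.
  have hJ : conj (∫ p : ℝ × ℝ, conj (f p.1) * f p.2 * K p) =
      ∫ p : ℝ × ℝ, conj (f p.1) * f p.2 * conj (K p) := by
    rw [← integral_conj, Measure.volume_eq_prod, ← integral_prod_swap]
    refine integral_congr_ae (Eventually.of_forall fun p => ?_)
    simp only [hK, Prod.fst_swap, Prod.snd_swap, map_mul, Complex.conj_conj]
    rw [max_comm, min_comm]
    ring
  have hR : ∀ p : ℝ × ℝ, W * conj (K p) - conj W * K p =
      2 * Complex.I * (a p.1 l * conj (a p.2 l) + b p.1 l * conj (b p.2 l)) := by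
    intro p
    have h1 := hG (max p.1 p.2) (min p.1 p.2)
    simp only [hK, map_mul]
    rw [show W = a' 0 l * b 0 l - a 0 l * b' 0 l from rfl, h1]
    rcases le_total p.1 p.2 with h | h
    · rw [max_eq_right h, min_eq_left h, hS]
    · rw [max_eq_left h, min_eq_right h]
  have hfact : ∀ c : ℝ → ℂ, ∫ p : ℝ × ℝ, conj (f p.1) * f p.2 * (c p.1 * conj (c p.2)) =
      ((‖∫ x, conj (c x) * f x‖ ^ 2 : ℝ) : ℂ) := by
    intro c
    have h1 : ∀ p : ℝ × ℝ, conj (f p.1) * f p.2 * (c p.1 * conj (c p.2)) =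
        conj (conj (c p.1) * f p.1) * (conj (c p.2) * f p.2) := fun p => by
      simp only [map_mul, Complex.conj_conj]
      ring
    simp_rw [h1]
    rw [Measure.volume_eq_prod, integral_prod_mul (fun x => conj (conj (c x) * f x))
      (fun y => conj (c y) * f y), integral_conj, ← Complex.normSq_eq_conj_mul_self,
      Complex.normSq_eq_norm_sq]
  set J := ∫ p : ℝ × ℝ, conj (f p.1) * f p.2 * K p with hJdef
  have hN : jostN a b f l = -J := rfl
  have key : W * conj J - conj W * J = 2 * Complex.I *
      (((‖∫ x, conj (a x l) * f x‖ ^ 2 + ‖∫ x, conj (b x l) * f x‖ ^ 2 : ℝ)) : ℂ) := by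
    rw [hJ, hJdef, ← integral_const_mul, ← integral_const_mul]
    have i1 : Integrable fun p : ℝ × ℝ => W * (conj (f p.1) * f p.2 * conj (K p)) := hiK'.const_mul W
    have i2 : Integrable fun p : ℝ × ℝ => conj W * (conj (f p.1) * f p.2 * K p) := hiK.const_mul _
    rw [← integral_sub i1 i2]
    have h2 : ∀ p : ℝ × ℝ, W * (conj (f p.1) * f p.2 * conj (K p)) -
        conj W * (conj (f p.1) * f p.2 * K p) =
        2 * Complex.I * (conj (f p.1) * f p.2 * (a p.1 l * conj (a p.2 l)) +
          conj (f p.1) * f p.2 * (b p.1 l * conj (b p.2 l))) := fun p => by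
      linear_combination (conj (f p.1) * f p.2) * hR p
    simp_rw [h2]
    have i3 : Integrable fun p : ℝ × ℝ => conj (f p.1) * f p.2 * (a p.1 l * conj (a p.2 l)) :=
      hf.integrable_kernel ((hac.comp continuous_fst).mul (hcc.comp (hac.comp continuous_snd)))
    have i4 : Integrable fun p : ℝ × ℝ => conj (f p.1) * f p.2 * (b p.1 l * conj (b p.2 l)) :=
      hf.integrable_kernel ((hbc.comp continuous_fst).mul (hcc.comp (hbc.comp continuous_snd)))
    rw [integral_const_mul, integral_add i3 i4, hfact (fun x => a x l), hfact (fun x => b x l)]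
    push_cast
    ring
  rw [hN, Complex.div_im, Complex.normSq_eq_norm_sq]
  have h3 := congrArg Complex.im key
  simp only [Complex.sub_im, Complex.mul_im, Complex.conj_im, Complex.conj_re, Complex.re_ofNat,
    Complex.im_ofNat, Complex.I_re, Complex.I_im, Complex.ofReal_re, Complex.ofReal_im,
    Complex.mul_re] at h3
  have hn : ‖W‖ ^ 2 ≠ 0 := pow_ne_zero 2 (norm_ne_zero_iff.2 hW0)
  simp only [Complex.neg_re, Complex.neg_im]
  field_simp
  linarith

/-! ### Parseval's identity for test functions -/

theorem integrable_of_halves {h : ℝ → ℝ} (h1 : IntegrableOn h (Set.Ioi 0))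
    (h2 : IntegrableOn (fun x => h (-x)) (Set.Ioi 0)) :
    Integrable h ∧ ∫ x, h x = (∫ x in Set.Ioi (0 : ℝ), h x) + ∫ x in Set.Ioi (0 : ℝ), h (-x) := by
  have h3 : IntegrableOn h (Set.Iic 0) := by
    rw [integrableOn_Iic_iff_integrableOn_Iio]
    have := (Measure.measurePreserving_neg (volume : Measure ℝ)).integrableOn_comp_preimage
      (Homeomorph.neg ℝ).measurableEmbedding (f := h) (s := Set.Iio 0)
    simpa [Function.comp_def] using this.1 (by simpa [Function.comp_def] using h2)
  have h4 := h3.union h1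
  rw [Set.Iic_union_Ioi, integrableOn_univ] at h4
  refine ⟨h4, ?_⟩
  rw [← intervalIntegral.integral_Iic_add_Ioi h3 h1, add_comm, integral_comp_neg_Ioi, neg_zero]

/-- The eigenfunctions of negative energy, normalized as residues of the resolvent form. -/
structure IsBoundStates (V : ℝ → ℝ) (φ : ℝ → ℝ → ℂ) : Prop where
  sol : ∀ l : ℝ, l < 0 → ∃ φ', IsResolvent V l (fun _ => 0) (φ l) φ'
  eq_zero : ∀ l : ℝ, 0 ≤ l → φ l = fun _ => 0
  pole : ∀ l : ℝ, l < 0 → ∀ f, IsTest f → Tendsto (fun z : ℂ => (resolventForm V f z +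
    ((‖∫ x, conj (φ l x) * f x‖ ^ 2 : ℝ) : ℂ) / (z - l)).im) (𝓝[{z | 0 < z.im}] (l : ℂ)) (𝓝 0)
  isolated : ∀ l < 0, ∀ᶠ x in 𝓝[≠] l, φ x = fun _ => 0

theorem exists_isBoundStates {V : ℝ → ℝ} {μ : ℝ} (hμ0 : 0 < μ) (hμ : μ < 2) (hV : IsSymbol (-μ) V) :
    ∃ φ, IsBoundStates V φ := by
  have hex : ∀ l : ℝ, ∃ φ : ℝ → ℂ, (0 ≤ l → φ = fun _ => 0) ∧
      (l < 0 → (∃ φ', IsResolvent V l (fun _ => 0) φ φ') ∧ ∀ f, IsTest f →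
        Tendsto (fun z : ℂ => (resolventForm V f z +
          ((‖∫ x, conj (φ x) * f x‖ ^ 2 : ℝ) : ℂ) / (z - l)).im) (𝓝[{z | 0 < z.im}] (l : ℂ)) (𝓝 0)) := by
    intro l
    rcases le_or_gt 0 l with hl | hl
    · exact ⟨fun _ => 0, fun _ => rfl, fun h => absurd h (not_lt.2 hl)⟩
    · obtain ⟨φ, φ', h1, h2⟩ := exists_atom hμ0 hμ hV hl
      exact ⟨φ, fun h => absurd h (not_le.2 hl), fun _ => ⟨⟨φ', h1⟩, h2⟩⟩
  choose φ h0 h1 using hex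
  refine ⟨φ, fun l hl => (h1 l hl).1, h0, fun l hl => (h1 l hl).2, fun l hl => ?_⟩
  filter_upwards [eventually_not_eigenvalue hμ0 hμ hV hl,
    (gt_mem_nhds hl).filter_mono nhdsWithin_le_nhds] with x hx hx0
  obtain ⟨φ', hφ⟩ := (h1 x hx0).1
  exact funext (hx _ _ hφ)

/-- The negative axis is exhausted by the compact intervals [-(n+1), -1/(n+1)], each containing
finitely many eigenvalues. -/
theorem IsBoundStates.countable {V : ℝ → ℝ} {φ : ℝ → ℝ → ℂ} (h : IsBoundStates V φ) :
    {l : ℝ | φ l ≠ fun _ => 0}.Countable := by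
  have h1 : ∀ n : ℕ, {l : ℝ | l ∈ Set.Icc (-(n + 1 : ℝ)) (-(n + 1 : ℝ)⁻¹) ∧ φ l ≠ fun _ => 0}.Finite :=
    fun n => finite_of_isolated fun l hl => (h.isolated l (hl.2.trans_lt (by
      rw [neg_lt_zero]
      positivity))).mono fun _ h => not_not.2 h
  refine (Set.countable_iUnion fun n => (h1 n).countable).mono fun l hl => ?_
  have hl0 : l < 0 := by
    by_contra hc
    exact hl (h.eq_zero l (not_lt.1 hc))
  obtain ⟨n, hn⟩ := exists_nat_ge (max (-l) (-l)⁻¹)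
  refine Set.mem_iUnion.2 ⟨n, ⟨?_, ?_⟩, hl⟩
  · linarith [(le_max_left (-l) (-l)⁻¹).trans hn]
  · have h2 : (-l)⁻¹ ≤ n + 1 := ((le_max_right (-l) (-l)⁻¹).trans hn).trans (by linarith)
    have h3 := inv_anti₀ (inv_pos.2 (neg_pos.2 hl0)) h2
    rw [inv_inv] at h3
    linarith

/-- A pair of Jost solutions on the closed quadrant with the fluxes of outgoing waves. -/
structure IsScatteringPair (V : ℝ → ℝ) (a a' b b' : ℝ → ℂ → ℂ) : Prop where
  pair : IsJostPair V closedQuadrant a a' b b'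
  fluxA : ∀ l : ℝ, 0 ≤ l → ∀ x, a' x l * conj (a x l) - a x l * conj (a' x l) = 2 * Complex.I
  fluxB : ∀ l : ℝ, 0 ≤ l → ∀ x, b' x l * conj (b x l) - b x l * conj (b' x l) = -(2 * Complex.I)

theorem ofReal_mem_closedQuadrant {l : ℝ} (hl : 0 ≤ l) : (l : ℂ) ∈ closedQuadrant := by
  simpa [closedQuadrant] using hl

theorem isScatteringPair_of_families {V Qp Qm : ℝ → ℝ} {u u' v v' : ℝ → ℂ → ℂ}
    (hu : IsWKBFamily V Qp closedQuadrant u u') (hud : IsDecaying closedQuadrant u u')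
    (hQp : ∀ x, Qp x < 0) (hv : IsWKBFamily (fun x => V (-x)) Qm closedQuadrant v v')
    (hvd : IsDecaying closedQuadrant v v') (hQm : ∀ x, Qm x < 0) :
    IsScatteringPair V u u' (fun x z => v (-x) z) (fun x z => -v' (-x) z) where
  pair := isJostPair_of_families hu hud hv hvd
  fluxA l hl x := hu.flux (ofReal_mem_closedQuadrant hl) (fun x => (hQp x).trans_le hl) x
  fluxB l hl x := by
    have := hv.flux (ofReal_mem_closedQuadrant hl) (fun x => (hQm x).trans_le hl) (-x)
    simp only [map_neg]
    linear_combination -this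

/-- The distorted plane waves, up to a phase. -/
noncomputable def distortedWave (a a' b b' : ℝ → ℂ → ℂ) (k x : ℝ) : ℂ :=
  2 * Real.sqrt |k| / jostW a a' b b' (k ^ 2 : ℝ) *
    (if 0 < k then a x (k ^ 2 : ℝ) else b x (k ^ 2 : ℝ))

namespace IsScatteringPair

variable {V : ℝ → ℝ} {a a' b b' : ℝ → ℂ → ℂ} {f : ℝ → ℂ} {φ : ℝ → ℝ → ℂ}

theorem two_le_norm_jostW (h : IsScatteringPair V a a' b b') {l : ℝ} (hl : 0 ≤ l) :
    2 ≤ ‖jostW a a' b b' l‖ :=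
  two_le_norm_wronskian (h.fluxA l hl 0) (h.fluxB l hl 0)

theorem jostW_ne_zero (h : IsScatteringPair V a a' b b') {l : ℝ} (hl : 0 ≤ l) :
    jostW a a' b b' l ≠ 0 :=
  norm_pos_iff.1 (two_pos.trans_le (h.two_le_norm_jostW hl))

theorem im_form (h : IsScatteringPair V a a' b b') (hf : IsTest f) {l : ℝ} (hl : 0 ≤ l) :
    (jostN a b f l / jostW a a' b b' l).im = (‖jostW a a' b b' l‖ ^ 2)⁻¹ *
      (‖∫ x, conj (a x l) * f x‖ ^ 2 + ‖∫ x, conj (b x l) * f x‖ ^ 2) :=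
  im_jostN_div hf (h.pair.solA _ (ofReal_mem_closedQuadrant hl))
    (h.pair.solB _ (ofReal_mem_closedQuadrant hl)) (h.fluxA l hl) (h.fluxB l hl)

/-- On the right, N / W is continuous on the closed quadrant because W does not vanish on [0, ∞); on
the left, the masses are the residues built into `IsBoundStates`. -/
theorem hasBoundaryValues (h : IsScatteringPair V a a' b b') (hV : ∃ M, ∀ x, |V x| ≤ M)
    (hφ : IsBoundStates V φ) (hf : IsTest f) :
    HasBoundaryValues (resolventForm V f) (fun l => ‖∫ x, conj (φ l x) * f x‖ ^ 2)
      (fun l => (jostN a b f l / jostW a a' b b' l).im) where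
  nonneg l := by positivity
  eq_zero l hl := by simp [hφ.eq_zero l hl]
  isolated l hl := by
    filter_upwards [hφ.isolated l hl] with x hx
    simp [hx]
  left l hl := hφ.pole l hl f hf
  continuousOn := by
    refine Complex.continuous_im.comp_continuousOn (ContinuousOn.div ?_ ?_ fun l hl =>
      h.jostW_ne_zero hl)
    · exact (h.pair.continuousOn_jostN hf).comp Complex.continuous_ofReal.continuousOn
        fun l hl => ofReal_mem_closedQuadrant hl
    · exact h.pair.continuousOn_jostW.comp Complex.continuous_ofReal.continuousOn
        fun l hl => ofReal_mem_closedQuadrant hl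
  right l hl := by
    have hm := ofReal_mem_closedQuadrant hl
    have h1 : ContinuousWithinAt (fun z => (jostN a b f z / jostW a a' b b' z).im) closedQuadrant
        (l : ℂ) := Complex.continuous_im.continuousAt.comp_continuousWithinAt
      (((h.pair.continuousOn_jostN hf) _ hm).div (h.pair.continuousOn_jostW _ hm) (h.jostW_ne_zero hl))
    refine (h1.tendsto.mono_left (nhdsWithin_mono _ fun z hz => ⟨hz.1, le_of_lt hz.2⟩)).congr' ?_
    filter_upwards [self_mem_nhdsWithin] with z hz
    rw [h.pair.resolventForm_eq hV hf ⟨hz.1, le_of_lt hz.2⟩ (ne_of_gt hz.2)]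

theorem norm_integral_distortedWave (f : ℝ → ℂ) (k : ℝ) :
    ‖∫ x, conj (distortedWave a a' b b' k x) * f x‖ ^ 2 =
      4 * |k| * (‖jostW a a' b b' (k ^ 2 : ℝ)‖ ^ 2)⁻¹ *
        ‖∫ x, conj (if 0 < k then a x (k ^ 2 : ℝ) else b x (k ^ 2 : ℝ)) * f x‖ ^ 2 := by
  simp only [distortedWave, map_mul, mul_assoc]
  rw [integral_const_mul, norm_mul, mul_pow, Complex.norm_conj, norm_div, norm_mul, Complex.norm_real,
    Real.norm_of_nonneg (Real.sqrt_nonneg _), div_pow, mul_pow, Real.sq_sqrt (abs_nonneg k)]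
  norm_num
  ring

theorem continuous_distortedWave (h : IsScatteringPair V a a' b b') (k : ℝ) :
    Continuous (distortedWave a a' b b' k) := by
  have hm := ofReal_mem_closedQuadrant (sq_nonneg k)
  unfold distortedWave
  refine continuous_const.mul ?_
  split_ifs
  · exact (h.pair.solA _ hm).continuous
  · exact (h.pair.solB _ hm).continuous

theorem aestronglyMeasurable_distortedWave (h : IsScatteringPair V a a' b b') (hf : IsTest f) :
    AEStronglyMeasurable fun k => ∫ x, conj (distortedWave a a' b b' k x) * f x := by
  have hsq : Continuous fun k : ℝ => (((k ^ 2 : ℝ)) : ℂ) := by fun_prop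
  have hmem : ∀ k : ℝ, (((k ^ 2 : ℝ)) : ℂ) ∈ closedQuadrant :=
    fun k => ofReal_mem_closedQuadrant (sq_nonneg k)
  have hW : Continuous fun k : ℝ => jostW a a' b b' (k ^ 2 : ℝ) :=
    h.pair.continuousOn_jostW.comp_continuous hsq hmem
  have hint : ∀ c : ℝ → ℂ → ℂ, ContinuousOn (fun p : ℝ × ℂ => c p.1 p.2) (Set.univ ×ˢ closedQuadrant) →
      Continuous fun k : ℝ => ∫ x, conj (c x (k ^ 2 : ℝ)) * f x := by
    intro c hc
    have h1 : Continuous fun q : ℝ × ℝ => c q.2 (q.1 ^ 2 : ℝ) :=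
      hc.comp_continuous (f := fun q : ℝ × ℝ => (q.2, ((q.1 ^ 2 : ℝ) : ℂ)))
        (continuous_snd.prodMk (hsq.comp continuous_fst)) fun q => ⟨trivial, hmem _⟩
    have h2 : Continuous fun q : ℝ × ℝ => conj (c q.2 (q.1 ^ 2 : ℝ)) * f q.2 :=
      (Complex.continuous_conj.comp h1).mul (hf.continuous.comp continuous_snd)
    rw [← continuousOn_univ]
    exact continuousOn_integral_of_compact_support hf.2.isCompact h2.continuousOn
      fun k x _ hx => by simp [image_eq_zero_of_notMem_tsupport hx]
  have hcoef : Continuous fun k : ℝ => conj (2 * Real.sqrt |k| / jostW a a' b b' (k ^ 2 : ℝ)) := by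
    refine Complex.continuous_conj.comp (Continuous.div (by fun_prop) hW fun k =>
      h.jostW_ne_zero (sq_nonneg k))
  have e : (fun k => ∫ x, conj (distortedWave a a' b b' k x) * f x) = fun k =>
      conj (2 * Real.sqrt |k| / jostW a a' b b' (k ^ 2 : ℝ)) *
        (if 0 < k then ∫ x, conj (a x (k ^ 2 : ℝ)) * f x else ∫ x, conj (b x (k ^ 2 : ℝ)) * f x) := by
    funext k
    simp only [distortedWave, map_mul, mul_assoc]
    rw [integral_const_mul]
    split_ifs <;> rfl
  rw [e]
  exact (hcoef.stronglyMeasurable.mul (StronglyMeasurable.ite measurableSet_Ioi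
    (hint a h.pair.contA).stronglyMeasurable (hint b h.pair.contB).stronglyMeasurable)).aestronglyMeasurable

/-- This is `HasBoundaryValues.total_mass` for the resolvent form after the substitution l = k². The
a-part of the density becomes the integral over k > 0 and the b-part the one over k < 0. -/
theorem parseval_test (h : IsScatteringPair V a a' b b') {μ : ℝ} (hμ0 : 0 < μ) (hμ : μ < 2)
    (hV : IsSymbol (-μ) V) (hφ : IsBoundStates V φ) (hf : IsTest f) :
    Summable (fun l => ‖∫ x, conj (φ l x) * f x‖ ^ 2) ∧
      Integrable (fun k => ‖∫ x, conj (distortedWave a a' b b' k x) * f x‖ ^ 2) ∧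
      (∑' l, ‖∫ x, conj (φ l x) * f x‖ ^ 2) + (2 * Real.pi)⁻¹ *
        ∫ k, ‖∫ x, conj (distortedWave a a' b b' k x) * f x‖ ^ 2 = ∫ x, ‖f x‖ ^ 2 := by
  obtain ⟨h1, h2, h3⟩ := (h.hasBoundaryValues (hV.bounded hμ0) hφ hf).total_mass
    (isHerglotz_resolventForm hμ0 hμ hV hf)
  set ρ : ℝ → ℝ := fun l => (jostN a b f l / jostW a a' b b' l).im with hρ
  set G : ℝ → ℝ := fun k => ‖∫ x, conj (distortedWave a a' b b' k x) * f x‖ ^ 2 with hG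
  have hGm : AEStronglyMeasurable G := (h.aestronglyMeasurable_distortedWave hf).norm.pow 2
  -- The factor 2√|k| / W of the waves squares to 4|k| / |W|², twice the Jacobian 2k of l = k². The
  -- right side is written in the shape of the power substitution formula.
  have hsum : ∀ k : ℝ, 0 < k → G k + G (-k) = 2 * (|(2 : ℝ)| * k ^ ((2 : ℝ) - 1)) • ρ (k ^ (2 : ℝ)) := by
    intro k hk
    simp only [hG, norm_integral_distortedWave, if_pos hk, if_neg (show ¬ 0 < -k by linarith), neg_sq,
      abs_neg, abs_of_pos hk, Real.rpow_two, hρ, h.im_form hf (sq_nonneg k), smul_eq_mul]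
    rw [show (2 : ℝ) - 1 = 1 by norm_num, Real.rpow_one, abs_of_pos two_pos]
    ring
  have hi : IntegrableOn (fun k => G k + G (-k)) (Set.Ioi 0) := by
    refine IntegrableOn.congr_fun (((integrableOn_Ioi_comp_rpow_iff ρ two_ne_zero).2 h2).const_mul 2)
      (fun k hk => ?_) measurableSet_Ioi
    rw [hsum k hk, smul_eq_mul]
  have hG0 : ∀ k, 0 ≤ G k := fun k => by positivity
  have hGm' : AEStronglyMeasurable fun k => G (-k) :=
    hGm.comp_measurePreserving (Measure.measurePreserving_neg volume)
  have hi1 : IntegrableOn G (Set.Ioi 0) := hi.mono' hGm.restrict (Eventually.of_forall fun k => by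
    rw [Real.norm_of_nonneg (hG0 k)]
    linarith [hG0 (-k)])
  have hi2 : IntegrableOn (fun k => G (-k)) (Set.Ioi 0) :=
    hi.mono' hGm'.restrict (Eventually.of_forall fun k => by
      rw [Real.norm_of_nonneg (hG0 (-k))]
      linarith [hG0 k])
  obtain ⟨h4, h5⟩ := integrable_of_halves hi1 hi2
  refine ⟨h1, h4, ?_⟩
  have h6 : ∫ k, G k = 2 * ∫ l in Set.Ioi (0 : ℝ), ρ l := by
    rw [h5, ← integral_add hi1 hi2, setIntegral_congr_fun measurableSet_Ioi fun k hk => hsum k hk,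
      ← integral_comp_rpow_Ioi ρ two_ne_zero, ← integral_const_mul]
  rw [h6]
  have hpi := Real.pi_ne_zero
  field_simp
  linarith

end IsScatteringPair

/-! ### Extension of Parseval's identity by density -/

theorem eLpNorm_two_eq {α : Type*} [MeasurableSpace α] {ν : Measure α} {F : α → ℂ} (hF : MemLp F 2 ν) :
    eLpNorm F 2 ν = ENNReal.ofReal (Real.sqrt (∫ a, ‖F a‖ ^ 2 ∂ν)) := by
  rw [hF.eLpNorm_eq_integral_rpow_norm two_ne_zero ENNReal.ofNat_ne_top, ENNReal.toReal_ofNat,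
    Real.sqrt_eq_rpow]
  simp only [Real.rpow_two, one_div]

theorem SchwartzMap.integrable_norm_sq (f : 𝓢(ℝ, ℂ)) : Integrable fun x => ‖f x‖ ^ 2 :=
  (memLp_two_iff_integrable_sq_norm f.continuous.aestronglyMeasurable).1 (f.memLp 2 volume)

/-- Test functions are dense in the Schwartz space. -/
theorem exists_test_approximation (f : 𝓢(ℝ, ℂ)) : ∃ F : ℕ → ℝ → ℂ, (∀ n, IsTest (F n)) ∧
    (∀ n x, ‖F n x‖ ≤ ‖f x‖) ∧ (∀ x, Tendsto (fun n => F n x) atTop (𝓝 (f x))) ∧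
    Tendsto (fun n => eLpNorm (F n - ⇑f) 2 volume) atTop (𝓝 0) := by
  obtain ⟨χ, hχ, hχs, hχ0, hχle, hχ1⟩ := exists_smooth_cutoff one_pos
  let F : ℕ → ℝ → ℂ := fun n x => (χ (x / (n + 1)) : ℂ) * f x
  have hpos : ∀ n : ℕ, (0 : ℝ) < n + 1 := fun n => by positivity
  have hF : ∀ n, IsTest (F n) := by
    intro n
    refine ⟨(Complex.ofRealCLM.contDiff.comp (hχ.comp (contDiff_id.div_const _))).mul
      (f.smooth ⊤), ?_⟩
    have h1 : HasCompactSupport fun x : ℝ => χ (x / (n + 1)) :=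
      by
      simp_rw [div_eq_mul_inv]
      exact hχs.comp_homeomorph (Homeomorph.mulRight₀ (n + 1 : ℝ)⁻¹ (inv_ne_zero (hpos n).ne'))
    exact (h1.comp_left (g := fun r : ℝ => (r : ℂ)) Complex.ofReal_zero).mul_right
  have hle : ∀ n x, ‖F n x‖ ≤ ‖f x‖ := by
    intro n x
    simp only [F, norm_mul, Complex.norm_real, Real.norm_of_nonneg (hχ0 _)]
    exact mul_le_of_le_one_left (norm_nonneg _) (hχle _)
  have hlim : ∀ x, Tendsto (fun n => F n x) atTop (𝓝 (f x)) := by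
    intro x
    refine tendsto_const_nhds.congr' ?_
    filter_upwards [eventually_ge_atTop ⌈|x|⌉₊] with n hn
    have h1 : |x| ≤ n + 1 := (Nat.ceil_le.1 hn).trans (by linarith)
    have h2 : χ (x / (n + 1)) = 1 := hχ1 _ (by
      rw [abs_div, abs_of_pos (hpos n), div_le_one (hpos n)]
      exact h1)
    simp [F, h2]
  refine ⟨F, hF, hle, hlim, ?_⟩
  have hm : ∀ n, MemLp (F n - ⇑f) 2 volume := by
    intro n
    refine MemLp.sub ?_ (f.memLp 2 volume)
    exact (memLp_two_iff_integrable_sq_norm (hF n).continuous.aestronglyMeasurable).2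
      (hF n).integrable_sq
  simp_rw [fun n => eLpNorm_two_eq (hm n)]
  have h0 : Tendsto (fun n => ∫ x, ‖(F n - ⇑f) x‖ ^ 2) atTop (𝓝 (∫ _x : ℝ, (0 : ℝ))) := by
    refine tendsto_integral_of_dominated_convergence (fun x => 4 * ‖f x‖ ^ 2) (fun n => ?_)
      (f.integrable_norm_sq.const_mul 4) (fun n => Eventually.of_forall fun x => ?_)
      (Eventually.of_forall fun x => ?_)
    · exact (((hF n).continuous.sub f.continuous).norm.pow 2).aestronglyMeasurable
    · rw [Real.norm_of_nonneg (by positivity), Pi.sub_apply]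
      have h1 := norm_sub_le (F n x) (f x)
      have h2 := hle n x
      nlinarith [norm_nonneg (F n x - f x), norm_nonneg (f x)]
    · have h1 := (((hlim x).sub_const (f x)).norm).pow 2
      simpa using h1
  rw [integral_zero] at h0
  have h1 := (ENNReal.continuous_ofReal.tendsto _).comp ((Real.continuous_sqrt.tendsto _).comp h0)
  simpa [Function.comp_def] using h1

section Extension

variable {J : Type*} {X : J → ℝ → ℂ}

/-- The generalized Fourier transform of `f` with kernel `X`. -/
noncomputable def kernelTransform (X : J → ℝ → ℂ) (f : ℝ → ℂ) (j : J) : ℂ := ∫ x, conj (X j x) * f x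

theorem integrable_kernelTransform (hX : ∀ j, Continuous (X j) ∧ ∃ C, ∀ x, ‖X j x‖ ≤ C) {f : ℝ → ℂ}
    (hf : Integrable f) (j : J) : Integrable fun x => conj (X j x) * f x := by
  obtain ⟨hc, C, hC⟩ := hX j
  exact hf.bdd_mul (c := C) (Complex.continuous_conj.comp hc).aestronglyMeasurable
    (Eventually.of_forall fun x => by rw [Complex.norm_conj]; exact hC x)

variable [MeasurableSpace J] {ν : Measure J}

/-- The kernels are bounded for each index, so transforms of the truncations converge pointwise;
Fatou's lemma for L² norms upgrades this to L² convergence, and the isometry passes to the limit. -/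
theorem kernelTransform_memLp (hX : ∀ j, Continuous (X j) ∧ ∃ C, ∀ x, ‖X j x‖ ≤ C)
    (hm : ∀ f, IsTest f → AEStronglyMeasurable (kernelTransform X f) ν)
    (hp : ∀ f, IsTest f → eLpNorm (kernelTransform X f) 2 ν = eLpNorm f 2 volume) (f : 𝓢(ℝ, ℂ)) :
    MemLp (kernelTransform X f) 2 ν ∧ eLpNorm (kernelTransform X f) 2 ν = eLpNorm f 2 volume := by
  obtain ⟨F, hF, hle, hlim, hnorm⟩ := exists_test_approximation f
  have hFi : ∀ n, Integrable (F n) := fun n =>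
    (hF n).continuous.integrable_of_hasCompactSupport (hF n).2
  have hfi : Integrable f := f.integrable
  have hTlim : ∀ j, Tendsto (fun n => kernelTransform X (F n) j) atTop (𝓝 (kernelTransform X f j)) := by
    intro j
    obtain ⟨hc, C, hC⟩ := hX j
    refine tendsto_integral_of_dominated_convergence (fun x => C * ‖f x‖)
      (fun n => (integrable_kernelTransform hX (hFi n) j).aestronglyMeasurable)
      (hfi.norm.const_mul C) (fun n => Eventually.of_forall fun x => ?_)
      (Eventually.of_forall fun x => (hlim x).const_mul _)
    rw [norm_mul, Complex.norm_conj]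
    exact mul_le_mul (hC x) (hle n x) (norm_nonneg _) ((norm_nonneg _).trans (hC x))
  have hTm : AEStronglyMeasurable (kernelTransform X f) ν :=
    aestronglyMeasurable_of_tendsto_ae atTop (fun n => hm _ (hF n)) (Eventually.of_forall hTlim)
  have hsub : ∀ n m, kernelTransform X (F n - F m) =
      kernelTransform X (F n) - kernelTransform X (F m) := by
    intro n m
    funext j
    have := integral_sub (integrable_kernelTransform hX (hFi n) j)
      (integrable_kernelTransform hX (hFi m) j)
    simp only [Pi.sub_apply, kernelTransform, mul_sub]
    exact this
  have htest : ∀ n m, IsTest (F n - F m) := fun n m => ⟨(hF n).1.sub (hF m).1, (hF n).2.sub (hF m).2⟩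
  have hd : ∀ n, eLpNorm (kernelTransform X (F n) - kernelTransform X f) 2 ν ≤
      eLpNorm (F n - ⇑f) 2 volume := by
    intro n
    have h1 : ∀ j, Tendsto (fun m => (kernelTransform X (F n) - kernelTransform X (F m)) j) atTop
        (𝓝 ((kernelTransform X (F n) - kernelTransform X f) j)) := fun j => (hTlim j).const_sub _
    -- Fatou in the second index; differences of test functions are test functions, so the isometry
    -- applies to them.
    refine (Lp.eLpNorm_lim_le_liminf_eLpNorm (fun m => (hm _ (hF n)).sub (hm _ (hF m))) _
      (Eventually.of_forall h1)).trans ?_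
    have h2 : Tendsto (fun m => eLpNorm (F n - ⇑f) 2 volume + eLpNorm (F m - ⇑f) 2 volume) atTop
        (𝓝 (eLpNorm (F n - ⇑f) 2 volume)) := by
      simpa using hnorm.const_add (eLpNorm (F n - ⇑f) 2 volume)
    rw [← h2.liminf_eq]
    refine liminf_le_liminf (Eventually.of_forall fun m => ?_)
    rw [← hsub, hp _ (htest n m), show F n - F m = (F n - ⇑f) - (F m - ⇑f) by simp]
    exact eLpNorm_sub_le ((hF n).continuous.sub f.continuous).aestronglyMeasurable
      ((hF m).continuous.sub f.continuous).aestronglyMeasurable (by norm_num)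
  have hd0 : Tendsto (fun n => eLpNorm (kernelTransform X (F n) - kernelTransform X f) 2 ν) atTop
      (𝓝 0) := tendsto_of_tendsto_of_tendsto_of_le_of_le tendsto_const_nhds hnorm (fun _ => zero_le)
    hd
  have heq : eLpNorm (kernelTransform X f) 2 ν = eLpNorm f 2 volume := by
    refine le_antisymm ?_ ?_
    · have h1 : Tendsto (fun n => eLpNorm f 2 volume +
          eLpNorm (kernelTransform X (F n) - kernelTransform X f) 2 ν) atTop
          (𝓝 (eLpNorm f 2 volume)) := by
        simpa using hd0.const_add (eLpNorm f 2 volume)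
      refine ge_of_tendsto' h1 fun n => ?_
      have h2 := eLpNorm_sub_le (p := 2) (hm _ (hF n)) ((hm _ (hF n)).sub hTm) (by norm_num)
      rw [sub_sub_cancel, hp _ (hF n)] at h2
      exact h2.trans (add_le_add (eLpNorm_mono (hle n)) le_rfl)
    · have h1 : Tendsto (fun n => eLpNorm (kernelTransform X f) 2 ν +
          eLpNorm (kernelTransform X (F n) - kernelTransform X f) 2 ν + eLpNorm (F n - ⇑f) 2 volume) atTop
          (𝓝 (eLpNorm (kernelTransform X f) 2 ν)) := by
        simpa using (hd0.const_add (eLpNorm (kernelTransform X f) 2 ν)).add hnorm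
      refine ge_of_tendsto' h1 fun n => ?_
      have h2 := eLpNorm_sub_le (p := 2) (μ := volume) (hF n).continuous.aestronglyMeasurable
        ((hF n).continuous.sub f.continuous).aestronglyMeasurable (by norm_num)
      have h3 := eLpNorm_add_le (p := 2) hTm ((hm _ (hF n)).sub hTm) (by norm_num)
      rw [sub_sub_cancel, ← hp _ (hF n)] at h2
      rw [add_sub_cancel] at h3
      exact h2.trans (add_le_add h3 le_rfl)
  refine ⟨⟨hTm, ?_⟩, heq⟩
  rw [heq]
  exact (f.memLp 2 volume).2

/-- Polarized Parseval identity. -/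
theorem kernelTransform_inner (hX : ∀ j, Continuous (X j) ∧ ∃ C, ∀ x, ‖X j x‖ ≤ C)
    (hm : ∀ f, IsTest f → AEStronglyMeasurable (kernelTransform X f) ν)
    (hp : ∀ f, IsTest f → eLpNorm (kernelTransform X f) 2 ν = eLpNorm f 2 volume) (f g : 𝓢(ℝ, ℂ)) :
    Integrable (fun j => conj (kernelTransform X f j) * kernelTransform X g j) ν ∧
      ∫ j, conj (kernelTransform X f j) * kernelTransform X g j ∂ν = ∫ x, conj (f x) * g x := by
  have hT := kernelTransform_memLp hX hm hp
  let A : 𝓢(ℝ, ℂ) →ₗ[ℂ] Lp ℂ 2 ν :=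
    { toFun := fun f => (hT f).1.toLp
      map_add' := fun f g => by
        rw [← MemLp.toLp_add]
        refine MemLp.toLp_congr _ _ (Eventually.of_forall fun j => ?_)
        have := integral_add (integrable_kernelTransform hX f.integrable j)
          (integrable_kernelTransform hX g.integrable j)
        simp only [kernelTransform, Pi.add_apply, _root_.add_apply, mul_add]
        exact this
      map_smul' := fun c f => by
        rw [RingHom.id_apply, ← MemLp.toLp_const_smul]
        refine MemLp.toLp_congr _ _ (Eventually.of_forall fun j => ?_)
        simp only [kernelTransform, Pi.smul_apply, _root_.smul_apply, smul_eq_mul]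
        rw [← integral_const_mul]
        refine integral_congr_ae (Eventually.of_forall fun x => ?_)
        simp only
        ring }
  let B := SchwartzMap.toLpCLM ℂ ℂ 2 (volume : Measure ℝ)
  have hAB : ∀ h : 𝓢(ℝ, ℂ), ‖A h‖ = ‖B h‖ := by
    intro h
    show ‖(hT h).1.toLp‖ = ‖h.toLp 2 volume‖
    rw [Lp.norm_toLp, SchwartzMap.norm_toLp, (hT h).2]
  -- Polarization: two linear maps with equal norms have equal inner products.
  have hinner : inner ℂ (A f) (A g) = inner ℂ (B f) (B g) := by
    rw [inner_eq_sum_norm_sq_div_four, inner_eq_sum_norm_sq_div_four, ← map_add, ← map_sub, ← map_smul,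
      ← map_sub, ← map_add, ← map_add B, ← map_sub B, ← map_smul B, ← map_sub B, ← map_add B]
    simp only [hAB]
  have hAe : ∀ h : 𝓢(ℝ, ℂ), A h =ᵐ[ν] kernelTransform X h := fun h => (hT h).1.coeFn_toLp
  have hBe : ∀ h : 𝓢(ℝ, ℂ), B h =ᵐ[volume] h := fun h => h.coeFn_toLp 2 volume
  have e1 : (fun j => inner ℂ (A f j) (A g j)) =ᵐ[ν]
      fun j => conj (kernelTransform X f j) * kernelTransform X g j := by
    filter_upwards [hAe f, hAe g] with j h1 h2
    rw [h1, h2, RCLike.inner_apply, mul_comm]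
  have e2 : (fun x => inner ℂ (B f x) (B g x)) =ᵐ[volume] fun x => conj (f x) * g x := by
    filter_upwards [hBe f, hBe g] with j h1 h2
    rw [h1, h2, RCLike.inner_apply, mul_comm]
  refine ⟨(L2.integrable_inner (A f) (A g)).congr e1, ?_⟩
  rw [← integral_congr_ae e1, ← integral_congr_ae e2]
  exact hinner

end Extension

/-! ### Discrete and continuous spectrum in a single measure space -/

section SpectralMeasure

variable {I : Type*} [MeasurableSpace I]

/-- Counting measure on the discrete part, and `dk / 2π` on the continuous part. -/
noncomputable def spectralMeasure (I : Type*) [MeasurableSpace I] : Measure (I ⊕ ℝ) :=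
  Measure.map Sum.inl Measure.count +
    Measure.map Sum.inr (ENNReal.ofReal (2 * Real.pi)⁻¹ • (volume : Measure ℝ))

theorem measurableEmbedding_inl {α β : Type*} [MeasurableSpace α] [MeasurableSpace β] :
    MeasurableEmbedding (Sum.inl : α → α ⊕ β) :=
  ⟨Sum.inl_injective, measurable_inl, fun _ hs => measurableSet_inl_image.2 hs⟩

theorem measurableEmbedding_inr {α β : Type*} [MeasurableSpace α] [MeasurableSpace β] :
    MeasurableEmbedding (Sum.inr : β → α ⊕ β) :=
  ⟨Sum.inr_injective, measurable_inr, fun _ hs => measurableSet_inr_image.2 hs⟩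

theorem ofReal_inv_two_pi_ne_zero : ENNReal.ofReal (2 * Real.pi)⁻¹ ≠ 0 := by
  rw [Ne, ENNReal.ofReal_eq_zero, not_le]
  positivity

variable {E : Type*} [NormedAddCommGroup E]

theorem integrable_spectralMeasure_iff [MeasurableSingletonClass I] {F : I ⊕ ℝ → E} :
    Integrable F (spectralMeasure I) ↔
      (Summable fun i => ‖F (Sum.inl i)‖) ∧ Integrable fun k => F (Sum.inr k) := by
  rw [spectralMeasure, integrable_add_measure, measurableEmbedding_inl.integrable_map_iff,
    measurableEmbedding_inr.integrable_map_iff, integrable_count_iff,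
    integrable_smul_measure ofReal_inv_two_pi_ne_zero ENNReal.ofReal_ne_top]
  rfl

theorem integral_spectralMeasure [Countable I] [MeasurableSingletonClass I] [NormedSpace ℝ E]
    [CompleteSpace E] {F : I ⊕ ℝ → E} (hF : Integrable F (spectralMeasure I)) :
    ∫ j, F j ∂spectralMeasure I =
      (∑' i, F (Sum.inl i)) + (2 * Real.pi)⁻¹ • ∫ k, F (Sum.inr k) := by
  have h := hF
  rw [spectralMeasure, integrable_add_measure] at h
  have hc : Integrable (fun i => F (Sum.inl i)) (Measure.count : Measure I) :=
    measurableEmbedding_inl.integrable_map_iff.1 h.1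
  rw [spectralMeasure, integral_add_measure h.1 h.2, measurableEmbedding_inl.integral_map,
    measurableEmbedding_inr.integral_map, integral_smul_measure,
    integral_countable hc,
    ENNReal.toReal_ofReal (by positivity)]
  simp [measureReal_def]

/-- The polarized resolution of the identity on the Schwartz space follows from Parseval's identity
for test functions. -/
theorem resolution_of_parseval_test [Countable I] [MeasurableSingletonClass I] {φ : I → ℝ → ℂ}
    {Ψ : ℝ → ℝ → ℂ} (hφ : ∀ i, Continuous (φ i) ∧ ∃ C, ∀ x, ‖φ i x‖ ≤ C)
    (hΨ : ∀ k, Continuous (Ψ k) ∧ ∃ C, ∀ x, ‖Ψ k x‖ ≤ C)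
    (hm : ∀ f, IsTest f → AEStronglyMeasurable (kernelTransform Ψ f))
    (hp : ∀ f, IsTest f → (Summable fun i => ‖kernelTransform φ f i‖ ^ 2) ∧
      (Integrable fun k => ‖kernelTransform Ψ f k‖ ^ 2) ∧
      (∑' i, ‖kernelTransform φ f i‖ ^ 2) + (2 * Real.pi)⁻¹ * ∫ k, ‖kernelTransform Ψ f k‖ ^ 2 =
        ∫ x, ‖f x‖ ^ 2) (f g : 𝓢(ℝ, ℂ)) :
    (Summable fun i => conj (kernelTransform φ f i) * kernelTransform φ g i) ∧
      (Integrable fun k => conj (kernelTransform Ψ f k) * kernelTransform Ψ g k) ∧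
      (∑' i, conj (kernelTransform φ f i) * kernelTransform φ g i) +
        ((2 * Real.pi)⁻¹ : ℝ) * ∫ k, conj (kernelTransform Ψ f k) * kernelTransform Ψ g k =
          ∫ x, conj (f x) * g x := by
  -- Joining bound states and waves turns Parseval's identity into an isometry into a single L²
  -- space, as the density argument requires.
  let X : I ⊕ ℝ → ℝ → ℂ := Sum.elim φ Ψ
  have hX : ∀ j, Continuous (X j) ∧ ∃ C, ∀ x, ‖X j x‖ ≤ C := by
    rintro (i | k)
    · exact hφ i
    · exact hΨ k
  have hXm : ∀ f, IsTest f → AEStronglyMeasurable (kernelTransform X f) (spectralMeasure I) := by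
    intro f hf
    rw [spectralMeasure, aestronglyMeasurable_add_measure_iff,
      measurableEmbedding_inl.aestronglyMeasurable_map_iff,
      measurableEmbedding_inr.aestronglyMeasurable_map_iff]
    exact ⟨(measurable_of_countable _).aestronglyMeasurable, (hm f hf).smul_measure _⟩
  have hXp : ∀ f, IsTest f →
      eLpNorm (kernelTransform X f) 2 (spectralMeasure I) = eLpNorm f 2 volume := by
    intro f hf
    obtain ⟨h1, h2, h3⟩ := hp f hf
    have hi : Integrable (fun j => ‖kernelTransform X f j‖ ^ 2) (spectralMeasure I) :=
      integrable_spectralMeasure_iff.2 ⟨h1.norm, h2⟩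
    rw [eLpNorm_two_eq ((memLp_two_iff_integrable_sq_norm (hXm f hf)).2 hi),
      eLpNorm_two_eq ((memLp_two_iff_integrable_sq_norm hf.continuous.aestronglyMeasurable).2
        hf.integrable_sq), integral_spectralMeasure hi, ← h3]
    rfl
  obtain ⟨h4, h5⟩ := kernelTransform_inner hX hXm hXp f g
  have h6 := integrable_spectralMeasure_iff.1 h4
  refine ⟨h6.1.of_norm, h6.2, ?_⟩
  rw [integral_spectralMeasure h4, Complex.real_smul] at h5
  exact h5

end SpectralMeasure

/-! ### Quasiclassical solutions and reflection -/

/-- One of the two real roots always vanishes, because `Real.sqrt` is 0 on negative numbers. The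
single formula makes continuity across turning points evident. -/
theorem ofReal_cpow_half (r : ℝ) :
    ((r : ℝ) : ℂ) ^ (1 / 2 : ℂ) = Real.sqrt r + Complex.I * Real.sqrt (-r) := by
  have h0 : ∀ s : ℝ, 0 ≤ s → (s : ℂ) ^ (1 / 2 : ℂ) = Real.sqrt s := fun s hs => by
    rw [Real.sqrt_eq_rpow, Complex.ofReal_cpow hs]
    push_cast
    rfl
  rcases le_total 0 r with hr | hr
  · rw [h0 r hr, Real.sqrt_eq_zero_of_nonpos (by linarith : -r ≤ 0)]
    simp
  · have h1 : Complex.exp (Real.pi * Complex.I * (1 / 2)) = Complex.I := by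
      rw [show (Real.pi * Complex.I * (1 / 2) : ℂ) = ((Real.pi / 2 : ℝ) : ℂ) * Complex.I by
        push_cast
        ring, Complex.exp_mul_I, ← Complex.ofReal_cos, ← Complex.ofReal_sin, Real.cos_pi_div_two,
        Real.sin_pi_div_two]
      simp
    rw [Complex.ofReal_cpow_of_nonpos hr, h1, ← Complex.ofReal_neg, h0 _ (by linarith),
      Real.sqrt_eq_zero_of_nonpos hr]
    push_cast
    ring

theorem eikonal_of_pos (V : ℝ → ℝ) {k : ℝ} (hk : 0 < k) (x : ℝ) :
    eikonal V k x = Real.sqrt (V x - k ^ 2) - Complex.I * Real.sqrt (k ^ 2 - V x) := by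
  rw [eikonal, if_pos hk, ofReal_cpow_half, neg_sub]
  simp only [map_add, map_mul, Complex.conj_ofReal, Complex.conj_I]
  ring

theorem eikonal_re (V : ℝ → ℝ) {k : ℝ} (hk : 0 < k) (x : ℝ) :
    (eikonal V k x).re = Real.sqrt (V x - k ^ 2) := by
  rw [eikonal_of_pos V hk]
  simp

theorem continuous_eikonal {V : ℝ → ℝ} (hV : Continuous V) {k : ℝ} (hk : 0 < k) :
    Continuous (eikonal V k) := by
  rw [show eikonal V k = _ from funext (eikonal_of_pos V hk)]
  fun_prop

theorem eikonal_eq_wkbRoot {V Q : ℝ → ℝ} {k x : ℝ} (hk : 0 < k) (hVQ : V x = Q x) (hQ : Q x < 0) :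
    eikonal V k x = wkbRoot Q x (k ^ 2 : ℝ) := by
  have hlt : Q x < k ^ 2 := hQ.trans (by positivity)
  rw [wkbRoot_ofReal hlt, eikonal_of_pos V hk, hVQ, Real.sqrt_eq_zero_of_nonpos (by linarith)]
  simp

theorem phase_re {V : ℝ → ℝ} (hV : Continuous V) {k : ℝ} (hk : 0 < k) (x : ℝ) :
    (phase V k x).re = ∫ y in (0 : ℝ)..x, (eikonal V k y).re := by
  have := Complex.reCLM.intervalIntegral_comp_comm (μ := volume)
    ((continuous_eikonal hV hk).intervalIntegrable 0 x)
  rw [phase]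
  simpa using this.symm

theorem IsSol.isSolution {V : ℝ → ℝ} (hV : Continuous V) {l : ℝ} {u u' : ℝ → ℂ} (h : IsSol V l u u') :
    IsSolution V l u := by
  have h1 : deriv u = u' := funext fun x => (h.hasDerivAt x).deriv
  have h2 : deriv u' = fun x => (V x - l) * u x := funext fun x => (h.hasDerivAt' x).deriv
  refine ⟨?_, fun x => ?_⟩
  · rw [show (2 : WithTop ℕ∞) = 1 + 1 by norm_num, contDiff_succ_iff_deriv]
    refine ⟨fun x => (h.hasDerivAt x).differentiableAt, by simp, ?_⟩
    rw [h1, contDiff_one_iff_deriv, h2]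
    refine ⟨fun x => (h.hasDerivAt' x).differentiableAt, ?_⟩
    exact ((Complex.continuous_ofReal.comp hV).sub continuous_const).mul h.continuous
  · rw [h1, h2]
    ring

/-- The quasiclassical solutions at `+∞`, normalized at the origin of the phase. -/
theorem exists_quasiclassicalPlus {V B : ℝ → ℝ} {u u' : ℝ → ℂ → ℂ} (hV : Continuous V)
    (hB : HasCompactSupport B) (hBc : Continuous B) (hQ : ∀ x, V x + B x < 0)
    (hu : IsWKBFamily V (fun x => V x + B x) closedQuadrant u u') {k : ℝ} (hk : 0 < k) :
    ∃ (η : ℝ → ℂ) (p : ℂ), ‖p‖ = 1 ∧ IsQuasiclassicalPlus V k η ∧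
      ∀ x, jostPlus V k η x = p * Real.sqrt k * u x (k ^ 2 : ℝ) := by
  have hz := ofReal_mem_closedQuadrant (sq_nonneg k)
  set Q : ℝ → ℝ := fun x => V x + B x with hQdef
  obtain ⟨L, hL0, hL⟩ : ∃ L : ℝ, 0 < L ∧ ∀ x, L ≤ x → B x = 0 := by
    obtain ⟨L, hL⟩ := hB.isBounded.subset_ball 0
    refine ⟨max L 1, lt_max_of_lt_right one_pos, fun x hx => ?_⟩
    by_contra hne
    have h1 := hL (subset_tsupport B (Function.mem_support.2 hne))
    rw [Metric.mem_ball, dist_zero_right, Real.norm_eq_abs] at h1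
    linarith [le_abs_self x, le_max_left L 1]
  have hVQ : ∀ x, L ≤ x → V x = Q x := fun x hx => by simp [hQdef, hL x hx]
  have hQk : ∀ x, Q x < k ^ 2 := fun x => (hQ x).trans (by positivity)
  have hroot : ∀ x, L ≤ x → eikonal V k x = wkbRoot Q x (k ^ 2 : ℝ) := fun x hx =>
    eikonal_eq_wkbRoot hk (hVQ x hx) (hQ x)
  have hec := continuous_eikonal hV hk
  have hrc : Continuous fun x => wkbRoot Q x (k ^ 2 : ℝ) := by
    rw [show (fun x => wkbRoot Q x (k ^ 2 : ℝ)) = _ from funext fun x => wkbRoot_ofReal (hQk x)]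
    have : Continuous Q := hV.add hBc
    fun_prop
  -- V and Q agree beyond L, so the phases computed with V and with Q differ there by a constant,
  -- absorbed into the factor c = e^d.
  set d : ℂ := wkbPhase Q L (k ^ 2 : ℝ) - phase V k L with hd
  have hphase : ∀ x, L ≤ x → phase V k x = wkbPhase Q x (k ^ 2 : ℝ) - d := by
    intro x hx
    have h1 := intervalIntegral.integral_add_adjacent_intervals (hec.intervalIntegrable (μ := volume) 0 L)
      (hec.intervalIntegrable L x)
    have h2 := intervalIntegral.integral_add_adjacent_intervals (hrc.intervalIntegrable (μ := volume) 0 L)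
      (hrc.intervalIntegrable L x)
    have h3 : ∫ y in L..x, eikonal V k y = ∫ y in L..x, wkbRoot Q y (k ^ 2 : ℝ) :=
      intervalIntegral.integral_congr fun y hy => by
        rw [Set.uIcc_of_le hx] at hy
        exact hroot y hy.1
    rw [hd]
    simp only [phase, wkbPhase]
    rw [← h1, ← h2, h3]
    ring
  set c : ℂ := Complex.exp d with hc
  have hc0 : c ≠ 0 := Complex.exp_ne_zero _
  have hexp : ∀ x, L ≤ x → Complex.exp (-phase V k x) = c * Complex.exp (-wkbPhase Q x (k ^ 2 : ℝ)) := by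
    intro x hx
    rw [hphase x hx, hc, ← Complex.exp_add]
    ring_nf
  have hsol := (hu.isSol hz).const_mul c
  refine ⟨fun x => c * u x (k ^ 2 : ℝ), c * ((Real.exp (∫ y in Set.Ioi (0 : ℝ), (eikonal V k y).re) : ℝ) : ℂ),
    ?_, ⟨hsol.isSolution hV, ?_, ?_⟩, fun x => ?_⟩
  -- The modulus of c is exp(-∫_0^∞ Re F), because the phase built from Q is purely imaginary; the
  -- normalization of θ_+ cancels exactly this.
  · have h1 : ∫ y in Set.Ioi (0 : ℝ), (eikonal V k y).re = (phase V k L).re := by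
      rw [phase_re hV hk, intervalIntegral.integral_of_le hL0.le]
      refine (setIntegral_eq_of_subset_of_forall_sdiff_eq_zero measurableSet_Ioi Set.Ioc_subset_Ioi_self
        fun x hx => ?_)
      have hxL : L ≤ x := by
        by_contra! hlt
        exact hx.2 ⟨hx.1, hlt.le⟩
      rw [eikonal_re V hk, hVQ x hxL, Real.sqrt_eq_zero_of_nonpos (by linarith [hQk x])]
    have h2 : (wkbPhase Q L (k ^ 2 : ℝ)).re = 0 := by
      rw [wkbPhase_ofReal hQk]
      simp
    rw [norm_mul, Complex.norm_real, Real.norm_of_nonneg (Real.exp_pos _).le, hc, Complex.norm_exp, h1,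
      ← Real.exp_add, hd, Complex.sub_re, h2]
    simp
  · refine (hu.asymp _ hz).congr' ?_
    filter_upwards [eventually_ge_atTop L] with x hx
    rw [hexp x hx, hroot x hx, mul_left_comm, mul_div_mul_left _ _ hc0]
  · have h1 : deriv (fun x => c * u x (k ^ 2 : ℝ)) = fun x => c * u' x (k ^ 2 : ℝ) :=
      funext fun x => (hsol.hasDerivAt x).deriv
    rw [h1]
    refine (hu.asymp' _ hz).congr' ?_
    filter_upwards [eventually_ge_atTop L] with x hx
    rw [hexp x hx, hroot x hx, mul_left_comm, mul_div_mul_left _ _ hc0]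
  · rw [jostPlus, abs_of_pos hk]
    push_cast
    ring

theorem eikonal_comp_neg (V : ℝ → ℝ) (k x : ℝ) : eikonal (fun x => V (-x)) k x = eikonal V k (-x) := rfl

theorem phase_comp_neg (V : ℝ → ℝ) (k x : ℝ) : phase (fun x => V (-x)) k x = -phase V k (-x) := by
  simp only [phase, eikonal_comp_neg]
  rw [intervalIntegral.integral_comp_neg (fun y => eikonal V k y), neg_zero,
    intervalIntegral.integral_symm]

theorem IsSolution.comp_neg {V : ℝ → ℝ} {l : ℝ} {u : ℝ → ℂ} (h : IsSolution (fun x => V (-x)) l u) :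
    IsSolution V l fun x => u (-x) := by
  refine ⟨h.1.comp contDiff_neg, fun x => ?_⟩
  have h1 : deriv (fun x => u (-x)) = fun x => -deriv u (-x) := funext fun x => deriv_comp_neg u x
  have h2 : deriv (fun x => -deriv u (-x)) x = deriv (deriv u) (-x) := by
    rw [deriv.fun_neg, deriv_comp_neg, neg_neg]
  rw [h1, h2]
  have h3 := h.2 (-x)
  simp only [neg_neg] at h3
  exact h3

/-- The phase is odd under reflection, which turns e^(-S) at +∞ into e^(S) at -∞ and flips the sign
of the derivative. -/
theorem IsQuasiclassicalPlus.reflect {V : ℝ → ℝ} {k : ℝ} {η : ℝ → ℂ}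
    (h : IsQuasiclassicalPlus (fun x => V (-x)) k η) : IsQuasiclassicalMinus V k fun x => η (-x) := by
  refine ⟨h.1.comp_neg, ?_, ?_⟩
  · refine (h.2.1.comp tendsto_neg_atBot_atTop).congr fun x => ?_
    simp only [Function.comp, eikonal_comp_neg, phase_comp_neg, neg_neg]
  · refine (h.2.2.comp tendsto_neg_atBot_atTop).congr fun x => ?_
    simp only [Function.comp, eikonal_comp_neg, phase_comp_neg, neg_neg]
    rw [deriv_comp_neg, neg_mul, div_neg, neg_div]

theorem jostMinus_reflect (V : ℝ → ℝ) (k : ℝ) (η : ℝ → ℂ) (x : ℝ) :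
    jostMinus V k (fun x => η (-x)) x = jostPlus (fun x => V (-x)) k η (-x) := by
  simp only [jostMinus, jostPlus, eikonal_comp_neg]
  rw [integral_comp_neg_Ioi 0 fun y => (eikonal V k y).re, neg_zero, integral_Iic_eq_integral_Iio]

/-! ### Bounded solutions as generalized eigenfunctions -/

theorem integrable_mul_schwartz {g : ℝ → ℂ} (hg : Continuous g) (hb : ∃ C, ∀ x, ‖g x‖ ≤ C)
    (f : 𝓢(ℝ, ℂ)) : Integrable fun x => g x * f x := by
  obtain ⟨C, hC⟩ := hb
  exact f.integrable.bdd_mul (c := C) hg.aestronglyMeasurable (Eventually.of_forall hC)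

/-- The function u'f - u f' is integrable with integrable derivative, so the integral of the
derivative vanishes; bounded u, u' and V are enough against a Schwartz function. -/
theorem IsSol.isDistribEigenfunction {V : ℝ → ℝ} (hV : Continuous V) (hVb : ∃ M, ∀ x, |V x| ≤ M) {l : ℝ}
    {u u' : ℝ → ℂ} (h : IsSol V l u u') (hu : ∃ C, ∀ x, ‖u x‖ ≤ C) (hu' : ∃ C, ∀ x, ‖u' x‖ ≤ C) (c : ℝ) :
    IsDistribEigenfunction (fun x => V x + c) (l + c) u := by
  intro f
  set f₁ : 𝓢(ℝ, ℂ) := SchwartzMap.derivCLM ℂ ℂ f with hf₁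
  set f₂ : 𝓢(ℝ, ℂ) := SchwartzMap.derivCLM ℂ ℂ f₁ with hf₂
  have e₁ : ∀ x, deriv f x = f₁ x := fun x => (SchwartzMap.derivCLM_apply ℂ f x).symm
  have e₂ : ∀ x, deriv (deriv f) x = f₂ x := fun x => by
    rw [show deriv f = f₁ from funext e₁]
    exact (SchwartzMap.derivCLM_apply ℂ f₁ x).symm
  have hd : ∀ x, HasDerivAt f (f₁ x) x := fun x => by
    rw [← e₁ x]
    exact f.differentiableAt.hasDerivAt
  have hd₁ : ∀ x, HasDerivAt f₁ (f₂ x) x := fun x => by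
    rw [hf₂, SchwartzMap.derivCLM_apply]
    exact f₁.differentiableAt.hasDerivAt
  obtain ⟨M, hM⟩ := hVb
  have hVu : Continuous (fun x => (V x : ℂ) * u x) ∧ ∃ C, ∀ x, ‖(V x : ℂ) * u x‖ ≤ C := by
    obtain ⟨C, hC⟩ := hu
    refine ⟨(Complex.continuous_ofReal.comp hV).mul h.continuous, M * C, fun x => ?_⟩
    rw [norm_mul, Complex.norm_real]
    exact mul_le_mul (hM x) (hC x) (norm_nonneg _) ((abs_nonneg _).trans (hM x))
  have i0 := integrable_mul_schwartz h.continuous hu f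
  have i2 := integrable_mul_schwartz h.continuous hu f₂
  have iV := integrable_mul_schwartz hVu.1 hVu.2 f
  have ic : Integrable fun x => (c : ℂ) * (u x * f x) := i0.const_mul _
  have il : Integrable fun x => ((l + c : ℝ) : ℂ) * (u x * f x) := i0.const_mul _
  have iT : Integrable fun x => u x * (-deriv (deriv f) x + ((V x + c : ℝ) : ℂ) * f x) := by
    refine ((iV.add ic).sub i2).congr (Eventually.of_forall fun x => ?_)
    simp only [Pi.add_apply, Pi.sub_apply, e₂]
    push_cast
    ring
  refine ⟨iT, ?_⟩
  have hderiv : ∀ x, HasDerivAt (fun x => u' x * f x - u x * f₁ x)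
      (u x * (-deriv (deriv f) x + ((V x + c : ℝ) : ℂ) * f x) - ((l + c : ℝ) : ℂ) * (u x * f x)) x := by
    intro x
    refine (((h.hasDerivAt' x).mul (hd x)).sub ((h.hasDerivAt x).mul (hd₁ x))).congr_deriv ?_
    rw [e₂]
    push_cast
    ring
  have iW : Integrable fun x => u' x * f x - u x * f₁ x :=
    (integrable_mul_schwartz h.continuous' hu' f).sub (integrable_mul_schwartz h.continuous hu f₁)
  have h0 := integral_eq_zero_of_hasDerivAt_of_integrable hderiv (iT.sub il) iW
  rw [integral_sub iT il, integral_const_mul, sub_eq_zero] at h0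
  exact h0

theorem isTemperedFunction_of_bounded {g : ℝ → ℂ} (hg : Continuous g) (hb : ∃ C, ∀ x, ‖g x‖ ≤ C) :
    IsTemperedFunction g := by
  have hi := integrable_mul_schwartz hg hb
  obtain ⟨C, hC⟩ := hb
  obtain ⟨k, D, hD0, hD⟩ := SchwartzMap.norm_toLp_le_seminorm ℂ ℂ (E := ℝ) 1 volume
  have hC0 : 0 ≤ C := (norm_nonneg _).trans (hC 0)
  refine ⟨SchwartzMap.mkCLMtoNormedSpace (fun f => ∫ x, g x * f x) (fun f₁ f₂ => ?_) (fun a f => ?_)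
    ⟨Finset.Iic (k, 0), C * D, by positivity, fun f => ?_⟩, fun f => ⟨hi f, rfl⟩⟩
  · rw [← integral_add (hi f₁) (hi f₂)]
    refine integral_congr_ae (Eventually.of_forall fun x => ?_)
    simp [mul_add]
  · rw [RingHom.id_apply, ← integral_smul]
    refine integral_congr_ae (Eventually.of_forall fun x => ?_)
    simp only [_root_.smul_apply, smul_eq_mul]
    ring
  · have h1 : ‖∫ x, g x * f x‖ ≤ C * ∫ x, ‖f x‖ := by
      rw [← integral_const_mul]
      refine norm_integral_le_of_norm_le (f.integrable.norm.const_mul C) (Eventually.of_forall fun x => ?_)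
      rw [norm_mul]
      exact mul_le_mul_of_nonneg_right (hC x) (norm_nonneg _)
    have h2 : ∫ x, ‖f x‖ = ‖f.toLp 1 volume‖ := by
      rw [L1.norm_eq_integral_norm]
      refine integral_congr_ae ?_
      filter_upwards [f.coeFn_toLp 1 volume] with x hx
      rw [hx]
    rw [h2] at h1
    refine h1.trans ?_
    rw [mul_assoc]
    exact mul_le_mul_of_nonneg_left (hD f) hC0

theorem pairing_mul_pairing {J : Type*} (X : J → ℝ → ℂ) (f g : ℝ → ℂ) (j : J) :
    pairing f (X j) * pairing (X j) g = conj (kernelTransform X f j) * kernelTransform X g j := by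
  have h1 : pairing f (X j) = conj (kernelTransform X f j) := by
    rw [pairing, kernelTransform, ← integral_conj]
    refine integral_congr_ae (Eventually.of_forall fun x => ?_)
    simp only [map_mul, Complex.conj_conj]
    ring
  rw [h1]
  rfl

/-- A countable set is enumerated by `ℕ` or by a finite set of integers. -/
theorem exists_enumeration {α : Type*} {S : Set α} (hS : S.Countable) :
    ∃ (I : Set ℕ) (e : I → α), (I = Set.univ ∨ I.Finite) ∧ Function.Injective e ∧ Set.range e = S := by
  have key : ∀ {I : Set ℕ} (E : I ≃ S), Function.Injective (fun i => (E i : α)) ∧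
      Set.range (fun i => (E i : α)) = S := fun E =>
    ⟨Subtype.val_injective.comp E.injective, by
      rw [← Function.comp_def, Set.range_comp, E.surjective.range_eq, Set.image_univ,
        Subtype.range_coe]⟩
  have := hS.to_subtype
  rcases finite_or_infinite S with h | h
  · obtain ⟨n, ⟨E⟩⟩ := Finite.exists_equiv_fin S
    exact ⟨{i | i < n}, _, Or.inr (Set.finite_lt_nat n), key ((E.trans Fin.equivSubtype).symm)⟩
  · obtain ⟨D⟩ := nonempty_denumerable S
    exact ⟨Set.univ, _, Or.inl rfl, key ((Equiv.Set.univ ℕ).trans (Denumerable.eqv S).symm)⟩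

/-! ### Distorted plane waves and quasiclassical solutions -/

/-- Since θ_+ = p √k a and θ_- = q √k b with unimodular p, q, one finds m = p q W / (2i). Thus m⁻¹
θ_+ and m⁻¹ θ_- differ from the waves 2√k a / W and 2√k b / W only by the phases i/q and i/p. -/
theorem exists_isQuasiclassicalFamily {V B D : ℝ → ℝ} {u u' v v' : ℝ → ℂ → ℂ} (hV : Continuous V)
    (hB : HasCompactSupport B) (hBc : Continuous B) (hQp : ∀ x, V x + B x < 0)
    (hu : IsWKBFamily V (fun x => V x + B x) closedQuadrant u u')
    (hD : HasCompactSupport D) (hDc : Continuous D) (hQm : ∀ x, V (-x) + D x < 0)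
    (hv : IsWKBFamily (fun x => V (-x)) (fun x => V (-x) + D x) closedQuadrant v v')
    (hp : IsScatteringPair V u u' (fun x z => v (-x) z) (fun x z => -v' (-x) z)) :
    ∃ (ηp ηm : ℝ → ℝ → ℂ) (w : ℝ → ℂ), (∀ k, ‖w k‖ = 1) ∧ IsQuasiclassicalFamily V ηp ηm fun k x =>
      w k * distortedWave u u' (fun x z => v (-x) z) (fun x z => -v' (-x) z) k x := by
  choose! η p hη1 hη hηu using fun (k : ℝ) (hk : 0 < k) => exists_quasiclassicalPlus hV hB hBc hQp hu hk
  choose! ξ q hξ1 hξ hξu using fun (k : ℝ) (hk : 0 < k) =>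
    exists_quasiclassicalPlus (hV.comp continuous_neg) hD hDc hQm hv hk
  set b : ℝ → ℂ → ℂ := fun x z => v (-x) z with hb
  set b' : ℝ → ℂ → ℂ := fun x z => -v' (-x) z with hb'
  -- The value 1 at k = 0 is arbitrary, nothing being prescribed there.
  refine ⟨η, fun k x => ξ k (-x), fun k => if 0 < k then Complex.I / q k else
    if k < 0 then Complex.I / p (-k) else 1, fun k => ?_, fun k hk => ?_⟩
  · beta_reduce
    split_ifs with h1 h2
    · rw [norm_div, hξ1 k h1, Complex.norm_I, div_one]
    · rw [norm_div, hη1 (-k) (by linarith), Complex.norm_I, div_one]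
    · exact norm_one
  have hz := ofReal_mem_closedQuadrant (sq_nonneg k)
  have hθp : jostPlus V k (η k) = fun x => p k * Real.sqrt k * u x (k ^ 2 : ℝ) := funext (hηu k hk)
  have hθm : jostMinus V k (fun x => ξ k (-x)) = fun x => q k * Real.sqrt k * b x (k ^ 2 : ℝ) :=
    funext fun x => by
      rw [jostMinus_reflect]
      exact hξu k hk (-x)
  have hsk : (Real.sqrt k : ℂ) ≠ 0 := Complex.ofReal_ne_zero.2 (Real.sqrt_pos.2 hk).ne'
  have hk' : (Real.sqrt k : ℂ) * Real.sqrt k = k := by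
    rw [← Complex.ofReal_mul, Real.mul_self_sqrt hk.le]
  have hk0 : (k : ℂ) ≠ 0 := Complex.ofReal_ne_zero.2 hk.ne'
  have hp0 : p k ≠ 0 := norm_ne_zero_iff.1 (by rw [hη1 k hk]; exact one_ne_zero)
  have hq0 : q k ≠ 0 := norm_ne_zero_iff.1 (by rw [hξ1 k hk]; exact one_ne_zero)
  have hW := hp.jostW_ne_zero (sq_nonneg k)
  have hm : jostM k (jostPlus V k (η k)) (jostMinus V k fun x => ξ k (-x)) =
      p k * q k * jostW u u' b b' (k ^ 2 : ℝ) / (2 * Complex.I) := by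
    have d1 := (((hp.pair.solA _ hz).hasDerivAt 0).const_mul (p k * Real.sqrt k)).deriv
    have d2 := (((hp.pair.solB _ hz).hasDerivAt 0).const_mul (q k * Real.sqrt k)).deriv
    rw [hθp, hθm, jostM, wronskianAt, d1, d2, jostW]
    rw [inv_mul_eq_div, div_eq_div_iff (by simp [hk0]) (by simp)]
    linear_combination (2 * Complex.I * p k * q k * (u' 0 (k ^ 2 : ℝ) * b 0 (k ^ 2 : ℝ) -
      u 0 (k ^ 2 : ℝ) * b' 0 (k ^ 2 : ℝ))) * hk'
  refine ⟨hη k hk, (hξ k hk).reflect, ?_, fun x => ?_, fun x => ?_⟩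
  · rw [hm]
    exact div_ne_zero (mul_ne_zero (mul_ne_zero hp0 hq0) hW) (by simp)
  · rw [hm, hθp]
    simp only [if_pos hk, distortedWave, abs_of_pos hk]
    field_simp
  · rw [hm, hθm]
    simp only [if_neg (show ¬ 0 < -k by linarith), if_pos (neg_lt_zero.2 hk), neg_neg, distortedWave,
      abs_neg, abs_of_pos hk, neg_sq]
    field_simp

theorem exists_norm_le_add {V B : ℝ → ℝ} (hV : ∃ M, ∀ x, |V x| ≤ M) (hB : HasCompactSupport B)
    (hBc : Continuous B) : ∃ M, ∀ x, |V x + B x| ≤ M := by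
  obtain ⟨M, hM⟩ := hV
  obtain ⟨N, hN⟩ := hB.exists_bound_of_continuous hBc
  exact ⟨M + N, fun x => (abs_add_le _ _).trans (add_le_add (hM x) (hN x))⟩

/-- The distorted plane waves are bounded uniformly in the energy. -/
theorem exists_norm_distortedWave_le {V Q R : ℝ → ℝ} {u u' v v' : ℝ → ℂ → ℂ}
    (hQ : ∀ x, Q x < 0) (hu : IsWKBFamily V Q closedQuadrant u u') (hR : ∀ x, R x < 0)
    (hv : IsWKBFamily (fun x => V (-x)) R closedQuadrant v v')
    (hp : IsScatteringPair V u u' (fun x z => v (-x) z) (fun x z => -v' (-x) z)) :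
    ∃ C, ∀ k x, ‖distortedWave u u' (fun x z => v (-x) z) (fun x z => -v' (-x) z) k x‖ ≤ C := by
  obtain ⟨C, hC⟩ := hu.norm_le hQ
  obtain ⟨D, hD⟩ := hv.norm_le hR
  refine ⟨max C D, fun k x => ?_⟩
  have hW := hp.two_le_norm_jostW (sq_nonneg k)
  have hz := ofReal_mem_closedQuadrant (sq_nonneg |k|)
  have hCD : 0 < k ∨ k = 0 ∨ k < 0 := by
    rcases lt_trichotomy k 0 with h | h | h <;> simp [h]
  have key : ∀ y : ℂ, Real.sqrt |k| * ‖y‖ ≤ max C D →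
      ‖2 * Real.sqrt |k| / jostW u u' (fun x z => v (-x) z) (fun x z => -v' (-x) z) (k ^ 2 : ℝ) * y‖ ≤
        max C D := by
    intro y hy
    rw [norm_mul, norm_div, norm_mul, Complex.norm_real, Real.norm_of_nonneg (Real.sqrt_nonneg _),
      Complex.norm_two, div_mul_eq_mul_div, div_le_iff₀ (two_pos.trans_le hW), mul_assoc]
    have h0 : 0 ≤ Real.sqrt |k| * ‖y‖ := by positivity
    nlinarith
  rw [distortedWave]
  refine key _ ?_
  rw [← sq_abs]
  -- At k = 0 the factor √|k| kills the wave, and only nonnegativity of the bound is needed.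
  rcases eq_or_ne k 0 with rfl | hk0
  · have h1 := hC 1 one_pos (ofReal_mem_closedQuadrant (sq_nonneg 1)) 0
    have : 0 ≤ C := le_trans (by positivity) h1
    simpa using Or.inl this
  have hk := abs_pos.2 hk0
  split_ifs
  · exact (hC _ hk hz x).trans (le_max_left _ _)
  · exact (hD _ hk hz (-x)).trans (le_max_right _ _)

/-- The resolution of the identity by bound states and distorted plane waves. -/
theorem IsScatteringPair.exists_isEigenfunctionBasis {V : ℝ → ℝ} {μ : ℝ} {φ : ℝ → ℝ → ℂ}
    {a a' b b' : ℝ → ℂ → ℂ} (hμ0 : 0 < μ) (hμ : μ < 2) (hV : IsSymbol (-μ) V) (hφ : IsBoundStates V φ)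
    (h : IsScatteringPair V a a' b b') (ha : ∀ l : ℝ, 0 ≤ l → ∃ C, ∀ x, ‖a' x l‖ ≤ C)
    (hb : ∀ l : ℝ, 0 ≤ l → ∃ C, ∀ x, ‖b' x l‖ ≤ C) (hd : ∃ C, ∀ k x, ‖distortedWave a a' b b' k x‖ ≤ C)
    {w : ℝ → ℂ} (hw : ∀ k, ‖w k‖ = 1) (m : ℝ) :
    ∃ (I : Set ℕ) (ev : I → ℝ) (Φ : I → ℝ → ℂ),
      IsEigenfunctionBasis V m I ev Φ fun k x => w k * distortedWave a a' b b' k x := by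
  have hVc := hV.1.continuous
  have hVb := hV.bounded hμ0
  obtain ⟨I, e, hI, he, heS⟩ := exists_enumeration hφ.countable
  have hne : ∀ i, e i < 0 := fun i => by
    by_contra! hi
    have h1 : e i ∈ {l | φ l ≠ fun _ => 0} := heS ▸ Set.mem_range_self i
    exact h1 (hφ.eq_zero _ hi)
  choose Φ' hΦ using fun i => hφ.sol (e i) (hne i)
  have hΦb : ∀ i, ∃ C, ∀ x, ‖φ (e i) x‖ ≤ C := fun i => (hΦ i).right.bounded_univ (hΦ i).left
  have hΦc : ∀ i, Continuous (φ (e i)) := fun i => (hΦ i).isSol.continuous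
  have hΨ : ∀ k, Continuous (distortedWave a a' b b' k) ∧ ∃ C, ∀ x, ‖distortedWave a a' b b' k x‖ ≤ C := by
    obtain ⟨C, hC⟩ := hd
    exact fun k => ⟨h.continuous_distortedWave k, C, hC k⟩
  have hΨw : ∀ k, Continuous (fun x => w k * distortedWave a a' b b' k x) ∧
      ∃ C, ∀ x, ‖w k * distortedWave a a' b b' k x‖ ≤ C := fun k => by
    obtain ⟨h1, C, hC⟩ := hΨ k
    refine ⟨continuous_const.mul h1, C, fun x => ?_⟩
    rw [norm_mul, hw, one_mul]
    exact hC x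
  -- The Parseval sum runs over all real l; this reduces it to the enumerated eigenvalues.
  have hsupp : ∀ f : ℝ → ℂ, Function.support (fun l : ℝ => ‖∫ x, conj (φ l x) * f x‖ ^ 2) ⊆ Set.range e := by
    intro f l hl
    rw [heS]
    intro h0
    refine hl ?_
    simp [h0]
  have hres := resolution_of_parseval_test (φ := fun i => φ (e i)) (fun i => ⟨hΦc i, hΦb i⟩) hΨ
    (fun f hf => h.aestronglyMeasurable_distortedWave hf) fun f hf => by
      obtain ⟨h1, h2, h3⟩ := h.parseval_test hμ0 hμ hV hφ hf
      refine ⟨h1.comp_injective he, h2, ?_⟩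
      rw [← h3, ← he.tsum_eq (hsupp f)]
      rfl
  -- The phases are unimodular and cancel in each rank-one form, so no measurability of `w` is
  -- needed.
  have hpair : ∀ (f g : ℝ → ℂ) k, pairing f (fun x => w k * distortedWave a a' b b' k x) *
      pairing (fun x => w k * distortedWave a a' b b' k x) g =
      conj (kernelTransform (distortedWave a a' b b') f k) *
        kernelTransform (distortedWave a a' b b') g k := by
    intro f g k
    rw [pairing_mul_pairing (fun k x => w k * distortedWave a a' b b' k x) f g k]
    have h1 : ∀ f : ℝ → ℂ, kernelTransform (fun k x => w k * distortedWave a a' b b' k x) f k =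
        conj (w k) * kernelTransform (distortedWave a a' b b') f k := fun f => by
      rw [kernelTransform, kernelTransform, ← integral_const_mul]
      refine integral_congr_ae (Eventually.of_forall fun x => ?_)
      simp only [map_mul]
      ring
    have h2 : w k * conj (w k) = 1 := by
      rw [Complex.mul_conj, Complex.normSq_eq_norm_sq, hw]
      simp
    rw [h1, h1, map_mul, Complex.conj_conj]
    linear_combination (conj (kernelTransform (distortedWave a a' b b') f k) *
        kernelTransform (distortedWave a a' b b') g k) * h2
  refine ⟨I, fun i => e i + m ^ 2, fun i => φ (e i), ?_⟩
  refine ⟨hI, fun i => ?_, fun k => ?_, fun i => ?_, fun i => by linarith [hne i], fun k => ?_,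
    fun f g => ?_, fun f g => ?_, fun f g => ?_⟩
  · rw [memLp_two_iff_integrable_sq_norm (hΦc i).aestronglyMeasurable]
    exact (hΦ i).integrable_sq
  · exact isTemperedFunction_of_bounded (hΨw k).1 (hΨw k).2
  · exact (hΦ i).isSol.isDistribEigenfunction hVc hVb (hΦb i) ((hΦ i).right'.bounded_univ (hΦ i).left') _
  -- A wave is a multiple of a or of b according to the sign of k, and the derivatives of both are
  -- bounded at each nonnegative energy.
  · have hz := ofReal_mem_closedQuadrant (sq_nonneg k)
    obtain ⟨u, u', hu, hwu, C, hC⟩ : ∃ u u' : ℝ → ℂ, IsSol V (k ^ 2 : ℝ) u u' ∧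
        (∃ c : ℂ, distortedWave a a' b b' k = fun x => c * u x) ∧ ∃ C, ∀ x, ‖u' x‖ ≤ C := by
      unfold distortedWave
      split_ifs
      · exact ⟨_, _, h.pair.solA _ hz, ⟨_, rfl⟩, ha _ (sq_nonneg k)⟩
      · exact ⟨_, _, h.pair.solB _ hz, ⟨_, rfl⟩, hb _ (sq_nonneg k)⟩
    obtain ⟨c, hc⟩ := hwu
    have hbd := (hΨw k).2
    simp only [hc, ← mul_assoc] at hbd ⊢
    refine (hu.const_mul (w k * c)).isDistribEigenfunction hVc hVb hbd ⟨‖w k * c‖ * C, fun x => ?_⟩ _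
    rw [norm_mul]
    exact mul_le_mul_of_nonneg_left (hC x) (norm_nonneg _)
  · simp only [pairing_mul_pairing (fun i => φ (e i))]
    exact (hres f g).1
  · simp only [hpair]
    exact (hres f g).2.1
  · simp only [hpair, pairing_mul_pairing (fun i => φ (e i))]
    rw [pairing, ← (hres f g).2.2]
    push_cast
    rw [one_div]

/-! ### Condition (BM2) and conclusion -/

/-- The weight is at least 1, so a bound uniform in x and k suffices. -/
theorem conditionBM2_of_bounded {μ : ℝ} (hμ : 0 < μ) {ψ : ℝ → ℝ → ℂ} (h : ∃ C, ∀ k x, ‖ψ k x‖ ≤ C) :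
    ConditionBM2 (fun x => bracket x ^ (μ / 4)) ψ := by
  obtain ⟨C, hC⟩ := h
  refine ⟨C.toNNReal, fun k => ?_⟩
  rw [eLpNorm_exponent_top]
  refine eLpNormEssSup_le_of_ae_bound (Eventually.of_forall fun x => ?_)
  have h1 : 1 ≤ bracket x ^ (μ / 4) := Real.one_le_rpow (one_le_bracket x) (by positivity)
  rw [norm_mul, norm_inv, Complex.norm_real, Real.norm_of_nonneg (zero_le_one.trans h1)]
  exact (mul_le_of_le_one_left (norm_nonneg _) (inv_le_one_of_one_le₀ h1)).trans (hC k x)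

theorem mainTheorem10 (V : ℝ → ℝ) (μ m : ℝ) (hμ_pos : 0 < μ) (hμ_lt : μ < 2) (hm : 0 ≤ m)
    (hV : IsSymbol (-μ) V)
    (hneg : ∃ c R : ℝ, 0 < c ∧ 0 < R ∧ ∀ x : ℝ, R ≤ |x| → V x ≤ -c * bracket x ^ (-μ))
    (hres : ¬ HasZeroEnergyResonance V) :
    ∃ (ηp ηm ψ : ℝ → ℝ → ℂ) (I : Set ℕ) (ev : I → ℝ) (φ : I → ℝ → ℂ),
      IsQuasiclassicalFamily V ηp ηm ψ ∧
      IsEigenfunctionBasis V m I ev φ ψ ∧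
      ConditionBM2 (fun x => bracket x ^ (μ / 4)) ψ := by
  have hVc := hV.1.continuous
  have hVb := hV.bounded hμ_pos
  obtain ⟨B, hB, hBc, hQp, u, u', hu, hud⟩ := exists_quadrant_family hμ_pos hμ_lt hV hneg
  obtain ⟨D, hD, hDc, hQm, v, v', hv, hvd⟩ := exists_quadrant_family hμ_pos hμ_lt hV.comp_neg
    (IsNegativeNearInfinity.comp_neg hneg)
  have hp := isScatteringPair_of_families hu hud hQp hv hvd hQm
  obtain ⟨φ, hφ⟩ := exists_isBoundStates hμ_pos hμ_lt hV
  obtain ⟨ηp, ηm, w, hw, hη⟩ := exists_isQuasiclassicalFamily hVc hB hBc hQp hu hD hDc hQm hv hp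
  obtain ⟨C, hC⟩ := exists_norm_distortedWave_le hQp hu hQm hv hp
  have hu' : ∀ l : ℝ, 0 ≤ l → ∃ C, ∀ x, ‖u' x l‖ ≤ C := fun l hl => by
    obtain ⟨M, hM⟩ := exists_norm_le_add hVb hB hBc
    exact hu.norm_deriv_le (fun x => (hQp x).trans_le hl) hM (ofReal_mem_closedQuadrant hl)
  have hv' : ∀ l : ℝ, 0 ≤ l → ∃ C, ∀ x, ‖-v' (-x) l‖ ≤ C := fun l hl => by
    obtain ⟨M, hM⟩ := exists_norm_le_add (hV.comp_neg.bounded hμ_pos) hD hDc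
    obtain ⟨C, hC⟩ := hv.norm_deriv_le (fun x => (hQm x).trans_le hl) hM (ofReal_mem_closedQuadrant hl)
    exact ⟨C, fun x => by
      rw [norm_neg]
      exact hC (-x)⟩
  obtain ⟨I, ev, Φ, hΦ⟩ := hp.exists_isEigenfunctionBasis hμ_pos hμ_lt hV hφ hu' hv' ⟨C, hC⟩ hw m
  refine ⟨ηp, ηm, _, I, ev, Φ, hη, hΦ, conditionBM2_of_bounded hμ_pos ⟨C, fun k x => ?_⟩⟩
  rw [norm_mul, hw, one_mul]
  exact hC k x
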